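/- Let $F$ be a finite extension of $\mathbb{Q}_p$ with ring of integers $\mathcal{O}$, uniformizer $\pi$ and residue field $\mathbb{F}_q$, and let $G_0$ be a one-dimensional formal $\mathcal{O}$-module law of height $n\ge 1$ over $\mathbb{F}_q$. Let $F^{univ}$, over $\mathcal{O}[[x_1,\dots,x_{n-1}]]$, be a universal deformation of $G_0$: it reduces to $G_0$ modulo the maximal ideal and, for every complete noetherian local $\mathcal{O}$-algebra $R$ with residue field $\mathbb{F}_q$, every formal $\mathcal{O}$-module law over $R$ which reduces to $G_0$ is isomorphic, by an isomorphism that is the identity modulo $\mathfrak{m}_R$, to the specialization of $F^{univ}$ along a unique local homomorphism of $\mathcal{O}$-algebras $\mathcal{O}[[x_1,\dots,x_{n-1}]]\to R$. Put $\mathfrak{X}=\mathrm{Spf}\,\mathcal{O}[[x_1,\dots,x_{n-1}]]$. Let $L$ be a complete valued extension of $F$, with a valuation $v:L\to\mathbb{R}\cup\{+\infty\}$ such that $v(\pi)=1$. For a point $\underline{x}\in\mathfrak{X}(\mathcal{O}_L)$, that is, a local homomorphism of $\mathcal{O}$-algebras $\mathcal{O}[[x_1,\dots,x_{n-1}]]\to\mathcal{O}_L$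 (equivalently, a point of $\mathfrak{m}_L^{n-1}$), let $F_{\underline{x}}$ be the specialization of $F^{univ}$ at $\underline{x}$; its reduction modulo $\mathfrak{m}_L$ is the base change of $G_0$. For $1\le i\le n$, let $-\lambda_{i,\underline{x}}$ be the slope, between the abscissas $q^{i-1}$ and $q^i$, of the Newton polygon of the series $[\pi]_{F_{\underline{x}}}(T)=\sum_k a_kT^k$, i.e. of the lower convex hull of the points $(k,v(a_k))$, so that $\lambda_{1,\underline{x}}\ge\dots\ge\lambda_{n,\underline{x}}$. Let $$\mathcal{H}(L)=\Big\{\underline{x}\in\mathfrak{X}(\mathcal{O}_L)\ \Big|\ \frac{\lambda_{1,\underline{x}}}{q^n}<\lambda_{n,\underline{x}}\Big\}.$$ Proposition 4.2. Let $\underline{x},\underline{x}'\in\mathcal{H}(L)$. If there is an isogeny of formal $\mathcal{O}$-modules $f:F_{\underline{x}}\to F_{\underline{x}'}$ which deforms a power of $\pi$, i.e. whose reduction modulo $\mathfrak{m}_L$ is the endomorphism $[\pi^m]$ of $G_0$ for some integer $m\ge 0$, then $\underline{x}=\underline{x}'$. -/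

import Mathlib

open IsLocalRing

universe u v

noncomputable section

namespace LubinTate

/-! ### One-dimensional formal `O`-modules -/

/-- A one-dimensional formal `O`-module law over the `O`-algebra `R`: a commutative formal group
law over `R` with an action `a ↦ [a](T)` of `O` by endomorphisms such that `[a](T) ≡ a T`
modulo `T ^ 2` (that is, `O` acts on the Lie algebra through the structure map `O → R`). -/
@[ext]
structure FormalModule (O : Type*) (R : Type*) [CommRing O] [CommRing R] [Algebra O R]
    extends FormalGroup R where
  comm : toPowerSeries = toPowerSeries.subst ![MvPowerSeries.X 1, MvPowerSeries.X 0]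
  /-- the series `[a](T)` -/
  act : O → PowerSeries R
  act_constantCoeff : ∀ a, PowerSeries.constantCoeff (act a) = 0
  act_coeff_one : ∀ a, PowerSeries.coeff 1 (act a) = algebraMap O R a
  /-- `[a](F(X, Y)) = F([a](X), [a](Y))` -/
  act_hom : ∀ a, (act a).subst toPowerSeries =
    toPowerSeries.subst ![(act a).subst (MvPowerSeries.X 0 : MvPowerSeries (Fin 2) R),
      (act a).subst (MvPowerSeries.X 1 : MvPowerSeries (Fin 2) R)]
  /-- `[a + b](T) = F([a](T), [b](T))` -/
  act_add : ∀ a b, act (a + b) = toPowerSeries.subst ![act a, act b]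
  /-- `[a b](T) = [a]([b](T))` -/
  act_mul : ∀ a b, act (a * b) = (act a).subst (act b)
  act_one : act 1 = PowerSeries.X

namespace FormalModule

variable {O : Type*} {R : Type*} {S : Type*} [CommRing O] [CommRing R] [CommRing S]
  [Algebra O R] [Algebra O S]

lemma map_vec {ι : Type*} (h : R →+* S) (g₁ g₂ : MvPowerSeries ι R) :
    (fun i => (![g₁, g₂] i).map h) = ![g₁.map h, g₂.map h] := by
  ext1 i; fin_cases i <;> simp

/-- Base change of a formal `O`-module law along a morphism of `O`-algebras: apply it to all
coefficients. -/
def map (φ : R →ₐ[O] S) (G : FormalModule O R) : FormalModule O S where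
  toFormalGroup := G.toFormalGroup.map (φ : R →+* S)
  comm := by
    have h := congrArg (MvPowerSeries.map (φ : R →+* S)) G.comm
    rw [MvPowerSeries.map_subst MvPowerSeries.HasSubst.X_X, map_vec] at h
    simpa using h
  act a := (G.act a).map (φ : R →+* S)
  act_constantCoeff a := by
    have := G.act_constantCoeff a
    rw [← PowerSeries.coeff_zero_eq_constantCoeff_apply] at this ⊢
    simp [this]
  act_coeff_one a := by simp [G.act_coeff_one a]
  act_hom a := by
    have h := congrArg (MvPowerSeries.map (φ : R →+* S)) (G.act_hom a)
    have hX (i : Fin 2) : PowerSeries.HasSubst (MvPowerSeries.X i : MvPowerSeries (Fin 2) R) :=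
      PowerSeries.HasSubst.of_constantCoeff_zero (by simp)
    have h0 (i : Fin 2) : MvPowerSeries.constantCoeff
        ((G.act a).subst (MvPowerSeries.X i : MvPowerSeries (Fin 2) R)) = 0 :=
      PowerSeries.constantCoeff_subst_eq_zero (by simp) _ (G.act_constantCoeff a)
    rw [PowerSeries.map_subst (PowerSeries.HasSubst.of_constantCoeff_zero G.zero_constantCoeff),
      MvPowerSeries.map_subst (MvPowerSeries.hasSubst_of_constantCoeff_zero
        (by intro i; fin_cases i <;> simp [h0])), map_vec,
      PowerSeries.map_subst (hX 0), PowerSeries.map_subst (hX 1)] at h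
    simpa using h
  act_add a b := by
    have h := congrArg (MvPowerSeries.map (φ : R →+* S)) (G.act_add a b)
    rw [MvPowerSeries.map_subst (MvPowerSeries.hasSubst_of_constantCoeff_zero
        (by intro i; fin_cases i; exacts [G.act_constantCoeff a, G.act_constantCoeff b])),
      map_vec] at h
    exact h
  act_mul a b := by
    have h := congrArg (MvPowerSeries.map (φ : R →+* S)) (G.act_mul a b)
    rw [PowerSeries.map_subst
      (PowerSeries.HasSubst.of_constantCoeff_zero (G.act_constantCoeff b))] at h
    exact h
  act_one := by simp [G.act_one]

/-- `f(T)` is a homomorphism of formal `O`-module laws `G → G'`. -/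
structure IsHom (G G' : FormalModule O R) (f : PowerSeries R) : Prop where
  constantCoeff : PowerSeries.constantCoeff f = 0
  /-- `f(G(X, Y)) = G'(f(X), f(Y))` -/
  map_add : f.subst G.toPowerSeries =
    G'.toPowerSeries.subst ![f.subst (MvPowerSeries.X 0 : MvPowerSeries (Fin 2) R),
      f.subst (MvPowerSeries.X 1 : MvPowerSeries (Fin 2) R)]
  /-- `f([a](T)) = [a]'(f(T))` -/
  map_act : ∀ a, f.subst (G.act a) = (G'.act a).subst f

/-- `f : G → G'` is an isogeny: a homomorphism whose kernel `Spf (R⟦T⟧ / (f))` is finite and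
flat over `R`. -/
structure IsIsogeny (G G' : FormalModule O R) (f : PowerSeries R) : Prop
    extends IsHom G G' f where
  finite_ker : Module.Finite R (PowerSeries R ⧸ Ideal.span {f})
  flat_ker : Module.Flat R (PowerSeries R ⧸ Ideal.span {f})

end FormalModule

/-! ### Deformations and their universal family -/

section Deformations

variable {O : Type u} [CommRing O] [IsLocalRing O]

/-- The reduction map `R → R / 𝔪_R` of a local `O`-algebra, as a morphism of `O`-algebras. -/
abbrev reduction (O : Type*) [CommRing O] (R : Type*) [CommRing R] [IsLocalRing R] [Algebra O R] :
    R →ₐ[O] ResidueField R :=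
  IsScalarTower.toAlgHom O R (ResidueField R)

/-- The map of residue fields `k = O / 𝔪_O → R / 𝔪_R`, as a morphism of `O`-algebras. -/
def residueMap (O : Type*) [CommRing O] [IsLocalRing O]
    (R : Type*) [CommRing R] [IsLocalRing R] [Algebra O R] [IsLocalHom (algebraMap O R)] :
    ResidueField O →ₐ[O] ResidueField R where
  toRingHom := ResidueField.map (algebraMap O R)
  commutes' _ := rfl

/-- `G` is a deformation over `R` of the formal `O`-module law `G₀` over the residue field of `O`:
the reduction of `G` modulo the maximal ideal of `R` is (the base change of) `G₀`. -/
def IsDeformation (G₀ : FormalModule O (ResidueField O))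
    {R : Type*} [CommRing R] [IsLocalRing R] [Algebra O R] [IsLocalHom (algebraMap O R)]
    (G : FormalModule O R) : Prop :=
  G.map (reduction O R) = G₀.map (residueMap O R)

/-- Two deformations over `R` are `⋆`-isomorphic: there is a homomorphism between them which is
the identity modulo the maximal ideal of `R`. (Its linear coefficient is then a unit, so that
it is an isomorphism.) -/
def StarIsomorphic {R : Type*} [CommRing R] [IsLocalRing R] [Algebra O R]
    (G G' : FormalModule O R) : Prop :=
  ∃ g : PowerSeries R, G.IsHom G' g ∧ g.map (residue R) = PowerSeries.X

instance (σ : Type*) : IsLocalHom (algebraMap O (MvPowerSeries σ O)) where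
  map_nonunit a ha := by
    rw [MvPowerSeries.isUnit_iff_constantCoeff] at ha
    simpa [MvPowerSeries.algebraMap_apply] using ha

/-- The formal `O`-module law `U` over `O⟦x_i : i ∈ σ⟧` is a universal deformation of `G₀`, i.e.
`Spf O⟦x_i⟧` together with `U` represents the functor which sends a complete
noetherian local `O`-algebra `R` with the same residue field as `O` to the set of
`⋆`-isomorphism classes of deformations of `G₀` over `R`. -/
def IsUniversalDeformation (G₀ : FormalModule O (ResidueField O)) {σ : Type*}
    (U : FormalModule O (MvPowerSeries σ O)) : Prop :=
  IsDeformation G₀ U ∧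
  ∀ (R : Type u) [CommRing R] [IsLocalRing R] [IsNoetherianRing R] [Algebra O R]
    [IsLocalHom (algebraMap O R)] [IsAdicComplete (maximalIdeal R) R],
    Function.Bijective (residueMap O R) →
    ∀ G : FormalModule O R, IsDeformation G₀ G →
      ∃! φ : MvPowerSeries σ O →ₐ[O] R, IsLocalHom φ ∧ StarIsomorphic (U.map φ) G

/-- A formal `O`-module law over the residue field `k` of `O` has height `n`: the series
`[ϖ](T)` has order `q ^ n`, where `q` is the number of elements of `k`. -/
def HasHeight (ϖ : O) (G₀ : FormalModule O (ResidueField O)) (n : ℕ) : Prop :=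
  (G₀.act ϖ).order = ((Nat.card (ResidueField O) ^ n : ℕ) : ℕ∞)

end Deformations

/-! ### Valued fields -/

/-- The valuation ring of a field with a non-archimedean absolute value. -/
abbrev ValRing (K : Type*) [NormedField K] [IsUltrametricDist K] : ValuationSubring K :=
  (NormedField.valuation (K := K)).valuationSubring

lemma mem_ValRing {K : Type*} [NormedField K] [IsUltrametricDist K] {x : K} :
    x ∈ ValRing K ↔ ‖x‖ ≤ 1 := by
  rw [Valuation.mem_valuationSubring_iff, NormedField.valuation_apply, ← NNReal.coe_le_coe]
  simp

section Extension

variable {F : Type u} {L : Type v} [NormedField F] [IsUltrametricDist F]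
  [NormedField L] [IsUltrametricDist L] [NormedAlgebra F L]

/-- The valuation ring of an extension is an algebra over the valuation ring of the base. -/
instance : Algebra (ValRing F) (ValRing L) :=
  RingHom.toAlgebra (((algebraMap F L).comp (ValRing F).subtype).codRestrict (ValRing L).toSubring
    (fun x => by
      change algebraMap F L x ∈ ValRing L
      rw [mem_ValRing, norm_algebraMap']
      exact mem_ValRing.1 x.2))

@[simp] lemma coe_algebraMap_ValRing (x : ValRing F) :
    ((algebraMap (ValRing F) (ValRing L) x : ValRing L) : L) = algebraMap F L x := rfl

instance : IsLocalHom (algebraMap (ValRing F) (ValRing L)) where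
  map_nonunit a ha := by
    obtain ⟨b, hb⟩ := ha.exists_right_inv
    have h1 : algebraMap F L a * (b : L) = 1 := by
      simpa using congrArg (Subtype.val) hb
    have h2 : ‖(a : F)‖ * ‖(b : L)‖ = 1 := by
      rw [← norm_algebraMap' L (a : F), ← norm_mul, h1, norm_one]
    have ha1 := mem_ValRing.1 a.2
    have hb1 := mem_ValRing.1 b.2
    have ha2 : ‖(a : F)‖ = 1 := by
      nlinarith [norm_nonneg (a : F), norm_nonneg (b : L)]
    have ha0 : (a : F) ≠ 0 := by
      intro h
      simp [h] at ha2
    refine IsUnit.of_mul_eq_one ⟨(a : F)⁻¹, mem_ValRing.2 (by simp [ha2])⟩ ?_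
    ext
    simp [ha0]

open Classical in
/-- The valuation `v : L → ℝ ∪ {∞}` of the valued extension `L` of `F`, normalized by
`v ϖ = 1`. -/
def val (ϖ : ValRing F) (y : L) : WithTop ℝ :=
  if y = 0 then ⊤ else ((Real.logb ‖(ϖ : F)‖ ‖y‖ : ℝ) : WithTop ℝ)

/-- The Newton polygon of a power series `∑ a_k T ^ k` over the valuation ring of `L`, as a
function: the lower convex hull of the points `(k, v a_k)`, that is, the supremum of the affine
functions whose graph lies below all these points. -/
def newtonPolygon (ϖ : ValRing F) (P : PowerSeries (ValRing L)) (t : ℝ) : ℝ :=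
  sSup {y : ℝ | ∃ a b : ℝ, (∀ k : ℕ, ((a + b * k : ℝ) : WithTop ℝ) ≤
    val ϖ ((PowerSeries.coeff k P : ValRing L) : L)) ∧ y = a + b * t}

/-- The slope `λ_i` (`1 ≤ i ≤ n`), with the sign changed, between the abscissas `q ^ (i - 1)` and
`q ^ i`, of the Newton polygon of the multiplication by `ϖ` on the formal `O_F`-module law `G`. -/
def newtonSlope (ϖ : ValRing F) (G : FormalModule (ValRing F) (ValRing L)) (i : ℕ) : ℝ :=
  let q : ℝ := Nat.card (ResidueField (ValRing F))
  (newtonPolygon ϖ (G.act ϖ) (q ^ (i - 1)) - newtonPolygon ϖ (G.act ϖ) (q ^ i)) /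
    (q ^ i - q ^ (i - 1))

variable (F L) in
/-- The `L`-points of the open polydisc `𝔛 = Spf O_F⟦x_i : i ∈ σ⟧`: the local
homomorphisms of `O_F`-algebras `O_F⟦x_i⟧ → O_L`, which are the continuous ones.
Such a homomorphism is determined by the images of the `x_i`, which are arbitrary elements of the
maximal ideal of `O_L`. -/
abbrev Point (σ : Type*) :=
  {x : MvPowerSeries σ (ValRing F) →ₐ[ValRing F] ValRing L // IsLocalHom x}

/-- The specialization `F_x` of the universal deformation at the point `x`. -/
abbrev fibre {σ : Type*} (U : FormalModule (ValRing F) (MvPowerSeries σ (ValRing F)))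
    (x : Point F L σ) : FormalModule (ValRing F) (ValRing L) :=
  U.map x.1

variable (L) in
/-- The `L`-points of the domain `𝓗`, given by the condition `λ_1 / q ^ n < λ_n`. -/
def domainH (ϖ : ValRing F) (n : ℕ) {σ : Type*}
    (U : FormalModule (ValRing F) (MvPowerSeries σ (ValRing F))) : Set (Point F L σ) :=
  {x | newtonSlope ϖ (fibre U x) 1 / (Nat.card (ResidueField (ValRing F)) : ℝ) ^ n <
    newtonSlope ϖ (fibre U x) n}

/-- The homomorphism `f` between two deformations of `G₀` over `O_L` deforms a power of `ϖ`: for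
some `m ≥ 0`, its reduction modulo the maximal ideal is the endomorphism `[ϖ ^ m]` of `G₀`. -/
def DeformsPower (ϖ : ValRing F) (G₀ : FormalModule (ValRing F) (ResidueField (ValRing F)))
    (f : PowerSeries (ValRing L)) : Prop :=
  ∃ m : ℕ, f.map (residue (ValRing L)) = (G₀.map (residueMap (ValRing F) (ValRing L))).act (ϖ ^ m)

end Extension

end LubinTate

end

/-!
The proof has two halves: an isogeny `f : F_x → F_{x'}` lifting `[ϖ ^ m]` is, in the domain `𝓗`,
divisible by `[ϖ ^ m]`, so that one may assume `m = 0`; and two fibres of the universal deformation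
which are isomorphic by a lift of the identity lie over the same point.

*Division by `ϖ`.* Put `N = q ^ n` and `P = [ϖ]`. The vertices of the Newton polygon of `P` lie over
powers of `q` (`FormalModule.IsHom.coeff_eq_zero`), so the condition defining `𝓗` says that the
nonzero zeros of `P` have absolute values between radii `r₁ ≤ rₙ` with `rₙ ^ N < r₁`
(`exists_radii`). On the disc of radius `r₁` the series `P` is the dilation of ratio `|ϖ|`; as `f`
intertwines `P` and `P' = [ϖ]'`, it has no nonzero zero there, its linear coefficient being nonzero.
Comparing the numbers of zeros of the two sides of `f ∘ P = P' ∘ f` in well chosen discs, one finds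
that for `m ≥ 1` the largest absolute value `r₀` of a zero of `f` is at least `rₙ`, and that `f`
maps the disc of radius `r₀` into the one where `P'` is a dilation (`radius_estimates`). On the
former disc `P` then divides `P' ∘ f = f · ((P' / T) ∘ f)`, whose last factor has no zeros, and
Weierstrass division gives `P ∣ f` (`dvd_of_radius_estimates`). So `f` kills the kernel of `[ϖ]`,
it is constant on the fibres of `P`, and `f = g ∘ P` for a homomorphism `g` lifting `[ϖ ^ (m - 1)]`
(`FormalModule.IsHom.exists_factor`). All zero counting is done over `L` itself, without its
algebraic closure: the number of zeros of a series in a disc is the index of a dominant term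
(`IsFirst`, `IsLast`), and these indices add up under products and multiply under composition.

*Rigidity.* Let `g : F_x → F_{x'}` lift the identity, with `x ≠ x'`, and let `a` be a difference of
coordinates of `x` and `x'` of largest absolute value. The two fibres agree modulo `a`, so modulo
`a` the formal difference `h` of `g` and the identity commutes with `P'`. Since `h` vanishes modulo
the maximal ideal, a contraction argument shows that it vanishes modulo `a`
(`norm_coeff_le_of_comm`; the valuation of `L` need not be discrete, and the coefficients of `h`
need not be bounded away from `1`). Hence `(T, g)` is a homomorphism over the ring of pairs of
elements of `O_L` congruent modulo `a`. Mapping a pair `(z, z')` to `z + ((z' - z) / a) ε`, and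
retracting the residue field of `L` onto that `k` of `F`, turns it into a `⋆`-isomorphism between
two deformations over `k[ε]`. By universality their classifying homomorphisms coincide, but they differ
at the coordinate defining `a` (`point_eq_of_isHom_lift_id`).
-/

noncomputable section

namespace LubinTate

/-! ### Dominant terms of power series over an ultrametric field -/

section Dominance

variable {L : Type*} [NormedField L]

/-- The size `‖a_k‖ r ^ k` of the `k`-th term of a power series on the circle of radius `r`. -/
def wt (A : PowerSeries L) (r : ℝ) (k : ℕ) : ℝ := ‖PowerSeries.coeff k A‖ * r ^ k

lemma wt_nonneg (A : PowerSeries L) {r : ℝ} (hr : 0 ≤ r) (k : ℕ) : 0 ≤ wt A r k := by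
  unfold wt; positivity

/-- The `k`-th term of `A` is dominant on the circle of radius `r`, strictly so against all
indices `j` with `lt j k`. For `lt = (· < ·)` this makes `k` the first dominant index (the number
of zeros of `A` in the open disc of radius `r`), for `lt = (· > ·)` the last one (the number of
zeros in the closed disc). -/
structure IsDom (lt : ℕ → ℕ → Prop) (A : PowerSeries L) (r : ℝ) (k : ℕ) : Prop where
  ne_zero : PowerSeries.coeff k A ≠ 0
  le : ∀ j, wt A r j ≤ wt A r k
  lt : ∀ j, lt j k → wt A r j < wt A r k

/-- `k` is the first dominant index of `A` on the circle of radius `r`. -/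
abbrev IsFirst (A : PowerSeries L) (r : ℝ) (k : ℕ) : Prop := IsDom (· < ·) A r k

/-- `k` is the last dominant index of `A` on the circle of radius `r`. -/
abbrev IsLast (A : PowerSeries L) (r : ℝ) (k : ℕ) : Prop := IsDom (· > ·) A r k

variable {A B : PowerSeries L} {r : ℝ} {i j : ℕ}

lemma IsDom.pos {lt : ℕ → ℕ → Prop} (hr : 0 < r) (h : IsDom lt A r i) : 0 < wt A r i :=
  mul_pos (norm_pos_iff.2 h.ne_zero) (pow_pos hr i)

lemma IsFirst.unique (hi : IsFirst A r i) (hj : IsFirst A r j) : i = j := by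
  rcases lt_trichotomy i j with h | h | h
  · exact absurd (hj.lt i h) (hi.le j).not_gt
  · exact h
  · exact absurd (hi.lt j h) (hj.le i).not_gt

lemma IsFirst.le_of_forall_le (hi : IsFirst A r i) (h : ∀ k, wt A r k ≤ wt A r j) : i ≤ j := by
  by_contra! hlt
  exact absurd (hi.lt j hlt) (h i).not_gt

/-- A nonzero series with bounded coefficients has a dominant term on each circle of radius less
than one, and only finitely many indices can be dominant. -/
lemma exists_wt_max (hA : ∀ k, ‖PowerSeries.coeff k A‖ ≤ 1) (h0 : A ≠ 0) (hr : 0 < r)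
    (hr1 : r < 1) : ∃ k, PowerSeries.coeff k A ≠ 0 ∧ (∀ j, wt A r j ≤ wt A r k) ∧
      {j | wt A r k ≤ wt A r j}.Finite := by
  obtain ⟨m, hm⟩ : ∃ m, PowerSeries.coeff m A ≠ 0 := by
    by_contra! h; exact h0 (by ext k; simpa using h k)
  have hpos : 0 < wt A r m := mul_pos (norm_pos_iff.2 hm) (pow_pos hr m)
  obtain ⟨K, hK⟩ := exists_pow_lt_of_lt_one hpos hr1
  have htail : ∀ j, K ≤ j → wt A r j < wt A r m := fun j hj => by
    refine lt_of_le_of_lt ?_ hK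
    calc wt A r j ≤ 1 * r ^ j := by unfold wt; gcongr; exact hA j
      _ ≤ r ^ K := by rw [one_mul]; exact pow_le_pow_of_le_one hr.le hr1.le hj
  have hmK : m < K := by
    by_contra! h; exact (htail m h).false
  obtain ⟨k, hk, hmax⟩ := (Finset.range K).exists_max_image (wt A r) ⟨m, by simpa using hmK⟩
  have hkm : wt A r m ≤ wt A r k := hmax m (by simpa using hmK)
  refine ⟨k, ?_, fun j => ?_, (Set.finite_Iio K).subset fun j hj => ?_⟩
  · intro h
    have : wt A r k = 0 := by simp [wt, h]
    linarith
  · rcases lt_or_ge j K with h | h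
    · exact hmax j (by simpa using h)
    · exact (htail j h).le.trans hkm
  · by_contra! h
    exact absurd (htail j (by simpa using h)) (not_lt.2 (hkm.trans hj))

lemma exists_isFirst (hA : ∀ k, ‖PowerSeries.coeff k A‖ ≤ 1) (h0 : A ≠ 0) (hr : 0 < r)
    (hr1 : r < 1) : ∃ k, IsFirst A r k := by
  classical
  obtain ⟨k, hk, hle, -⟩ := exists_wt_max hA h0 hr hr1
  have hex : ∃ i, wt A r k ≤ wt A r i := ⟨k, le_rfl⟩
  have hi := Nat.find_spec hex
  refine ⟨Nat.find hex, ?_, fun j => (hle j).trans hi, fun j hj => ?_⟩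
  · intro h
    have h1 : wt A r (Nat.find hex) = 0 := by rw [wt, h, norm_zero, zero_mul]
    have : 0 < wt A r k := mul_pos (norm_pos_iff.2 hk) (pow_pos hr k)
    linarith
  · exact (not_le.1 (Nat.find_min hex hj)).trans_le hi

lemma exists_isLast (hA : ∀ k, ‖PowerSeries.coeff k A‖ ≤ 1) (h0 : A ≠ 0) (hr : 0 < r)
    (hr1 : r < 1) : ∃ k, IsLast A r k := by
  obtain ⟨k, hk, hle, hfin⟩ := exists_wt_max hA h0 hr hr1
  obtain ⟨i, hi, hmax⟩ := hfin.toFinset.exists_max_image id ⟨k, by simp⟩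
  have hi' : wt A r k ≤ wt A r i := by simpa using hi
  refine ⟨i, ?_, fun j => (hle j).trans hi', fun j hj => ?_⟩
  · intro h
    have h1 : wt A r i = 0 := by simp [wt, h]
    have : 0 < wt A r k := mul_pos (norm_pos_iff.2 hk) (pow_pos hr k)
    linarith
  · by_contra! h
    exact absurd (hmax j (by simpa using hi'.trans h)) (not_le.2 hj)

lemma coeff_subst_eq_sum (hB0 : PowerSeries.constantCoeff B = 0) (A : PowerSeries L) (n : ℕ) :
    ∃ s : Finset ℕ, (∀ d, d ∉ s → PowerSeries.coeff d A * PowerSeries.coeff n (B ^ d) = 0) ∧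
    PowerSeries.coeff n (A.subst B) =
      ∑ d ∈ s, PowerSeries.coeff d A * PowerSeries.coeff n (B ^ d) := by
  have hB := PowerSeries.HasSubst.of_constantCoeff_zero' hB0
  have hfin := PowerSeries.coeff_subst_finite' hB A n
  refine ⟨hfin.toFinset, fun d hd => ?_, ?_⟩
  · by_contra h
    exact hd (hfin.mem_toFinset.2 h)
  rw [PowerSeries.coeff_subst' hB, finsum_eq_sum_of_support_subset _ (s := hfin.toFinset) (by simp)]
  simp

variable [IsUltrametricDist L]

lemma norm_sum_lt_of_forall_lt {ι : Type*} {s : Finset ι} {f : ι → L} {c : ℝ} (hc : 0 < c)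
    (h : ∀ i ∈ s, ‖f i‖ < c) : ‖∑ i ∈ s, f i‖ < c := by
  rcases s.eq_empty_or_nonempty with rfl | hs
  · simpa using hc
  · obtain ⟨i, hi, hle⟩ := IsUltrametricDist.exists_norm_finsetSum_le_of_nonempty hs f
    exact hle.trans_lt (h i hi)

lemma norm_sum_eq_of_forall_lt {ι : Type*} {s : Finset ι} {f : ι → L} {i : ι} (hi : i ∈ s)
    (h0 : f i ≠ 0) (h : ∀ j ∈ s, j ≠ i → ‖f j‖ < ‖f i‖) : ‖∑ j ∈ s, f j‖ = ‖f i‖ := by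
  classical
  rw [← Finset.add_sum_erase s f hi]
  have hlt : ‖∑ j ∈ s.erase i, f j‖ < ‖f i‖ :=
    norm_sum_lt_of_forall_lt (norm_pos_iff.2 h0)
      fun j hj => h j (Finset.mem_of_mem_erase hj) (Finset.ne_of_mem_erase hj)
  rw [IsUltrametricDist.norm_add_eq_max_of_norm_ne_norm hlt.ne', max_eq_left hlt.le]

lemma wt_mul_le {a b : ℝ} (hr : 0 ≤ r) (hA : ∀ k, wt A r k ≤ a) (hB : ∀ k, wt B r k ≤ b) (n : ℕ) :
    wt (A * B) r n ≤ a * b := by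
  have ha : 0 ≤ a := (wt_nonneg A hr 0).trans (hA 0)
  have hb : 0 ≤ b := (wt_nonneg B hr 0).trans (hB 0)
  unfold wt
  rw [PowerSeries.coeff_mul]
  obtain ⟨p, hp, hle⟩ := IsUltrametricDist.exists_norm_finsetSum_le_of_nonempty
    (Finset.nonempty_def.2 ⟨(0, n), by simp⟩ : (Finset.HasAntidiagonal.antidiagonal n).Nonempty)
    (fun p => PowerSeries.coeff p.1 A * PowerSeries.coeff p.2 B)
  rw [Finset.HasAntidiagonal.mem_antidiagonal] at hp
  calc _ ≤ ‖PowerSeries.coeff p.1 A * PowerSeries.coeff p.2 B‖ * r ^ n := by gcongr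
    _ = wt A r p.1 * wt B r p.2 := by rw [← hp, norm_mul, pow_add]; unfold wt; ring
    _ ≤ a * b := mul_le_mul (hA _) (hB _) (wt_nonneg B hr _) ha

lemma wt_pow_le {b : ℝ} (hr : 0 ≤ r) (hB : ∀ k, wt B r k ≤ b) (d n : ℕ) :
    wt (B ^ d) r n ≤ b ^ d := by
  induction d generalizing n with
  | zero =>
    rw [pow_zero, pow_zero]
    unfold wt
    rw [PowerSeries.coeff_one]
    split_ifs with h <;> simp [h]
  | succ d ih => rw [pow_succ, pow_succ]; exact wt_mul_le hr ih hB n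

/-- Dominant indices of a product add up. -/
lemma IsDom.mul {lt : ℕ → ℕ → Prop}
    (hlt : ∀ a b i j, (lt (a + b) (i + j) ∨ (a + b = i + j ∧ a ≠ i)) → lt a i ∨ lt b j)
    (hr : 0 < r) (hA : IsDom lt A r i) (hB : IsDom lt B r j) :
    IsDom lt (A * B) r (i + j) ∧ wt (A * B) r (i + j) = wt A r i * wt B r j := by
  have hpA := hA.pos hr
  have hpB := hB.pos hr
  have key : ∀ a b, lt a i ∨ lt b j → wt A r a * wt B r b < wt A r i * wt B r j := by
    rintro a b (h | h)
    · calc wt A r a * wt B r b ≤ wt A r a * wt B r j :=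
              mul_le_mul_of_nonneg_left (hB.le b) (wt_nonneg A hr.le a)
          _ < _ := mul_lt_mul_of_pos_right (hA.lt a h) hpB
    · calc wt A r a * wt B r b ≤ wt A r i * wt B r b :=
              mul_le_mul_of_nonneg_right (hA.le a) (wt_nonneg B hr.le b)
          _ < _ := mul_lt_mul_of_pos_left (hB.lt b h) hpA
  have hterm : ∀ a b, ‖PowerSeries.coeff a A * PowerSeries.coeff b B‖ * r ^ (a + b) =
      wt A r a * wt B r b := fun a b => by rw [norm_mul, pow_add]; unfold wt; ring
  have hmain : wt (A * B) r (i + j) = wt A r i * wt B r j := by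
    rw [← hterm, wt, PowerSeries.coeff_mul]
    congr 1
    refine norm_sum_eq_of_forall_lt (i := (i, j)) (by simp)
      (mul_ne_zero hA.ne_zero hB.ne_zero) fun p hp hne => ?_
    rw [Finset.HasAntidiagonal.mem_antidiagonal] at hp
    refine lt_of_mul_lt_mul_right ?_ (pow_nonneg hr.le (i + j))
    change ‖PowerSeries.coeff p.1 A * PowerSeries.coeff p.2 B‖ * r ^ (i + j) <
      ‖PowerSeries.coeff i A * PowerSeries.coeff j B‖ * r ^ (i + j)
    rw [hterm i j, ← hp, hterm]
    refine key _ _ (hlt _ _ _ _ (Or.inr ⟨hp, fun h => hne ?_⟩))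
    ext <;> simp <;> omega
  refine ⟨⟨?_, fun n => hmain ▸ wt_mul_le hr.le hA.le hB.le n, fun n hn => ?_⟩, hmain⟩
  · intro h
    have : wt (A * B) r (i + j) = 0 := by simp [wt, h]
    have := mul_pos hpA hpB
    linarith
  · rw [hmain]
    unfold wt
    rw [PowerSeries.coeff_mul]
    obtain ⟨p, hp, hle⟩ := IsUltrametricDist.exists_norm_finsetSum_le_of_nonempty
      (Finset.nonempty_def.2 ⟨(0, n), by simp⟩ : (Finset.HasAntidiagonal.antidiagonal n).Nonempty)
      (fun p => PowerSeries.coeff p.1 A * PowerSeries.coeff p.2 B)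
    rw [Finset.HasAntidiagonal.mem_antidiagonal] at hp
    calc _ ≤ ‖PowerSeries.coeff p.1 A * PowerSeries.coeff p.2 B‖ * r ^ n := by gcongr
      _ = wt A r p.1 * wt B r p.2 := by rw [← hp, hterm]
      _ < _ := key _ _ (hlt _ _ _ _ (Or.inl (hp ▸ hn)))

lemma IsFirst.mul (hr : 0 < r) (hA : IsFirst A r i) (hB : IsFirst B r j) :
    IsFirst (A * B) r (i + j) ∧ wt (A * B) r (i + j) = wt A r i * wt B r j :=
  IsDom.mul (by intros; omega) hr hA hB

lemma IsLast.mul (hr : 0 < r) (hA : IsLast A r i) (hB : IsLast B r j) : IsLast (A * B) r (i + j) :=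
  (IsDom.mul (by intros; omega) hr hA hB).1

lemma IsFirst.pow (hr : 0 < r) (hB : IsFirst B r j) (d : ℕ) :
    IsFirst (B ^ d) r (d * j) ∧ wt (B ^ d) r (d * j) = wt B r j ^ d := by
  induction d with
  | zero =>
    simp only [pow_zero, zero_mul]
    have h0 : wt (1 : PowerSeries L) r 0 = 1 := by simp [wt]
    refine ⟨⟨by simp, fun k => ?_, fun k hk => absurd hk (by simp)⟩, h0⟩
    rw [h0]
    simpa using wt_pow_le (B := B) hr.le hB.le 0 k
  | succ d ih =>
    have := IsFirst.mul hr ih.1 hB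
    rw [← pow_succ, ih.2] at this
    rw [add_mul, one_mul, pow_succ (wt B r j)]
    exact this

section Substitution

variable (hB0 : PowerSeries.constantCoeff B = 0)

include hB0

lemma wt_subst_lt_of_forall {c : ℝ} (hc : 0 < c) (n : ℕ)
    (h : ∀ d, ‖PowerSeries.coeff d A‖ * wt (B ^ d) r n < c) : wt (A.subst B) r n < c := by
  obtain ⟨s, -, hs⟩ := coeff_subst_eq_sum hB0 A n
  rcases s.eq_empty_or_nonempty with rfl | hne
  · simpa [wt, hs] using hc
  obtain ⟨d, -, hle⟩ := IsUltrametricDist.exists_norm_finsetSum_le_of_nonempty hne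
    (fun d => PowerSeries.coeff d A * PowerSeries.coeff n (B ^ d))
  by_cases hr : 0 ≤ r ^ n
  · refine lt_of_le_of_lt ?_ (h d)
    unfold wt
    rw [hs, ← mul_assoc, ← norm_mul]
    gcongr
  · refine lt_of_le_of_lt ?_ hc
    exact mul_nonpos_of_nonneg_of_nonpos (norm_nonneg _) (not_le.1 hr).le

/-- On the circle of radius `r`, the sup norm of `A ∘ B` is at most the sup norm of `A` on the
circle of radius the sup norm of `B`. -/
lemma wt_subst_le {a b : ℝ} (hr : 0 ≤ r) (ha : 0 ≤ a) (hB : ∀ k, wt B r k ≤ b)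
    (hA : ∀ k, wt A b k ≤ a) (n : ℕ) : wt (A.subst B) r n ≤ a := by
  refine le_of_forall_pos_lt_add fun ε hε => wt_subst_lt_of_forall hB0 (by positivity) n fun d => ?_
  refine lt_of_le_of_lt ?_ (lt_add_of_pos_right a hε)
  exact (mul_le_mul_of_nonneg_left (wt_pow_le hr hB d n) (norm_nonneg _)).trans (hA d)

/-- First dominant indices multiply under composition. -/
lemma IsFirst.subst (hr : 0 < r) (hB : IsFirst B r j) (hA : IsFirst A (wt B r j) i) :
    IsFirst (A.subst B) r (i * j) ∧ wt (A.subst B) r (i * j) = wt A (wt B r j) i := by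
  set b := wt B r j with hb
  have hbpos : 0 < b := hB.pos hr
  have hApos := hA.pos hbpos
  have hle : ∀ d n, ‖PowerSeries.coeff d A‖ * wt (B ^ d) r n ≤ wt A b d := fun d n =>
    mul_le_mul_of_nonneg_left (wt_pow_le hr.le hB.le d n) (norm_nonneg _)
  have hj : 0 < j := by
    rcases Nat.eq_zero_or_pos j with rfl | h
    · exact absurd (by simpa using hB0) hB.ne_zero
    · exact h
  -- the `d`-th summand `a_d B ^ d` of the composite starts to dominate at the index `d * j`
  have hstrict : ∀ d n, n ≤ i * j → (n < i * j ∨ d ≠ i) →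
      ‖PowerSeries.coeff d A‖ * wt (B ^ d) r n < wt A b i := by
    intro d n hn hor
    rcases lt_or_ge d i with hd | hd
    · exact (hle d n).trans_lt (hA.lt d hd)
    by_cases h0 : PowerSeries.coeff d A = 0
    · simpa [h0] using hApos
    have hnd : n < d * j := by
      rcases hor with h | h
      · exact h.trans_le (Nat.mul_le_mul_right j hd)
      · exact hn.trans_lt ((Nat.mul_lt_mul_right hj).2 (lt_of_le_of_ne hd (Ne.symm h)))
    have hp := IsFirst.pow hr hB d
    calc _ < ‖PowerSeries.coeff d A‖ * wt (B ^ d) r (d * j) :=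
          mul_lt_mul_of_pos_left (hp.1.lt n hnd) (norm_pos_iff.2 h0)
      _ = wt A b d := by rw [hp.2]; rfl
      _ ≤ wt A b i := hA.le d
  have hii : ‖PowerSeries.coeff i A‖ * wt (B ^ i) r (i * j) = wt A b i := by
    rw [(IsFirst.pow hr hB i).2]; rfl
  have hmain : wt (A.subst B) r (i * j) = wt A b i := by
    obtain ⟨s, hs0, hs⟩ := coeff_subst_eq_sum hB0 A (i * j)
    have hne : PowerSeries.coeff i A * PowerSeries.coeff (i * j) (B ^ i) ≠ 0 :=
      mul_ne_zero hA.ne_zero (IsFirst.pow hr hB i).1.ne_zero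
    rw [← hii, wt, wt, hs, ← mul_assoc, ← norm_mul]
    congr 1
    refine norm_sum_eq_of_forall_lt (i := i) ?_ hne fun d _ hd => ?_
    · by_contra h; exact hne (hs0 i h)
    refine lt_of_mul_lt_mul_right ?_ (pow_nonneg hr.le (i * j))
    rw [norm_mul, norm_mul, mul_assoc, mul_assoc]
    change ‖PowerSeries.coeff d A‖ * wt (B ^ d) r (i * j) <
      ‖PowerSeries.coeff i A‖ * wt (B ^ i) r (i * j)
    rw [hii]
    exact hstrict d _ le_rfl (Or.inr hd)
  refine ⟨⟨?_, fun n => ?_, fun n hn => ?_⟩, hmain⟩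
  · intro h
    have : wt (A.subst B) r (i * j) = 0 := by simp [wt, h]
    linarith
  · rw [hmain]
    exact wt_subst_le hB0 hr.le hApos.le hB.le hA.le n
  · rw [hmain]
    exact wt_subst_lt_of_forall hB0 hApos n fun d => hstrict d n hn.le (Or.inl hn)

end Substitution

end Dominance

/-! ### Radii of the zeros of a power series -/

section Radii

variable {L : Type*} [NormedField L]

/-- `r` is the largest absolute value of a zero, in the open unit disc, of the series `A` of
Weierstrass degree `M`: it is the radius at which the `M`-th term of `A`, which has a unit
coefficient, ceases to be the only dominant one. -/
structure IsOuterRadius (A : PowerSeries L) (M : ℕ) (r : ℝ) : Prop where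
  bdd : ∀ k, ‖PowerSeries.coeff k A‖ ≤ 1
  unit : ‖PowerSeries.coeff M A‖ = 1
  pos : 0 < r
  lt_one : r < 1
  le : ∀ k, wt A r k ≤ r ^ M
  exists_eq : ∃ k < M, wt A r k = r ^ M

/-- The nonzero zeros of `A` in the open unit disc have absolute value at least `r`: the linear
term of `A` is dominant up to the radius `r`. -/
structure IsInnerRadius (A : PowerSeries L) (r : ℝ) : Prop where
  constantCoeff : PowerSeries.constantCoeff A = 0
  ne_zero : PowerSeries.coeff 1 A ≠ 0
  pos : 0 < r
  lt_one : r < 1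
  le : ∀ k, wt A r k ≤ ‖PowerSeries.coeff 1 A‖ * r

variable {A : PowerSeries L} {M : ℕ} {r s : ℝ}

lemma IsOuterRadius.wt_eq (h : IsOuterRadius A M r) (s : ℝ) : wt A s M = s ^ M := by
  rw [wt, h.unit, one_mul]

lemma IsOuterRadius.coeff_ne_zero (h : IsOuterRadius A M r) : PowerSeries.coeff M A ≠ 0 :=
  norm_ne_zero_iff.1 (by rw [h.unit]; exact one_ne_zero)

lemma IsOuterRadius.norm_coeff_le (h : IsOuterRadius A M r) {k : ℕ} (hk : k ≤ M) :
    ‖PowerSeries.coeff k A‖ ≤ r ^ (M - k) := by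
  have h1 := h.le k
  have h2 : r ^ M = r ^ (M - k) * r ^ k := by rw [← pow_add, Nat.sub_add_cancel hk]
  rw [wt, h2] at h1
  exact le_of_mul_le_mul_right h1 (pow_pos h.pos k)

lemma IsOuterRadius.wt_le (h : IsOuterRadius A M r) (hrs : r ≤ s) (hs : s < 1) (k : ℕ) :
    wt A s k ≤ s ^ M := by
  have hs0 : 0 < s := h.pos.trans_le hrs
  rcases le_total k M with hk | hk
  · calc wt A s k ≤ r ^ (M - k) * s ^ k := by unfold wt; gcongr; exact h.norm_coeff_le hk
      _ ≤ s ^ (M - k) * s ^ k := by have := h.pos.le; gcongr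
      _ = s ^ M := by rw [← pow_add, Nat.sub_add_cancel hk]
  · calc wt A s k ≤ 1 * s ^ k := by unfold wt; gcongr; exact h.bdd k
      _ ≤ s ^ M := by rw [one_mul]; exact pow_le_pow_of_le_one hs0.le hs.le hk

lemma IsOuterRadius.isFirst (h : IsOuterRadius A M r) (hrs : r < s) (hs : s < 1) :
    IsFirst A s M := by
  have hs0 : 0 < s := h.pos.trans hrs
  refine ⟨h.coeff_ne_zero, fun k => h.wt_eq s ▸ h.wt_le hrs.le hs k, fun k hk => ?_⟩
  rw [h.wt_eq]
  calc wt A s k ≤ r ^ (M - k) * s ^ k := by unfold wt; gcongr; exact h.norm_coeff_le hk.le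
    _ < s ^ (M - k) * s ^ k := by
      have := h.pos.le
      have : M - k ≠ 0 := by omega
      gcongr
    _ = s ^ M := by rw [← pow_add, Nat.sub_add_cancel hk.le]

lemma IsOuterRadius.isLast (h : IsOuterRadius A M r) (hrs : r ≤ s) (hs : s < 1) :
    IsLast A s M := by
  have hs0 : 0 < s := h.pos.trans_le hrs
  refine ⟨h.coeff_ne_zero, fun k => h.wt_eq s ▸ h.wt_le hrs hs k, fun k hk => ?_⟩
  rw [h.wt_eq]
  calc wt A s k ≤ 1 * s ^ k := by unfold wt; gcongr; exact h.bdd k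
    _ < s ^ M := by rw [one_mul]; exact pow_lt_pow_right_of_lt_one₀ hs0 hs hk

lemma IsOuterRadius.exists_isFirst_lt (h : IsOuterRadius A M r) :
    ∃ k < M, IsFirst A r k ∧ wt A r k = r ^ M := by
  have hA0 : A ≠ 0 := fun h0 => h.coeff_ne_zero (by simp [h0])
  obtain ⟨j, hj⟩ := exists_isFirst h.bdd hA0 h.pos h.lt_one
  obtain ⟨k, hk, hkM⟩ := h.exists_eq
  have hjk : j ≤ k := hj.le_of_forall_le fun i => hkM ▸ h.le i
  exact ⟨j, hjk.trans_lt hk, hj, le_antisymm (h.le j) (hkM ▸ hj.le k)⟩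

lemma IsInnerRadius.isFirst (h : IsInnerRadius A r) (hs : 0 < s) (hsr : s ≤ r) :
    IsFirst A s 1 := by
  have hone : wt A s 1 = ‖PowerSeries.coeff 1 A‖ * s := by simp [wt]
  refine ⟨h.ne_zero, fun k => ?_, fun k hk => ?_⟩
  · rcases k with _ | k
    · simpa [wt, h.constantCoeff] using mul_nonneg (norm_nonneg _) hs.le
    · have h1 := h.le (k + 1)
      rw [wt, pow_succ, ← mul_assoc] at h1
      have h2 := le_of_mul_le_mul_right h1 h.pos
      rw [hone, wt, pow_succ, ← mul_assoc]
      gcongr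
      refine le_trans ?_ h2
      gcongr
  · obtain rfl : k = 0 := by omega
    have : 0 < ‖PowerSeries.coeff 1 A‖ := norm_pos_iff.2 h.ne_zero
    rw [hone, wt]
    simp only [PowerSeries.coeff_zero_eq_constantCoeff, h.constantCoeff, norm_zero, zero_mul]
    positivity

/-- Existence of the outer radius. -/
lemma exists_isOuterRadius (hb : ∀ k, ‖PowerSeries.coeff k A‖ ≤ 1)
    (hu : ‖PowerSeries.coeff M A‖ = 1) (hlt : ∀ k < M, ‖PowerSeries.coeff k A‖ < 1)
    (hne : ∃ k < M, PowerSeries.coeff k A ≠ 0) : ∃ r, IsOuterRadius A M r := by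
  obtain ⟨k₀, hk₀, hk₀ne⟩ := hne
  let ρ : ℕ → ℝ := fun k => ‖PowerSeries.coeff k A‖ ^ ((M - k : ℕ) : ℝ)⁻¹
  have hρ : ∀ k < M, ρ k ^ (M - k) = ‖PowerSeries.coeff k A‖ := fun k hk =>
    Real.rpow_inv_natCast_pow (norm_nonneg _) (by omega)
  obtain ⟨k, hk, hmax⟩ := (Finset.range M).exists_max_image ρ ⟨k₀, by simpa using hk₀⟩
  rw [Finset.mem_range] at hk
  have hρ0 : ∀ j, 0 ≤ ρ j := fun j => Real.rpow_nonneg (norm_nonneg _) _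
  have hpos : 0 < ρ k :=
    (Real.rpow_pos_of_pos (norm_pos_iff.2 hk₀ne) _).trans_le (hmax k₀ (by simpa using hk₀))
  have hlt1 : ρ k < 1 := by
    by_contra! h
    have := one_le_pow₀ (n := M - k) h
    rw [hρ k hk] at this
    exact (hlt k hk).not_ge this
  refine ⟨ρ k, hb, hu, hpos, hlt1, fun j => ?_, k, hk, ?_⟩
  · rcases lt_or_ge j M with hj | hj
    · rw [wt, ← hρ j hj, ← Nat.sub_add_cancel hj.le, pow_add, Nat.sub_add_cancel hj.le]
      have := hmax j (by simpa using hj)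
      have := hρ0 j
      gcongr
    · calc wt A (ρ k) j ≤ 1 * ρ k ^ j := by unfold wt; gcongr; exact hb j
        _ ≤ _ := by rw [one_mul]; exact pow_le_pow_of_le_one hpos.le hlt1.le hj
  · rw [wt, ← hρ k hk, ← pow_add, Nat.sub_add_cancel hk.le]

/-- Existence of the inner radius, which is attained. -/
lemma exists_isInnerRadius (hb : ∀ k, ‖PowerSeries.coeff k A‖ ≤ 1) (hM : 1 < M)
    (hu : ‖PowerSeries.coeff M A‖ = 1) (h0 : PowerSeries.constantCoeff A = 0)
    (h1 : PowerSeries.coeff 1 A ≠ 0) (h1' : ‖PowerSeries.coeff 1 A‖ < 1) :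
    ∃ r, IsInnerRadius A r ∧ ∃ k, 1 < k ∧ k ≤ M ∧ wt A r k = ‖PowerSeries.coeff 1 A‖ * r := by
  classical
  set c := ‖PowerSeries.coeff 1 A‖ with hc
  have hc0 : 0 < c := norm_pos_iff.2 h1
  let ρ : ℕ → ℝ := fun k => (c / ‖PowerSeries.coeff k A‖) ^ ((k - 1 : ℕ) : ℝ)⁻¹
  let S := (Finset.Icc 2 M).filter fun k => PowerSeries.coeff k A ≠ 0
  have hMne : PowerSeries.coeff M A ≠ 0 := norm_ne_zero_iff.1 (by rw [hu]; exact one_ne_zero)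
  have hMS : M ∈ S := by simp [S, hMne]; omega
  have hS : ∀ k ∈ S, 2 ≤ k ∧ k ≤ M ∧ PowerSeries.coeff k A ≠ 0 := fun k hk => by
    simpa [S, and_assoc] using hk
  have hρ : ∀ k ∈ S, ‖PowerSeries.coeff k A‖ * ρ k ^ k = c * ρ k ∧ 0 < ρ k := fun k hk => by
    obtain ⟨h2, -, hne⟩ := hS k hk
    have hn : 0 < ‖PowerSeries.coeff k A‖ := norm_pos_iff.2 hne
    have hp : ρ k ^ (k - 1) = c / ‖PowerSeries.coeff k A‖ :=
      Real.rpow_inv_natCast_pow (by positivity) (by omega)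
    refine ⟨?_, Real.rpow_pos_of_pos (by positivity) _⟩
    have : ρ k ^ k = ρ k ^ (k - 1) * ρ k := by rw [← pow_succ]; congr 1; omega
    rw [this, hp]; field_simp
  obtain ⟨k, hk, hmin⟩ := S.exists_min_image ρ ⟨M, hMS⟩
  obtain ⟨hkeq, hkpos⟩ := hρ k hk
  have hle : ∀ j ∈ S, wt A (ρ k) j ≤ c * ρ k := fun j hj => by
    obtain ⟨hjeq, hjpos⟩ := hρ j hj
    have h2 := (hS j hj).1
    have e : ∀ x : ℝ, x ^ j = x ^ (j - 1) * x := fun x => by rw [← pow_succ]; congr 1; omega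
    rw [e, ← mul_assoc] at hjeq
    have := mul_right_cancel₀ hjpos.ne' hjeq
    rw [wt, e, ← mul_assoc, ← this]
    have := hmin j hj
    gcongr
  have hlt1 : ρ k < 1 := by
    by_contra! h
    have hw := hle M hMS
    rw [wt, hu, one_mul] at hw
    have : ρ k ≤ ρ k ^ M := le_self_pow₀ h (by omega)
    nlinarith
  refine ⟨ρ k, ⟨h0, h1, hkpos, hlt1, fun j => ?_⟩, k, (hS k hk).1, (hS k hk).2.1, hkeq⟩
  by_cases hj0 : PowerSeries.coeff j A = 0
  · simp only [wt, hj0, norm_zero, zero_mul]; positivity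
  rcases lt_or_ge j 2 with hj | hj
  · interval_cases j
    · exact absurd (by simpa using h0) hj0
    · simp [wt]
  rcases le_or_gt j M with hjM | hjM
  · exact hle j (by simp [S, hj0, hj, hjM])
  · refine le_trans ?_ (hle M hMS)
    rw [wt, wt, hu]
    have := hb j
    have := pow_le_pow_of_le_one hkpos.le hlt1.le hjM.le
    gcongr

end Radii

section Isogeny

variable {L : Type*} [NormedField L] [IsUltrametricDist L] {P P' f : PowerSeries L}
  {N M : ℕ} {r₁ rₙ r₁' rₙ' r₀ : ℝ}

/-- If `f ∘ P = P' ∘ f` and multiplication by `P` is a dilation on the disc of radius `r₁`, then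
`f` has no zero besides `0` on this disc: the orbit of such a zero under the dilation
would be infinite. -/
lemma isFirst_one_of_comm (hP : IsInnerRadius P r₁) (hc : ‖PowerSeries.coeff 1 P‖ < 1)
    (hb' : ∀ k, ‖PowerSeries.coeff k P'‖ ≤ 1) (h0' : PowerSeries.constantCoeff P' = 0)
    (hne' : P' ≠ 0) (hf : ∀ k, ‖PowerSeries.coeff k f‖ ≤ 1)
    (hf0 : PowerSeries.constantCoeff f = 0) (hf1 : PowerSeries.coeff 1 f ≠ 0)
    (hcomm : f.subst P = P'.subst f) {r : ℝ} (hr : 0 < r) (hr1 : r ≤ r₁) : IsFirst f r 1 := by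
  set c := ‖PowerSeries.coeff 1 P‖ with hcdef
  have hc0 : 0 < c := norm_pos_iff.2 hP.ne_zero
  have hfne : f ≠ 0 := fun h => hf1 (by simp [h])
  have hf1pos : 0 < ‖PowerSeries.coeff 1 f‖ := norm_pos_iff.2 hf1
  have hpos_of_isFirst : ∀ {B : PowerSeries L} {s : ℝ} {j : ℕ},
      PowerSeries.constantCoeff B = 0 → IsFirst B s j → 1 ≤ j := fun {B s j} hB hj => by
    rcases Nat.eq_zero_or_pos j with rfl | h
    · exact absurd (by simpa using hB) hj.ne_zero
    · exact h
  -- near zero the linear term dominates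
  have hsmall : ∀ s, 0 < s → s < 1 → s ≤ ‖PowerSeries.coeff 1 f‖ → IsFirst f s 1 := by
    intro s hs hs1 hsf
    refine ⟨hf1, fun k => ?_, fun k hk => ?_⟩
    · rcases k with _ | _ | k
      · simpa [wt, hf0] using mul_nonneg hf1pos.le hs.le
      · exact le_rfl
      · calc wt f s (k + 2) ≤ 1 * s ^ (k + 2) := by unfold wt; gcongr; exact hf _
          _ ≤ s ^ 2 := by
            rw [one_mul]; exact pow_le_pow_of_le_one hs.le hs1.le (by omega)
          _ ≤ wt f s 1 := by rw [wt, pow_one, pow_two]; gcongr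
    · obtain rfl : k = 0 := by omega
      simp only [wt, PowerSeries.coeff_zero_eq_constantCoeff, hf0, norm_zero, zero_mul]
      positivity
  -- passing from the radius `s` to `c * s` can only increase the first dominant index
  have hstep : ∀ s, 0 < s → s ≤ r₁ → ∀ i j, IsFirst f s i → IsFirst f (c * s) j → i ≤ j := by
    intro s hs hsr i j hi hj
    have hs1 : s < 1 := hsr.trans_lt hP.lt_one
    have hPs := hP.isFirst hs hsr
    have hval : wt P s 1 = c * s := by simp [wt, hcdef]
    have h1 := (IsFirst.subst hP.constantCoeff hs hPs (hval.symm ▸ hj)).1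
    have hi1 := hpos_of_isFirst hf0 hi
    have hv : wt f s i < 1 := by
      calc wt f s i ≤ 1 * s ^ i := by unfold wt; gcongr; exact hf i
        _ < 1 := by rw [one_mul]; exact pow_lt_one₀ hs.le hs1 (by omega)
    obtain ⟨e, he⟩ := exists_isFirst hb' hne' (hi.pos hs) hv
    have h2 := (IsFirst.subst hf0 hs hi he).1
    rw [← hcomm] at h2
    have heq := h1.unique h2
    have := hpos_of_isFirst h0' he
    nlinarith
  have hr1' : r < 1 := hr1.trans_lt hP.lt_one
  obtain ⟨K, hK⟩ := exists_pow_lt_of_lt_one (div_pos hf1pos hr) hc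
  have hKr : c ^ K * r ≤ ‖PowerSeries.coeff 1 f‖ := by
    rw [lt_div_iff₀ hr] at hK; exact hK.le
  have hcK : ∀ k, 0 < c ^ k * r ∧ c ^ k * r ≤ r := fun k =>
    ⟨by positivity, mul_le_of_le_one_left hr.le (pow_le_one₀ hc0.le hc.le)⟩
  have hind : ∀ k i, k ≤ K → IsFirst f (c ^ (K - k) * r) i → i = 1 := by
    intro k
    induction k with
    | zero =>
      intro i _ hi
      exact hi.unique (hsmall _ (hcK _).1 ((hcK _).2.trans_lt hr1') (by simpa using hKr))
    | succ k ih =>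
      intro i hk hi
      obtain ⟨j, hj⟩ := exists_isFirst hf hfne (hcK (K - k)).1 ((hcK (K - k)).2.trans_lt hr1')
      have hj1 := ih j (by omega) hj
      have e : c ^ (K - k) * r = c * (c ^ (K - (k + 1)) * r) := by
        rw [← mul_assoc, ← pow_succ']; congr 2; omega
      have := hstep _ (hcK _).1 ((hcK _).2.trans hr1) i j hi (e ▸ hj)
      have := hpos_of_isFirst hf0 hi
      omega
  obtain ⟨i, hi⟩ := exists_isFirst hf hfne hr hr1'
  obtain rfl := hind K i le_rfl (by simpa using hi)
  exact hi

/-- The valuation-theoretic heart of the argument. Let `f` intertwine `P` and `P'`, both in the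
domain `rₙ ^ N < r₁`, and let `r₀` be the largest absolute value of a zero of `f`. Then `r₀` is at
least the largest absolute value `rₙ` of a zero of `P`, and `f` maps the disc of radius `r₀` into
the disc where `P'` is a dilation. -/
lemma radius_estimates (hP : IsOuterRadius P N rₙ) (hP₁ : IsInnerRadius P r₁)
    (hH : rₙ ^ N < r₁) (hP' : IsOuterRadius P' N rₙ') (hP₁' : IsInnerRadius P' r₁')
    (hH' : rₙ' ^ N < r₁') (hc : ‖PowerSeries.coeff 1 P‖ < 1) (hN : 2 ≤ N) (hNM : N ≤ M)
    (hf : IsOuterRadius f M r₀) (hf0 : PowerSeries.constantCoeff f = 0)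
    (hf1 : PowerSeries.coeff 1 f ≠ 0) (hcomm : f.subst P = P'.subst f) :
    rₙ ≤ r₀ ∧ r₀ ^ M < r₁' := by
  have hne' : P' ≠ 0 := fun h => hP₁'.ne_zero (by simp [h])
  have hge : rₙ ≤ r₀ := by
    by_contra! hlt
    obtain ⟨e, heN, he, hev⟩ := hP.exists_isFirst_lt
    have hf1st : IsFirst f (wt P rₙ e) 1 :=
      isFirst_one_of_comm hP₁ hc hP'.bdd hP₁'.constantCoeff hne' hf.bdd hf0 hf1 hcomm
        (he.pos hP.pos) (hev ▸ hH.le)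
    have h1 := (IsFirst.subst hP₁.constantCoeff hP.pos he hf1st).1
    have hfM := hf.isFirst hlt hP.lt_one
    obtain ⟨j, hj⟩ := exists_isFirst hP'.bdd hne' (hfM.pos hP.pos) (by
      rw [hf.wt_eq]; exact pow_lt_one₀ hP.pos.le hP.lt_one (by omega))
    have h2 := (IsFirst.subst hf0 hP.pos hfM hj).1
    rw [← hcomm] at h2
    have heq := h1.unique h2
    have hj1 : 1 ≤ j := by
      rcases Nat.eq_zero_or_pos j with rfl | h
      · exact absurd (by simpa using hP₁'.constantCoeff) hj.ne_zero
      · exact h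
    nlinarith
  refine ⟨hge, ?_⟩
  -- the radius `s` of the zeros of `f ∘ P` lying above a zero of `f` of absolute value `r₀`
  set s := r₀ ^ ((N : ℕ) : ℝ)⁻¹ with hs
  have hsN : s ^ N = r₀ := Real.rpow_inv_natCast_pow hf.pos.le (by omega)
  have hs0 : 0 < s := Real.rpow_pos_of_pos hf.pos _
  have hs1 : s < 1 := by
    by_contra! h
    have := one_le_pow₀ (n := N) h
    rw [hsN] at this
    exact hf.lt_one.not_ge this
  have hr₀s : r₀ < s := by
    calc r₀ = s ^ N := hsN.symm
      _ < s ^ 1 := pow_lt_pow_right_of_lt_one₀ hs0 hs1 (by omega)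
      _ = s := pow_one s
  have hPs := hP.isFirst (hge.trans_lt hr₀s) hs1
  obtain ⟨k, hkM, hk, -⟩ := hf.exists_isFirst_lt
  have hval : wt P s N = r₀ := by rw [hP.wt_eq, hsN]
  have h1 := (IsFirst.subst hP₁.constantCoeff hs0 hPs (hval.symm ▸ hk)).1
  have hfs := hf.isFirst hr₀s hs1
  have hsM : s ^ M ≤ rₙ' := by
    by_contra! hlt
    have hP's := hP'.isFirst hlt (pow_lt_one₀ hs0.le hs1 (by omega))
    have h2 := (IsFirst.subst hf0 hs0 hfs ((hf.wt_eq s).symm ▸ hP's)).1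
    rw [← hcomm] at h2
    have := h1.unique h2
    nlinarith
  calc r₀ ^ M = (s ^ M) ^ N := by rw [← hsN, ← pow_mul, ← pow_mul, mul_comm]
    _ ≤ rₙ' ^ N := by gcongr
    _ < r₁' := hH'

end Isogeny

/-! ### Series over the valuation ring and Weierstrass division -/

section Divisibility

variable {L : Type*} [NormedField L] [IsUltrametricDist L]

lemma norm_coe_le_one (a : ValRing L) : ‖(a : L)‖ ≤ 1 := mem_ValRing.1 a.2

lemma dvd_of_norm_le {a b : ValRing L} (ha : a ≠ 0) (h : ‖(b : L)‖ ≤ ‖(a : L)‖) : a ∣ b := by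
  have ha' : (a : L) ≠ 0 := by simpa using ha
  have hpos : 0 < ‖(a : L)‖ := norm_pos_iff.2 ha'
  refine ⟨⟨b / a, mem_ValRing.2 ?_⟩, ?_⟩
  · rw [norm_div]; exact (div_le_one hpos).2 h
  · ext; simp [mul_div_cancel₀ _ ha']

lemma norm_le_of_dvd {a b : ValRing L} (h : a ∣ b) : ‖(b : L)‖ ≤ ‖(a : L)‖ := by
  obtain ⟨c, rfl⟩ := h
  simpa using mul_le_of_le_one_right (norm_nonneg (a : L)) (norm_coe_le_one c)

lemma isUnit_valRing_iff {a : ValRing L} : IsUnit a ↔ ‖(a : L)‖ = 1 := by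
  constructor
  · rintro h
    exact le_antisymm (norm_coe_le_one a) (by simpa using norm_le_of_dvd h.dvd (b := 1))
  · intro h
    have h0 : a ≠ 0 := by rintro rfl; simp at h
    exact isUnit_of_dvd_one (dvd_of_norm_le h0 (by simp [h]))

lemma mem_maximalIdeal_valRing_iff {a : ValRing L} :
    a ∈ maximalIdeal (ValRing L) ↔ ‖(a : L)‖ < 1 := by
  rw [mem_maximalIdeal, mem_nonunits_iff, isUnit_valRing_iff]
  exact ⟨fun h => lt_of_le_of_ne (norm_coe_le_one a) h, fun h => h.ne⟩

lemma mem_span_pow_iff {a b : ValRing L} (ha : a ≠ 0) (n : ℕ) :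
    b ∈ Ideal.span {a} ^ n ↔ ‖(b : L)‖ ≤ ‖(a : L)‖ ^ n := by
  rw [Ideal.span_singleton_pow, Ideal.mem_span_singleton]
  constructor
  · intro h; simpa using norm_le_of_dvd h
  · intro h; exact dvd_of_norm_le (pow_ne_zero n ha) (by simpa using h)

/-- The valuation ring of a complete field is adically complete for each principal proper ideal.
(It is in general not so for its maximal ideal, which is idempotent when the valuation is not
discrete.) -/
lemma isAdicComplete_span [CompleteSpace L] {a : ValRing L} (ha : a ≠ 0) (ha1 : ‖(a : L)‖ < 1) :
    IsAdicComplete (Ideal.span {a}) (ValRing L) := by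
  have hlim : ∀ ε > 0, ∃ n, ‖(a : L)‖ ^ n < ε := fun ε hε => exists_pow_lt_of_lt_one hε ha1
  refine { haus' := fun x hx => ?_, prec' := fun f hf => ?_ }
  · have h0 : ‖(x : L)‖ ≤ 0 := by
      refine le_of_forall_pos_le_add fun ε hε => ?_
      obtain ⟨n, hn⟩ := hlim ε hε
      have := hx n
      rw [SModEq.zero, smul_eq_mul, Ideal.mul_top, mem_span_pow_iff ha] at this
      linarith
    simpa using h0
  · have hf' : ∀ {m n}, m ≤ n → ‖(f m : L) - f n‖ ≤ ‖(a : L)‖ ^ m := fun {m n} hmn => by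
      have := hf hmn
      rw [SModEq.sub_mem, smul_eq_mul, Ideal.mul_top, mem_span_pow_iff ha] at this
      simpa using this
    have hc : CauchySeq fun n => (f n : L) := by
      refine Metric.cauchySeq_iff'.2 fun ε hε => ?_
      obtain ⟨N, hN⟩ := hlim ε hε
      refine ⟨N, fun n hn => ?_⟩
      rw [dist_comm, dist_eq_norm]
      exact (hf' hn).trans_lt hN
    obtain ⟨l, hl⟩ := cauchySeq_tendsto_of_complete hc
    have hl1 : ‖l‖ ≤ 1 :=
      le_of_tendsto hl.norm (Filter.Eventually.of_forall fun n => norm_coe_le_one (f n))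
    refine ⟨⟨l, mem_ValRing.2 hl1⟩, fun n => ?_⟩
    rw [SModEq.sub_mem, smul_eq_mul, Ideal.mul_top, mem_span_pow_iff ha]
    have ht : Filter.Tendsto (fun m => ‖(f n : L) - f m‖) Filter.atTop (nhds ‖(f n : L) - l‖) :=
      (hl.const_sub _).norm
    exact le_of_tendsto ht (Filter.eventually_atTop.2 ⟨n, fun m hm => hf' hm⟩)

/-- A power series over the valuation ring, with its coefficients read in the field. -/
abbrev toField (A : PowerSeries (ValRing L)) : PowerSeries L := A.map (ValRing L).subtype

@[simp] lemma coeff_toField (A : PowerSeries (ValRing L)) (k : ℕ) :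
    PowerSeries.coeff k (toField A) = ((PowerSeries.coeff k A : ValRing L) : L) := by simp

lemma toField_injective : Function.Injective (toField (L := L)) := fun A B h => by
  ext k
  simpa using congrArg (PowerSeries.coeff k) h

lemma norm_coeff_toField_le (A : PowerSeries (ValRing L)) (k : ℕ) :
    ‖PowerSeries.coeff k (toField A)‖ ≤ 1 := by
  rw [coeff_toField]; exact norm_coe_le_one _

/-- Weierstrass division by a series whose `N`-th coefficient is a unit and whose previous
coefficients are not. -/
lemma exists_weierstrass_division [CompleteSpace L] {P : PowerSeries (ValRing L)} {N : ℕ}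
    (hN : ‖((PowerSeries.coeff N P : ValRing L) : L)‖ = 1)
    (hlt : ∀ k < N, ‖((PowerSeries.coeff k P : ValRing L) : L)‖ < 1)
    (hne : ∃ k < N, PowerSeries.coeff k P ≠ 0) (f : PowerSeries (ValRing L)) :
    ∃ (Q : PowerSeries (ValRing L)) (R : Polynomial (ValRing L)), R.degree < N ∧
      f = P * Q + (R : PowerSeries (ValRing L)) := by
  obtain ⟨k₀, hk₀, hk₀ne⟩ := hne
  obtain ⟨k, hk, hmax⟩ := (Finset.range N).exists_max_image
    (fun k => ‖((PowerSeries.coeff k P : ValRing L) : L)‖) ⟨k₀, by simpa using hk₀⟩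
  rw [Finset.mem_range] at hk
  set a := PowerSeries.coeff k P with ha
  have ha1 : ‖(a : L)‖ < 1 := hlt k hk
  have ha0 : a ≠ 0 := by
    intro h
    have h1 := hmax k₀ (by simpa using hk₀)
    rw [h] at h1
    exact hk₀ne (by simpa using h1)
  have := isAdicComplete_span ha0 ha1
  have horder : (P.map (Ideal.Quotient.mk (Ideal.span {a}))).order = N := by
    refine PowerSeries.order_eq_nat.2 ⟨?_, fun i hi => ?_⟩
    · rw [PowerSeries.coeff_map, Ne, Ideal.Quotient.eq_zero_iff_mem, Ideal.mem_span_singleton]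
      intro h
      have := norm_le_of_dvd h
      linarith
    · rw [PowerSeries.coeff_map, Ideal.Quotient.eq_zero_iff_mem, Ideal.mem_span_singleton]
      exact dvd_of_norm_le ha0 (hmax i (by simpa using hi))
  have hdiv : P.IsWeierstrassDivisorAt (Ideal.span {a}) := by
    rw [PowerSeries.IsWeierstrassDivisorAt, horder, ENat.toNat_natCast]
    exact isUnit_valRing_iff.2 hN
  obtain ⟨hdeg, heq⟩ := hdiv.isWeierstrassDivisionAt_div_mod f
  rw [horder, ENat.toNat_natCast] at hdeg
  exact ⟨_, _, hdeg, heq⟩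

/-- If `f` intertwines `P` and `P'` and maps the disc of radius `r₀`, which contains the zeros of
`P`, into the disc where `P'` is a dilation, then `P` divides `f`: on this disc
`P' ∘ f` is `f` times the series `(P' / T) ∘ f` without zeros, and it is divisible by `P`. -/
lemma dvd_of_radius_estimates [CompleteSpace L] {P P' f : PowerSeries (ValRing L)} {N M : ℕ}
    {rₙ r₁' r₀ : ℝ} (hP : IsOuterRadius (toField P) N rₙ)
    (hP0 : PowerSeries.constantCoeff P = 0) (hP₁' : IsInnerRadius (toField P') r₁')
    (hPlt : ∀ k < N, ‖((PowerSeries.coeff k P : ValRing L) : L)‖ < 1)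
    (hf : ∀ k, wt (toField f) r₀ k ≤ r₀ ^ M) (hr₀ : rₙ ≤ r₀) (hr₀1 : r₀ < 1)
    (hr₀' : r₀ ^ M < r₁') (hf0 : PowerSeries.constantCoeff f = 0)
    (hcomm : f.subst P = P'.subst f) : P ∣ f := by
  have hr₀pos : 0 < r₀ := hP.pos.trans_le hr₀
  have hsf := PowerSeries.HasSubst.of_constantCoeff_zero' hf0
  have hsP := PowerSeries.HasSubst.of_constantCoeff_zero' hP0
  have hP0' : PowerSeries.constantCoeff P' = 0 := by
    have := hP₁'.constantCoeff
    rw [← PowerSeries.coeff_zero_eq_constantCoeff_apply, coeff_toField] at this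
    simpa using this
  obtain ⟨S, hS⟩ := PowerSeries.X_dvd_iff.2 hP0'
  obtain ⟨f₁, hf₁⟩ := PowerSeries.X_dvd_iff.2 hf0
  -- `V = (P' / T) ∘ f`
  set V := S.subst f with hV
  have hfV : P'.subst f = f * V := by
    rw [hS, PowerSeries.subst_mul hsf, PowerSeries.subst_X hsf]
  have hPW : f.subst P = P * f₁.subst P := by
    conv_lhs => rw [hf₁]
    rw [PowerSeries.subst_mul hsP, PowerSeries.subst_X hsP]
  have hScoeff : ∀ d, PowerSeries.coeff d S = PowerSeries.coeff (d + 1) P' := fun d => by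
    rw [hS, mul_comm, PowerSeries.coeff_succ_mul_X]
  have hV0 : PowerSeries.coeff 0 V = PowerSeries.coeff 1 P' := by
    obtain ⟨s, hs⟩ : PowerSeries.X ∣ S - PowerSeries.C (PowerSeries.constantCoeff S) :=
      PowerSeries.X_dvd_iff.2 (by simp)
    have : V = f * s.subst f + PowerSeries.C (PowerSeries.constantCoeff S) := by
      rw [hV]
      conv_lhs => rw [sub_eq_iff_eq_add.1 hs]
      rw [PowerSeries.subst_add hsf, PowerSeries.subst_mul hsf, PowerSeries.subst_X hsf,
        PowerSeries.subst_C]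
      rfl
    rw [this, ← zero_add 1, ← hScoeff]
    simp [hf0]
  have hVfield : toField V = (toField S).subst (toField f) := PowerSeries.map_subst hsf S
  have hft0 : PowerSeries.constantCoeff (toField f) = 0 := by
    rw [← PowerSeries.coeff_zero_eq_constantCoeff_apply, coeff_toField,
      PowerSeries.coeff_zero_eq_constantCoeff_apply, hf0]
    rfl
  set c := ‖PowerSeries.coeff 1 (toField P')‖ with hc
  have hc0 : 0 < c := norm_pos_iff.2 hP₁'.ne_zero
  have hVone : ‖PowerSeries.coeff 0 (toField V)‖ = c := by
    rw [coeff_toField, hV0, hc, coeff_toField]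
  have hVlt : ∀ n, 0 < n → wt (toField V) r₀ n < c := by
    intro n hn
    rw [hVfield]
    refine wt_subst_lt_of_forall hft0 hc0 n fun d => ?_
    rcases Nat.eq_zero_or_pos d with rfl | hd
    · simpa [wt, PowerSeries.coeff_one, hn.ne'] using hc0
    have hle := hP₁'.le (d + 1)
    rw [wt, pow_succ, ← mul_assoc] at hle
    have hle := le_of_mul_le_mul_right hle hP₁'.pos
    rw [coeff_toField, hScoeff, ← coeff_toField]
    by_cases h0 : PowerSeries.coeff (d + 1) (toField P') = 0
    · simpa [h0] using hc0
    calc _ ≤ ‖PowerSeries.coeff (d + 1) (toField P')‖ * (r₀ ^ M) ^ d := by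
          gcongr; exact wt_pow_le hr₀pos.le hf d n
      _ < ‖PowerSeries.coeff (d + 1) (toField P')‖ * r₁' ^ d := by
          have := norm_pos_iff.2 h0
          have := hd.ne'
          gcongr
      _ ≤ c := hle
  have hVlast : IsLast (toField V) r₀ 0 := by
    have h0 : wt (toField V) r₀ 0 = c := by rw [wt, hVone, pow_zero, mul_one]
    refine ⟨norm_ne_zero_iff.1 (hVone ▸ hc0.ne'), fun k => ?_, fun k hk => ?_⟩
    · rcases Nat.eq_zero_or_pos k with rfl | hk
      · exact le_rfl
      · exact h0 ▸ (hVlt k hk).le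
    · exact h0 ▸ hVlt k hk
  have hVne : V ≠ 0 := fun h => hVlast.ne_zero (by rw [h]; simp)
  obtain ⟨k₀, hk₀, hk₀eq⟩ := hP.exists_eq
  have hk₀ne : PowerSeries.coeff k₀ P ≠ 0 := by
    intro h
    rw [wt, coeff_toField, h] at hk₀eq
    have := pow_pos hP.pos N
    simp at hk₀eq
    linarith
  obtain ⟨Q, R, hdeg, hdiv⟩ := exists_weierstrass_division (by simpa using hP.unit) hPlt
    ⟨k₀, hk₀, hk₀ne⟩ f
  by_cases hR : (R : PowerSeries (ValRing L)) = 0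
  · exact ⟨Q, by rw [hdiv, hR, add_zero]⟩
  exfalso
  -- comparison of the number of zeros of the two sides in the disc of radius `r₀`
  have hprod : (R : PowerSeries (ValRing L)) * V = P * (f₁.subst P - Q * V) := by
    have h1 : f * V = P * f₁.subst P := by rw [← hfV, ← hcomm, hPW]
    rw [mul_sub, ← h1, hdiv]
    ring
  have hW0 : f₁.subst P - Q * V ≠ 0 := by
    intro h
    rw [h, mul_zero] at hprod
    exact (mul_ne_zero hR hVne) hprod
  have hRfield : toField (R : PowerSeries (ValRing L)) ≠ 0 := fun h =>
    hR (toField_injective (by simpa using h))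
  have hWfield : toField (f₁.subst P - Q * V) ≠ 0 := fun h =>
    hW0 (toField_injective (by simpa using h))
  obtain ⟨i, hi⟩ := exists_isLast (norm_coeff_toField_le _) hRfield hr₀pos hr₀1
  obtain ⟨j, hj⟩ := exists_isLast (norm_coeff_toField_le _) hWfield hr₀pos hr₀1
  have hl := IsLast.mul hr₀pos hi hVlast
  have hr := IsLast.mul hr₀pos (hP.isLast hr₀ hr₀1) hj
  rw [toField, toField, ← map_mul, hprod, map_mul] at hl
  have hiN : i < N := by
    by_contra! h
    refine hi.ne_zero ?_
    rw [coeff_toField, Polynomial.coeff_coe, Polynomial.coeff_eq_zero_of_degree_lt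
      (hdeg.trans_le (by exact_mod_cast h))]
    rfl
  have hlt : i + 0 < N + j := by omega
  exact absurd (hl.lt _ hlt) (hr.le _).not_gt

end Divisibility

/-! ### Formal addition and homomorphisms of formal modules -/

section SubstZero

variable {R : Type*} [CommRing R]

lemma hasSubst_pair {σ : Type*} {a b : MvPowerSeries σ R} (ha : MvPowerSeries.constantCoeff a = 0)
    (hb : MvPowerSeries.constantCoeff b = 0) : MvPowerSeries.HasSubst ![a, b] :=
  MvPowerSeries.hasSubst_of_constantCoeff_zero (by intro i; fin_cases i <;> simp [ha, hb])

lemma mvSubst_psSubst {σ τ : Type*} {a : MvPowerSeries σ R}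
    (ha : MvPowerSeries.constantCoeff a = 0) {u : σ → MvPowerSeries τ R}
    (hu : MvPowerSeries.HasSubst u) (φ : PowerSeries R) :
    MvPowerSeries.subst u (φ.subst a) = φ.subst (MvPowerSeries.subst u a) := by
  rw [PowerSeries.subst_def, PowerSeries.subst_def, MvPowerSeries.subst_comp_subst_apply
    (PowerSeries.HasSubst.of_constantCoeff_zero ha).const hu]

lemma constantCoeff_subst_X {σ : Type*} {Q : PowerSeries R}
    (hQ : PowerSeries.constantCoeff Q = 0) (i : σ) :
    MvPowerSeries.constantCoeff (Q.subst (MvPowerSeries.X i : MvPowerSeries σ R)) = 0 :=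
  PowerSeries.constantCoeff_subst_eq_zero (by simp) _ hQ

/-- A power series in two variables vanishing for `X = 0` is divisible by `X`. -/
lemma X_dvd_of_subst_zero {H : MvPowerSeries (Fin 2) R}
    (h : H.subst ![(0 : MvPowerSeries (Fin 2) R), MvPowerSeries.X 1] = 0) :
    MvPowerSeries.X 0 ∣ H := by
  classical
  rw [MvPowerSeries.X_dvd_iff]
  intro m hm
  have hsub : MvPowerSeries.HasSubst ![(0 : MvPowerSeries (Fin 2) R), MvPowerSeries.X 1] :=
    hasSubst_pair (by simp) (by simp)
  have h1 := congrArg (MvPowerSeries.coeff m) h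
  rw [MvPowerSeries.coeff_subst hsub, finsum_eq_single _ m] at h1
  · rw [Finsupp.prod_fintype _ _ (by simp), Fin.prod_univ_two] at h1
    have hm1 : m = Finsupp.single 1 (m 1) := by
      ext i; fin_cases i <;> simp [hm]
    simp only [Matrix.cons_val_zero, Matrix.cons_val_one, hm, pow_zero, one_mul,
      MvPowerSeries.coeff_X_pow] at h1
    rw [if_pos hm1] at h1
    simpa using h1
  · intro d hd
    rw [Finsupp.prod_fintype _ _ (by simp), Fin.prod_univ_two]
    simp only [Matrix.cons_val_zero, Matrix.cons_val_one]
    by_cases hd0 : d 0 = 0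
    · rw [hd0, pow_zero, one_mul, MvPowerSeries.coeff_X_pow, if_neg, smul_zero]
      intro hmd
      refine hd ?_
      have h11 : m 1 = d 1 := by rw [hmd]; simp
      ext i; fin_cases i
      · simp [hd0, hm]
      · simp [h11]
    · rw [zero_pow hd0, zero_mul, map_zero, smul_zero]

/-- A power series in two variables vanishing on the diagonal is divisible by `X - Y`. -/
lemma sub_dvd_of_subst_diag {H : MvPowerSeries (Fin 2) R}
    (h : H.subst ![(MvPowerSeries.X 1 : MvPowerSeries (Fin 2) R), MvPowerSeries.X 1] = 0) :
    MvPowerSeries.X 0 - MvPowerSeries.X 1 ∣ H := by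
  have h1 : MvPowerSeries.HasSubst
      ![(MvPowerSeries.X 0 + MvPowerSeries.X 1 : MvPowerSeries (Fin 2) R),
      MvPowerSeries.X 1] := hasSubst_pair (by simp) (by simp)
  have h2 : MvPowerSeries.HasSubst ![(0 : MvPowerSeries (Fin 2) R), MvPowerSeries.X 1] :=
    hasSubst_pair (by simp) (by simp)
  have h3 : MvPowerSeries.HasSubst
      ![(MvPowerSeries.X 0 - MvPowerSeries.X 1 : MvPowerSeries (Fin 2) R),
      MvPowerSeries.X 1] := hasSubst_pair (by simp) (by simp)
  have hd : MvPowerSeries.X 0 ∣ H.subst ![(MvPowerSeries.X 0 + MvPowerSeries.X 1 :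
      MvPowerSeries (Fin 2) R), MvPowerSeries.X 1] := by
    apply X_dvd_of_subst_zero
    rw [MvPowerSeries.subst_comp_subst_apply h1 h2]
    refine Eq.trans ?_ h
    congr 1
    ext1 i; fin_cases i
    · simp [MvPowerSeries.subst_add h2, MvPowerSeries.subst_X h2]
    · simp [MvPowerSeries.subst_X h2]
  obtain ⟨K, hK⟩ := hd
  have h4 := congrArg (MvPowerSeries.subst ![(MvPowerSeries.X 0 - MvPowerSeries.X 1 :
    MvPowerSeries (Fin 2) R), MvPowerSeries.X 1]) hK
  rw [MvPowerSeries.subst_mul h3, MvPowerSeries.subst_X h3,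
    MvPowerSeries.subst_comp_subst_apply h1 h3] at h4
  refine ⟨_, Eq.trans ?_ h4⟩
  conv_lhs => rw [← id_eq H, ← MvPowerSeries.subst_self]
  congr 1
  ext1 i; fin_cases i
  · simp [MvPowerSeries.subst_add h3, MvPowerSeries.subst_X h3]
  · simp [MvPowerSeries.subst_X h3]

end SubstZero

namespace FormalModule

variable {O : Type*} {R : Type*} {S : Type*} [CommRing O] [CommRing R] [CommRing S]
  [Algebra O R] [Algebra O S]

/-- The formal sum `G(a, b)` of two power series without constant term. -/
def add (G : FormalModule O R) {σ : Type*} (a b : MvPowerSeries σ R) : MvPowerSeries σ R :=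
  G.toPowerSeries.subst ![a, b]

section Add

variable {G G' : FormalModule O R} {σ τ : Type*} {a b c : MvPowerSeries σ R}

lemma constantCoeff_add (G : FormalModule O R) (ha : MvPowerSeries.constantCoeff a = 0)
    (hb : MvPowerSeries.constantCoeff b = 0) : MvPowerSeries.constantCoeff (G.add a b) = 0 :=
  MvPowerSeries.constantCoeff_subst_eq_zero (hasSubst_pair ha hb)
    (by intro i; fin_cases i <;> simp [ha, hb]) G.zero_constantCoeff

lemma subst_add_mv (G : FormalModule O R) (ha : MvPowerSeries.constantCoeff a = 0)
    (hb : MvPowerSeries.constantCoeff b = 0) {u : σ → MvPowerSeries τ R}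
    (hu : MvPowerSeries.HasSubst u) :
    (G.add a b).subst u = G.add (a.subst u) (b.subst u) := by
  rw [add, add, MvPowerSeries.subst_comp_subst_apply (hasSubst_pair ha hb) hu]
  congr 1
  ext1 i; fin_cases i <;> rfl

lemma subst_add_ps (G : FormalModule O R) {a b : PowerSeries R}
    (ha : PowerSeries.constantCoeff a = 0) (hb : PowerSeries.constantCoeff b = 0)
    {u : MvPowerSeries τ R} (hu : MvPowerSeries.constantCoeff u = 0) :
    PowerSeries.subst u (G.add a b : PowerSeries R) = G.add (a.subst u) (b.subst u) :=
  subst_add_mv G ha hb (PowerSeries.HasSubst.of_constantCoeff_zero hu).const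

lemma add_assoc (G : FormalModule O R) (ha : MvPowerSeries.constantCoeff a = 0)
    (hb : MvPowerSeries.constantCoeff b = 0) (hc : MvPowerSeries.constantCoeff c = 0) :
    G.add (G.add a b) c = G.add a (G.add b c) :=
  G.assoc' (PowerSeries.HasSubst.of_constantCoeff_zero ha)
    (PowerSeries.HasSubst.of_constantCoeff_zero hb) (PowerSeries.HasSubst.of_constantCoeff_zero hc)

lemma add_zero (G : FormalModule O R) (ha : MvPowerSeries.constantCoeff a = 0) :
    G.add a 0 = a :=
  G.toFormalGroup.add_zero (PowerSeries.HasSubst.of_constantCoeff_zero ha)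

lemma zero_add (G : FormalModule O R) (ha : MvPowerSeries.constantCoeff a = 0) :
    G.add 0 a = a :=
  G.toFormalGroup.zero_add (PowerSeries.HasSubst.of_constantCoeff_zero ha)

lemma IsHom.subst_add {f : PowerSeries R} (hf : IsHom G G' f)
    (ha : MvPowerSeries.constantCoeff a = 0) (hb : MvPowerSeries.constantCoeff b = 0) :
    f.subst (G.add a b) = G'.add (f.subst a) (f.subst b) := by
  have hab := hasSubst_pair ha hb
  have h := congrArg (MvPowerSeries.subst ![a, b]) hf.map_add
  have hG := PowerSeries.HasSubst.of_constantCoeff_zero G.zero_constantCoeff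
  have hX (i : Fin 2) : MvPowerSeries.constantCoeff
      (f.subst (MvPowerSeries.X i : MvPowerSeries (Fin 2) R)) = 0 :=
    PowerSeries.constantCoeff_subst_eq_zero (by simp) _ hf.constantCoeff
  have hs (i : Fin 2) : MvPowerSeries.subst ![a, b]
      (f.subst (MvPowerSeries.X i : MvPowerSeries (Fin 2) R)) = f.subst (![a, b] i) := by
    rw [mvSubst_psSubst (by simp) hab, MvPowerSeries.subst_X hab]
  rw [PowerSeries.subst, MvPowerSeries.subst_comp_subst_apply hG.const hab] at h
  refine h.trans ?_
  have := subst_add_mv G' (hX 0) (hX 1) hab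
  rw [hs, hs] at this
  exact this

lemma act_isHom (G : FormalModule O R) (x : O) : IsHom G G (G.act x) where
  constantCoeff := G.act_constantCoeff x
  map_add := G.act_hom x
  map_act y := by rw [← G.act_mul, ← G.act_mul, mul_comm]

lemma act_zero (G : FormalModule O R) : G.act 0 = 0 := by
  -- `[0]` is idempotent for composition and its linear coefficient vanishes
  have h := G.act_mul 0 0
  rw [mul_zero] at h
  set z := G.act 0 with hz
  have h0 : PowerSeries.constantCoeff z = 0 := G.act_constantCoeff 0
  have h1 : PowerSeries.coeff 1 z = 0 := by rw [hz, G.act_coeff_one, map_zero]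
  have hs := PowerSeries.HasSubst.of_constantCoeff_zero' h0
  obtain ⟨w, hw⟩ := PowerSeries.X_pow_dvd_iff (n := 2) (φ := z) |>.2 fun m hm => by
    interval_cases m
    · simpa using h0
    · exact h1
  have hzw : z = PowerSeries.subst z (PowerSeries.X ^ 2 * w) := by rw [← hw]; exact h
  have hdiv : ∀ n, PowerSeries.X ^ n ∣ z := by
    intro n
    induction n with
    | zero => simp
    | succ n ih =>
      rw [hzw, PowerSeries.subst_mul hs, PowerSeries.subst_pow hs, PowerSeries.subst_X hs, pow_two,
        pow_succ]
      exact (mul_dvd_mul ih (PowerSeries.X_dvd_iff.2 h0)).mul_right _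
  ext n
  simpa using PowerSeries.X_pow_dvd_iff.1 (hdiv (n + 1)) n (Nat.lt_succ_self n)

lemma add_neg (G : FormalModule O R) (ha : MvPowerSeries.constantCoeff a = 0) :
    G.add a ((G.act (-1)).subst a) = 0 := by
  have h := G.act_add 1 (-1)
  rw [add_neg_cancel, act_zero, G.act_one] at h
  have h1 := G.subst_add_ps (a := PowerSeries.X) (by simp) (G.act_constantCoeff (-1)) ha
  have hs := PowerSeries.HasSubst.of_constantCoeff_zero ha
  rw [PowerSeries.subst_X hs] at h1
  rw [← h1, add, ← h, ← PowerSeries.coe_substAlgHom hs, map_zero]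

lemma neg_add (G : FormalModule O R) (ha : MvPowerSeries.constantCoeff a = 0) :
    G.add ((G.act (-1)).subst a) a = 0 := by
  have h := G.act_add (-1) 1
  rw [neg_add_cancel, act_zero, G.act_one] at h
  have h1 := G.subst_add_ps (b := PowerSeries.X) (G.act_constantCoeff (-1)) (by simp) ha
  have hs := PowerSeries.HasSubst.of_constantCoeff_zero ha
  rw [PowerSeries.subst_X hs] at h1
  rw [← h1, add, ← h, ← PowerSeries.coe_substAlgHom hs, map_zero]

/-- `a` divides `G(a, b) - b`. -/
lemma dvd_add_sub (G : FormalModule O R) (ha : MvPowerSeries.constantCoeff a = 0)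
    (hb : MvPowerSeries.constantCoeff b = 0) : a ∣ G.add a b - b := by
  have hs := hasSubst_pair ha hb
  have h0 : MvPowerSeries.HasSubst ![(0 : MvPowerSeries (Fin 2) R), MvPowerSeries.X 1] :=
    hasSubst_pair (by simp) (by simp)
  obtain ⟨K, hK⟩ : MvPowerSeries.X 0 ∣ G.toPowerSeries - MvPowerSeries.X 1 := by
    apply X_dvd_of_subst_zero
    rw [MvPowerSeries.subst_sub h0, MvPowerSeries.subst_X h0]
    have := G.zero_add (a := (MvPowerSeries.X 1 : MvPowerSeries (Fin 2) R)) (by simp)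
    rw [add] at this
    rw [this]
    simp
  have h1 := congrArg (MvPowerSeries.subst ![a, b]) hK
  rw [MvPowerSeries.subst_sub hs, MvPowerSeries.subst_mul hs, MvPowerSeries.subst_X hs,
    MvPowerSeries.subst_X hs] at h1
  exact ⟨_, h1⟩

lemma subst_add_neg_X (G : FormalModule O R) (hs : MvPowerSeries.HasSubst ![a, b]) :
    MvPowerSeries.subst ![a, b] (G.add (MvPowerSeries.X 0 : MvPowerSeries (Fin 2) R)
      ((G.act (-1)).subst (MvPowerSeries.X 1 : MvPowerSeries (Fin 2) R))) =
      G.add a ((G.act (-1)).subst b) := by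
  rw [subst_add_mv G (by simp) (PowerSeries.constantCoeff_subst_eq_zero (by simp) _
    (G.act_constantCoeff _)) hs, MvPowerSeries.subst_X hs, PowerSeries.subst,
    MvPowerSeries.subst_comp_subst_apply (PowerSeries.HasSubst.X _).const hs]
  simp only [MvPowerSeries.subst_X hs]
  rfl

/-- `a - b` divides the formal difference of `a` and `b`. -/
lemma sub_dvd_add_neg (G : FormalModule O R) (ha : MvPowerSeries.constantCoeff a = 0)
    (hb : MvPowerSeries.constantCoeff b = 0) : a - b ∣ G.add a ((G.act (-1)).subst b) := by
  have hs := hasSubst_pair ha hb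
  obtain ⟨K, hK⟩ : MvPowerSeries.X 0 - MvPowerSeries.X 1 ∣
      G.add (MvPowerSeries.X 0 : MvPowerSeries (Fin 2) R)
      ((G.act (-1)).subst (MvPowerSeries.X 1 : MvPowerSeries (Fin 2) R)) := by
    apply sub_dvd_of_subst_diag
    rw [subst_add_neg_X G (hasSubst_pair (by simp) (by simp)), G.add_neg (by simp)]
  have h1 := congrArg (MvPowerSeries.subst ![a, b]) hK
  rw [subst_add_neg_X G hs, MvPowerSeries.subst_mul hs, MvPowerSeries.subst_sub hs,
    MvPowerSeries.subst_X hs, MvPowerSeries.subst_X hs] at h1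
  exact ⟨_, h1⟩

/-- The formal difference of an endomorphism `g` and the identity commutes with the action. -/
lemma IsHom.sub_id_comm {g : PowerSeries R} (hg : IsHom G G g) (x : O) :
    PowerSeries.subst (G.act x) (G.add g (G.act (-1)) : PowerSeries R) =
      (G.act x).subst (G.add g (G.act (-1)) : PowerSeries R) := by
  rw [G.subst_add_ps hg.constantCoeff (G.act_constantCoeff _) (G.act_constantCoeff x),
    hg.map_act, ← G.act_mul, mul_comm, G.act_mul]
  exact ((G.act_isHom x).subst_add hg.constantCoeff (G.act_constantCoeff _)).symm

/-- `g` is recovered from its formal difference with the identity. -/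
lemma add_sub_id {g : PowerSeries R} (hg : PowerSeries.constantCoeff g = 0) :
    G.add (G.add g (G.act (-1)) : PowerSeries R) PowerSeries.X = g := by
  have h := G.neg_add (a := (PowerSeries.X : PowerSeries R)) PowerSeries.constantCoeff_X
  have h2 : PowerSeries.subst (PowerSeries.X : PowerSeries R) (G.act (-1)) = G.act (-1) :=
    PowerSeries.X_subst _
  rw [h2] at h
  rw [G.add_assoc hg (G.act_constantCoeff _) PowerSeries.constantCoeff_X, h, G.add_zero hg]

end Add

lemma map_add (φ : R →ₐ[O] S) (G : FormalModule O R) {σ : Type*} {a b : MvPowerSeries σ R}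
    (ha : MvPowerSeries.constantCoeff a = 0) (hb : MvPowerSeries.constantCoeff b = 0) :
    (G.add a b).map (φ : R →+* S) = (G.map φ).add (a.map (φ : R →+* S)) (b.map (φ : R →+* S)) := by
  rw [add, add, MvPowerSeries.map_subst (hasSubst_pair ha hb), map_vec]
  rfl

lemma map_subst_law (G : FormalModule O R) (q : R →ₐ[O] S) (f : PowerSeries R) :
    MvPowerSeries.map (q : R →+* S) (f.subst G.toPowerSeries) =
      (f.map (q : R →+* S)).subst (G.map q).toPowerSeries :=
  PowerSeries.map_subst (PowerSeries.HasSubst.of_constantCoeff_zero G.zero_constantCoeff) f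

lemma map_law_subst (G : FormalModule O R) (q : R →ₐ[O] S) {f : PowerSeries R}
    (hf : PowerSeries.constantCoeff f = 0) :
    MvPowerSeries.map (q : R →+* S) (G.toPowerSeries.subst
      ![f.subst (MvPowerSeries.X 0 : MvPowerSeries (Fin 2) R),
        f.subst (MvPowerSeries.X 1 : MvPowerSeries (Fin 2) R)]) =
      (G.map q).toPowerSeries.subst
        ![(f.map (q : R →+* S)).subst (MvPowerSeries.X 0 : MvPowerSeries (Fin 2) S),
          (f.map (q : R →+* S)).subst (MvPowerSeries.X 1 : MvPowerSeries (Fin 2) S)] := by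
  rw [MvPowerSeries.map_subst (hasSubst_pair (constantCoeff_subst_X hf (0 : Fin 2))
    (constantCoeff_subst_X hf 1)), map_vec, PowerSeries.map_subst (PowerSeries.HasSubst.X 0),
    PowerSeries.map_subst (PowerSeries.HasSubst.X 1), MvPowerSeries.map_X, MvPowerSeries.map_X]
  rfl

lemma IsHom.map (φ : R →ₐ[O] S) {G G' : FormalModule O R} {f : PowerSeries R} (hf : IsHom G G' f) :
    IsHom (G.map φ) (G'.map φ) (f.map (φ : R →+* S)) where
  constantCoeff := by
    have := hf.constantCoeff
    rw [← PowerSeries.coeff_zero_eq_constantCoeff_apply] at this ⊢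
    simp [this]
  map_add := by
    rw [← G.map_subst_law φ, ← G'.map_law_subst φ hf.constantCoeff, hf.map_add]
  map_act x := by
    have h := congrArg (PowerSeries.map (φ : R →+* S)) (hf.map_act x)
    have h1 := PowerSeries.map_subst (h := (φ : R →+* S))
      (PowerSeries.HasSubst.of_constantCoeff_zero (G.act_constantCoeff x)) f
    have h2 := PowerSeries.map_subst (h := (φ : R →+* S))
      (PowerSeries.HasSubst.of_constantCoeff_zero hf.constantCoeff) (G'.act x)
    exact (h1.symm.trans h).trans h2

lemma map_comp {T : Type*} [CommRing T] [Algebra O T] (G : FormalModule O R) (φ : R →ₐ[O] S)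
    (ψ : S →ₐ[O] T) : (G.map φ).map ψ = G.map (ψ.comp φ) := by
  ext <;> simp [map]

lemma isHom_X (G : FormalModule O R) : IsHom G G PowerSeries.X := by
  rw [← G.act_one]; exact G.act_isHom 1

end FormalModule

/-! ### Series constant on the fibres of another series -/

section Descent

variable {R : Type*} [CommRing R]

/-- If `a` is regular modulo `p` and `A = a X + ⋯`, then `A` is regular modulo the
constant `p`. -/
lemma C_dvd_of_C_dvd_mul {p a : R} (hreg : ∀ b, p ∣ a * b → p ∣ b) {A B : PowerSeries R}
    (hA0 : PowerSeries.constantCoeff A = 0) (hA1 : PowerSeries.coeff 1 A = a)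
    (h : PowerSeries.C p ∣ A * B) : PowerSeries.C p ∣ B := by
  obtain ⟨D, hD⟩ := h
  obtain ⟨A', rfl⟩ := PowerSeries.X_dvd_iff.2 hA0
  have ha : PowerSeries.coeff 0 A' = a := by
    rw [← hA1, mul_comm, ← zero_add 1, PowerSeries.coeff_succ_mul_X]
  have hdvd : ∀ n, p ∣ PowerSeries.coeff n (A' * B) := fun n => by
    have h1 := congrArg (PowerSeries.coeff (n + 1)) hD
    rw [mul_assoc, mul_comm PowerSeries.X, PowerSeries.coeff_succ_mul_X,
      PowerSeries.coeff_C_mul] at h1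
    exact ⟨_, h1⟩
  have hB : ∀ n, p ∣ PowerSeries.coeff n B := by
    intro n
    induction n using Nat.strong_induction_on with
    | _ n ih =>
      refine hreg _ ?_
      have h1 := hdvd n
      rw [PowerSeries.coeff_mul, ← Finset.add_sum_erase _ _
        (Finset.HasAntidiagonal.mem_antidiagonal.2 (zero_add n) :
          ((0, n) : ℕ × ℕ) ∈ Finset.HasAntidiagonal.antidiagonal n)] at h1
      rw [ha] at h1
      refine (dvd_add_left (Finset.dvd_sum fun q hq => ?_)).1 h1
      rw [Finset.mem_erase, Finset.HasAntidiagonal.mem_antidiagonal] at hq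
      refine (ih q.2 ?_).mul_left _
      have : q.1 ≠ 0 := fun h0 => hq.1 (by ext <;> simp <;> omega)
      omega
  choose B' hB' using hB
  exact ⟨PowerSeries.mk B', by ext n; rw [PowerSeries.coeff_C_mul, PowerSeries.coeff_mk, hB']⟩

/-- The first of two variables. The index type `Option Unit` lets series in the two variables be
read as series in the first one, by `MvPowerSeries.optionEquivLeft`. -/
abbrev xVar (R : Type*) [CommRing R] : MvPowerSeries (Option Unit) R := MvPowerSeries.X none

/-- The second variable. -/
abbrev yVar (R : Type*) [CommRing R] : MvPowerSeries (Option Unit) R := MvPowerSeries.X (some ())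

lemma optionEquivLeft_subst_xVar (P : PowerSeries R) :
    MvPowerSeries.optionEquivLeft Unit R (P.subst (xVar R)) =
      P.map (MvPowerSeries.C : R →+* MvPowerSeries Unit R) := by
  classical
  refine PowerSeries.ext fun n => MvPowerSeries.ext fun x => ?_
  rw [MvPowerSeries.coeff_coeff_optionEquivLeft, PowerSeries.coeff_subst_single,
    PowerSeries.coeff_map, MvPowerSeries.coeff_C]
  have hiff : x.optionElim n = Finsupp.single none (x.optionElim n none) ↔ x = 0 := by
    constructor
    · intro h
      ext
      simpa using DFunLike.congr_fun h (some ())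
    · rintro rfl
      ext (_ | _) <;> simp
  by_cases h : x = 0
  · rw [if_pos (hiff.2 h), if_pos h, Finsupp.optionElim_apply_none]
  · rw [if_neg (mt hiff.1 h), if_neg h]

lemma optionEquivLeft_subst_yVar (P : PowerSeries R) :
    MvPowerSeries.optionEquivLeft Unit R (P.subst (yVar R)) =
      PowerSeries.C (R := MvPowerSeries Unit R) P := by
  classical
  refine PowerSeries.ext fun n => MvPowerSeries.ext fun x => ?_
  rw [MvPowerSeries.coeff_coeff_optionEquivLeft, PowerSeries.coeff_subst_single,
    PowerSeries.coeff_C]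
  have hiff : x.optionElim n = Finsupp.single (some ()) (x.optionElim n (some ())) ↔ n = 0 := by
    constructor
    · intro h
      simpa using DFunLike.congr_fun h none
    · rintro rfl
      ext (_ | _) <;> simp
  have hx : x = Finsupp.single () (x ()) := by ext; simp
  by_cases h : n = 0
  · rw [if_pos (hiff.2 h), if_pos h, Finsupp.optionElim_apply_some, PowerSeries.coeff, ← hx]
  · rw [if_neg (mt hiff.1 h), if_neg h, map_zero]

/-- The series `f` is constant on the fibres of `P`: the difference `f(X) - f(Y)` is divisible by
`P(X) - P(Y)`. -/
def FibreConst (P f : PowerSeries R) : Prop :=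
  P.subst (xVar R) - P.subst (yVar R) ∣ f.subst (xVar R) - f.subst (yVar R)

variable [IsDomain R] {P : PowerSeries R}

/-- A series constant on the fibres of `P` is, up to a constant, `P` times such a series. -/
lemma FibreConst.exists_eq {f : PowerSeries R} (hP0 : PowerSeries.constantCoeff P = 0) (hP : P ≠ 0)
    (hreg : ∀ b, P ∣ PowerSeries.C (PowerSeries.coeff 1 P) * b → P ∣ b) (hf : FibreConst P f) :
    ∃ f₁, f = PowerSeries.C (PowerSeries.constantCoeff f) + P * f₁ ∧ FibreConst P f₁ := by
  obtain ⟨H, hH⟩ := hf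
  have hx : PowerSeries.HasSubst (xVar R) := PowerSeries.HasSubst.X _
  have hy : PowerSeries.HasSubst (yVar R) := PowerSeries.HasSubst.X _
  set u : Option Unit → MvPowerSeries Unit R := fun i => i.elim PowerSeries.X 0 with hu_def
  have hu : MvPowerSeries.HasSubst u := MvPowerSeries.hasSubst_of_constantCoeff_zero (by
    rintro (_ | _)
    · exact PowerSeries.constantCoeff_X
    · simp [u])
  have hux : ∀ φ : PowerSeries R, MvPowerSeries.subst u (φ.subst (xVar R)) = φ := fun φ => by
    rw [PowerSeries.subst, MvPowerSeries.subst_comp_subst_apply hx.const hu]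
    simp only [MvPowerSeries.subst_X hu]
    exact PowerSeries.X_subst φ
  have huy : ∀ φ : PowerSeries R, MvPowerSeries.subst u (φ.subst (yVar R)) =
      PowerSeries.C (PowerSeries.constantCoeff φ) := fun φ => by
    rw [PowerSeries.subst, MvPowerSeries.subst_comp_subst_apply hy.const hu]
    simp only [MvPowerSeries.subst_X hu]
    have := PowerSeries.subst_zero_eq_C_constantCoeff (τ := Unit) (S := R) (f := φ)
    rw [Algebra.algebraMap_self] at this
    refine Eq.trans this ?_
    rw [MvPowerSeries.map_id]
    rfl
  have h1 := congrArg (MvPowerSeries.subst u) hH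
  rw [MvPowerSeries.subst_mul hu, MvPowerSeries.subst_sub hu, MvPowerSeries.subst_sub hu, hux, hux,
    huy, huy, hP0, map_zero, sub_zero, sub_eq_iff_eq_add'] at h1
  set f₁ : PowerSeries R := MvPowerSeries.subst u H with hf₁
  refine ⟨f₁, h1, ?_⟩
  set Px := P.subst (xVar R)
  set Py := P.subst (yVar R)
  have hPy : Py ≠ 0 := by
    intro h0
    have h2 := optionEquivLeft_subst_yVar P
    rw [show P.subst (yVar R) = 0 from h0, map_zero] at h2
    have h3 := congrArg (PowerSeries.coeff 0) h2
    rw [PowerSeries.coeff_zero_C, map_zero] at h3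
    exact hP h3.symm
  have hfx : f.subst (xVar R) =
      MvPowerSeries.C (PowerSeries.constantCoeff f) + Px * f₁.subst (xVar R) := by
    conv_lhs => rw [h1]
    rw [PowerSeries.subst_add hx, PowerSeries.subst_mul hx, PowerSeries.subst_C]
  have hfy : f.subst (yVar R) =
      MvPowerSeries.C (PowerSeries.constantCoeff f) + Py * f₁.subst (yVar R) := by
    conv_lhs => rw [h1]
    rw [PowerSeries.subst_add hy, PowerSeries.subst_mul hy, PowerSeries.subst_C]
  rw [hfx, hfy] at hH
  -- `P(Y)` divides `P(X) (H - f₁(X))`, hence `H - f₁(X)`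
  have hdvd : Py ∣ Px * (H - f₁.subst (xVar R)) :=
    ⟨H - f₁.subst (yVar R), by linear_combination -hH⟩
  obtain ⟨K, hK⟩ : Py ∣ H - f₁.subst (xVar R) := by
    rw [← map_dvd_iff (MvPowerSeries.optionEquivLeft Unit R)] at hdvd ⊢
    rw [map_mul, optionEquivLeft_subst_xVar, optionEquivLeft_subst_yVar] at hdvd
    rw [optionEquivLeft_subst_yVar]
    refine C_dvd_of_C_dvd_mul (R := MvPowerSeries Unit R) (p := P)
      (a := MvPowerSeries.C (PowerSeries.coeff 1 P)) hreg ?_ ?_ hdvd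
    · rw [← PowerSeries.coeff_zero_eq_constantCoeff_apply, PowerSeries.coeff_map,
        PowerSeries.coeff_zero_eq_constantCoeff_apply, hP0, map_zero]
    · rw [PowerSeries.coeff_map]
  refine ⟨K, mul_left_cancel₀ hPy ?_⟩
  linear_combination hH + (Px - Py) * hK

/-- A series which is constant on the fibres of `P` is a series in `P`. -/
lemma FibreConst.exists_subst {f : PowerSeries R} (hP0 : PowerSeries.constantCoeff P = 0)
    (hP : P ≠ 0) (hreg : ∀ b, P ∣ PowerSeries.C (PowerSeries.coeff 1 P) * b → P ∣ b)
    (hf : FibreConst P f) : ∃ g : PowerSeries R, f = g.subst P := by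
  have hs := PowerSeries.HasSubst.of_constantCoeff_zero' hP0
  choose F hF hFc using fun (f : {f // FibreConst P f}) => f.2.exists_eq hP0 hP hreg
  let s : ℕ → {f // FibreConst P f} := fun k => Nat.rec ⟨f, hf⟩ (fun _ f' => ⟨F f', hFc f'⟩) k
  have hs1 : ∀ k, (s k).1 =
      PowerSeries.C (PowerSeries.constantCoeff (s k).1) + P * (s (k + 1)).1 := fun k => hF (s k)
  let g : ℕ → PowerSeries R := fun k =>
    PowerSeries.mk fun j => PowerSeries.constantCoeff (s (k + j)).1
  have hg : ∀ k, g k = PowerSeries.C (PowerSeries.constantCoeff (s k).1) +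
      PowerSeries.X * g (k + 1) := fun k => by
    ext (_ | j)
    · simp [g]
    · rw [map_add, mul_comm, PowerSeries.coeff_succ_mul_X, PowerSeries.coeff_C]
      simp only [g, PowerSeries.coeff_mk, Nat.succ_ne_zero, if_false, zero_add]
      rw [Nat.add_right_comm, Nat.add_assoc]
  have hd : ∀ k, (s k).1 - (g k).subst P = P * ((s (k + 1)).1 - (g (k + 1)).subst P) := fun k => by
    have h1 : (g k).subst P = PowerSeries.C (PowerSeries.constantCoeff (s k).1) +
        P * (g (k + 1)).subst P := by
      rw [hg k, PowerSeries.subst_add hs, PowerSeries.subst_mul hs, PowerSeries.subst_X hs,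
        PowerSeries.subst_C]
      rfl
    rw [h1]
    linear_combination hs1 k
  have hdiv : ∀ n k, PowerSeries.X ^ n ∣ (s k).1 - (g k).subst P := fun n => by
    induction n with
    | zero => simp
    | succ n ih =>
      intro k
      rw [hd, pow_succ']
      exact mul_dvd_mul (PowerSeries.X_dvd_iff.2 hP0) (ih (k + 1))
  refine ⟨g 0, sub_eq_zero.1 ?_⟩
  ext n
  exact PowerSeries.X_pow_dvd_iff.1 (hdiv (n + 1) 0) n (Nat.lt_succ_self n)

end Descent

/-! ### Factorization of homomorphisms through the multiplication by a uniformizer -/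

section Cancellation

/-- Right cancellation of a nonzero series without constant term. -/
lemma eq_zero_of_subst_eq_zero {R : Type*} [CommRing R] [IsDomain R] {P A : PowerSeries R}
    (hP0 : PowerSeries.constantCoeff P = 0) (hP : P ≠ 0) (h : A.subst P = 0) : A = 0 := by
  by_contra hA
  have hs := PowerSeries.HasSubst.of_constantCoeff_zero' hP0
  have hd := PowerSeries.coeff_order hA
  set d := A.order.toNat
  obtain ⟨w, hw⟩ : PowerSeries.X ^ d ∣ A := PowerSeries.X_pow_dvd_iff.2 fun m hm =>
    PowerSeries.coeff_of_lt_order_toNat m hm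
  have hw0 : PowerSeries.constantCoeff w ≠ 0 := by
    rw [hw, PowerSeries.coeff_X_pow_mul', if_pos le_rfl, Nat.sub_self] at hd
    simpa using hd
  obtain ⟨z, hz⟩ : PowerSeries.X ∣ w - PowerSeries.C (PowerSeries.constantCoeff w) :=
    PowerSeries.X_dvd_iff.2 (by simp)
  rw [sub_eq_iff_eq_add] at hz
  rw [hw, PowerSeries.subst_mul hs, PowerSeries.subst_pow hs, PowerSeries.subst_X hs] at h
  have h1 : w.subst P = 0 := (mul_eq_zero.1 h).resolve_left (pow_ne_zero d hP)
  rw [hz, PowerSeries.subst_add hs, PowerSeries.subst_mul hs, PowerSeries.subst_X hs,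
    PowerSeries.subst_C] at h1
  have h2 := congrArg (PowerSeries.constantCoeff (R := R)) h1
  rw [_root_.map_add, map_mul, hP0, zero_mul, _root_.zero_add, map_zero] at h2
  exact hw0 h2

lemma subst_left_injective {R : Type*} [CommRing R] [IsDomain R] {P A B : PowerSeries R}
    (hP0 : PowerSeries.constantCoeff P = 0) (hP : P ≠ 0) (h : A.subst P = B.subst P) : A = B := by
  have hs := PowerSeries.HasSubst.of_constantCoeff_zero' hP0
  exact sub_eq_zero.1 (eq_zero_of_subst_eq_zero hP0 hP
    (by rw [PowerSeries.subst_sub hs, h, sub_self]))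

/-- Substituting a series with nonzero linear term for both variables is injective: over the
fraction field the series has a compositional inverse. -/
lemma subst_pair_injective {R : Type*} [CommRing R] {K : Type*} [Field K] {φ : R →+* K}
    (hφ : Function.Injective φ) {P : PowerSeries R}
    (hP0 : PowerSeries.constantCoeff P = 0) (hP1 : PowerSeries.coeff 1 P ≠ 0)
    {A B : MvPowerSeries (Fin 2) R}
    (h : A.subst ![P.subst (MvPowerSeries.X 0 : MvPowerSeries (Fin 2) R),
        P.subst (MvPowerSeries.X 1 : MvPowerSeries (Fin 2) R)] =
      B.subst ![P.subst (MvPowerSeries.X 0 : MvPowerSeries (Fin 2) R),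
        P.subst (MvPowerSeries.X 1 : MvPowerSeries (Fin 2) R)]) : A = B := by
  set PK := P.map φ with hPK
  have hPK0 : PowerSeries.constantCoeff PK = 0 := by
    rw [← PowerSeries.coeff_zero_eq_constantCoeff_apply, hPK, PowerSeries.coeff_map,
      PowerSeries.coeff_zero_eq_constantCoeff_apply, hP0, map_zero]
  have hPK1 : IsUnit (PowerSeries.coeff 1 PK) := by
    rw [hPK, PowerSeries.coeff_map]
    exact IsUnit.mk0 _ ((map_ne_zero_iff φ hφ).2 hP1)
  set Q := PK.substInvOfIsUnit hPK1 with hQ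
  have hQ0 : PowerSeries.constantCoeff Q = 0 := PowerSeries.constantCoeff_substInvOfIsUnit _ _
  have hPQ : PK.subst Q = PowerSeries.X := PowerSeries.subst_substInvOfIsUnit_right PK hPK0 hPK1
  have hp := hasSubst_pair (constantCoeff_subst_X hP0 (0 : Fin 2)) (constantCoeff_subst_X hP0 1)
  have hpK := hasSubst_pair (constantCoeff_subst_X hPK0 (0 : Fin 2)) (constantCoeff_subst_X hPK0 1)
  have hqK := hasSubst_pair (constantCoeff_subst_X hQ0 (0 : Fin 2)) (constantCoeff_subst_X hQ0 1)
  have hback (i : Fin 2) : MvPowerSeries.subst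
      ![Q.subst (MvPowerSeries.X 0 : MvPowerSeries (Fin 2) K),
        Q.subst (MvPowerSeries.X 1 : MvPowerSeries (Fin 2) K)]
      (PK.subst (MvPowerSeries.X i : MvPowerSeries (Fin 2) K)) = MvPowerSeries.X i := by
    rw [mvSubst_psSubst (by simp) hqK, MvPowerSeries.subst_X hqK]
    have h1 := PowerSeries.subst_comp_subst_apply (PowerSeries.HasSubst.of_constantCoeff_zero' hQ0)
      (PowerSeries.HasSubst.X i :
        PowerSeries.HasSubst (MvPowerSeries.X i : MvPowerSeries (Fin 2) K)) PK
    rw [hPQ, PowerSeries.subst_X (PowerSeries.HasSubst.X i)] at h1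
    rw [h1]
    fin_cases i <;> rfl
  have hinv (A : MvPowerSeries (Fin 2) K) :
      MvPowerSeries.subst ![Q.subst (MvPowerSeries.X 0 : MvPowerSeries (Fin 2) K),
        Q.subst (MvPowerSeries.X 1 : MvPowerSeries (Fin 2) K)]
      (A.subst ![PK.subst (MvPowerSeries.X 0 : MvPowerSeries (Fin 2) K),
        PK.subst (MvPowerSeries.X 1 : MvPowerSeries (Fin 2) K)]) = A := by
    rw [MvPowerSeries.subst_comp_subst_apply hpK hqK]
    conv_rhs => rw [← id_eq A, ← MvPowerSeries.subst_self]
    congr 1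
    ext1 i
    fin_cases i
    · exact hback 0
    · exact hback 1
  have hmap (A : MvPowerSeries (Fin 2) R) : MvPowerSeries.map φ
      (A.subst ![P.subst (MvPowerSeries.X 0 : MvPowerSeries (Fin 2) R),
        P.subst (MvPowerSeries.X 1 : MvPowerSeries (Fin 2) R)]) =
      (A.map φ).subst ![PK.subst (MvPowerSeries.X 0 : MvPowerSeries (Fin 2) K),
        PK.subst (MvPowerSeries.X 1 : MvPowerSeries (Fin 2) K)] := by
    rw [MvPowerSeries.map_subst hp, FormalModule.map_vec,
      PowerSeries.map_subst (PowerSeries.HasSubst.X 0), PowerSeries.map_subst (PowerSeries.HasSubst.X 1),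
      MvPowerSeries.map_X, MvPowerSeries.map_X]
  have h1 := congrArg (MvPowerSeries.map φ) h
  rw [hmap, hmap] at h1
  have h2 := congrArg (MvPowerSeries.subst ![Q.subst (MvPowerSeries.X 0 : MvPowerSeries (Fin 2) K),
        Q.subst (MvPowerSeries.X 1 : MvPowerSeries (Fin 2) K)]) h1
  rw [hinv, hinv] at h2
  ext m
  have h3 := congrArg (MvPowerSeries.coeff m) h2
  rw [MvPowerSeries.coeff_map, MvPowerSeries.coeff_map] at h3
  exact hφ h3

/-- The value at `1` of `c r ^ k`, from its values near `1`. -/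
lemma le_of_forall_mul_pow_le {c d s : ℝ} (hs : s < 1) (k : ℕ)
    (h : ∀ r, s < r → r < 1 → c * r ^ k ≤ d) : c ≤ d := by
  have ht : Filter.Tendsto (fun r : ℝ => c * r ^ k) (nhdsWithin 1 (Set.Iio 1)) (nhds c) := by
    have : Filter.Tendsto (fun r : ℝ => c * r ^ k) (nhds 1) (nhds (c * 1 ^ k)) :=
      (continuous_const.mul (continuous_pow k)).tendsto 1
    rw [one_pow, mul_one] at this
    exact this.mono_left nhdsWithin_le_nhds
  refine le_of_tendsto ht ?_
  filter_upwards [Ioo_mem_nhdsLT hs] with r hr using h r hr.1 hr.2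

end Cancellation

section Quotient

variable {L : Type*} [NormedField L] [IsUltrametricDist L]

/-- Nonzero constants are regular modulo a series whose reduction is nonzero. -/
lemma dvd_of_dvd_C_mul {P : PowerSeries (ValRing L)} {N : ℕ} {rₙ : ℝ}
    (hP : IsOuterRadius (toField P) N rₙ) {a : ValRing L} (ha : a ≠ 0)
    {b : PowerSeries (ValRing L)} (h : P ∣ PowerSeries.C a * b) : P ∣ b := by
  obtain ⟨w, hw⟩ := h
  have hle : ∀ k, ‖((PowerSeries.coeff k w : ValRing L) : L)‖ ≤ ‖(a : L)‖ := by
    intro k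
    by_cases hw0 : w = 0
    · simp [hw0]
    refine le_of_forall_mul_pow_le hP.lt_one k fun r hr hr1 => ?_
    have hr0 : 0 < r := hP.pos.trans hr
    have hwf : toField w ≠ 0 := fun h => hw0 (toField_injective (by simpa using h))
    obtain ⟨j, hj⟩ := exists_isFirst (norm_coeff_toField_le w) hwf hr0 hr1
    have h1 := (IsFirst.mul hr0 (hP.isFirst hr hr1) hj).2
    rw [← map_mul, ← hw, hP.wt_eq] at h1
    have h2 : wt (toField (PowerSeries.C a * b)) r (N + j) ≤ ‖(a : L)‖ * r ^ (N + j) := by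
      rw [wt, coeff_toField, PowerSeries.coeff_C_mul]
      gcongr
      push_cast
      rw [norm_mul]
      exact mul_le_of_le_one_right (norm_nonneg _) (norm_coe_le_one _)
    have h3 : wt (toField w) r j ≤ ‖(a : L)‖ * r ^ j := by
      rw [h1, pow_add] at h2
      refine le_of_mul_le_mul_left ?_ (pow_pos hr0 N)
      linarith
    have h4 := hj.le k
    rw [wt, coeff_toField] at h4
    calc _ ≤ _ := h4
      _ ≤ _ := h3
      _ ≤ ‖(a : L)‖ * 1 := by gcongr; exact pow_le_one₀ hr0.le hr1.le
      _ = _ := mul_one _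
  choose z hz using fun k => dvd_of_norm_le ha (hle k)
  have hwz : w = PowerSeries.C a * PowerSeries.mk z := by
    ext k
    rw [PowerSeries.coeff_C_mul, PowerSeries.coeff_mk, ← hz]
  refine ⟨PowerSeries.mk z, mul_left_cancel₀ (a := PowerSeries.C a) ?_ ?_⟩
  · intro h
    exact ha (by simpa using congrArg (PowerSeries.constantCoeff) h)
  · rw [hw, hwz]; ring

variable {O : Type*} [CommRing O] [Algebra O (ValRing L)]

/-- A homomorphism of formal modules killing the kernel of `[ϖ]` factors through `[ϖ]`. -/
lemma FormalModule.IsHom.exists_factor {G G' : FormalModule O (ValRing L)}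
    {f : PowerSeries (ValRing L)} (hf : G.IsHom G' f) {ϖ : O} {N : ℕ} {rₙ : ℝ}
    (hP : IsOuterRadius (toField (G.act ϖ)) N rₙ)
    (hϖ : algebraMap O (ValRing L) ϖ ≠ 0) (hdvd : G.act ϖ ∣ f) :
    ∃ g, G.IsHom G' g ∧ f = g.subst (G.act ϖ) := by
  set P := G.act ϖ with hPdef
  have hP0 : PowerSeries.constantCoeff P = 0 := G.act_constantCoeff ϖ
  have hP1 : PowerSeries.coeff 1 P = algebraMap O (ValRing L) ϖ := G.act_coeff_one ϖ
  have hP1' : PowerSeries.coeff 1 P ≠ 0 := hP1 ▸ hϖ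
  have hPne : P ≠ 0 := fun h => hP1' (by simp [h])
  have hsP := PowerSeries.HasSubst.of_constantCoeff_zero' hP0
  have hfib : FibreConst P f := by
    have hx : MvPowerSeries.constantCoeff (xVar (ValRing L)) = 0 := by simp
    have hy : MvPowerSeries.constantCoeff (yVar (ValRing L)) = 0 := by simp
    have hc {φ : PowerSeries (ValRing L)} (hφ : PowerSeries.constantCoeff φ = 0)
        {u : MvPowerSeries (Option Unit) (ValRing L)} (hu : MvPowerSeries.constantCoeff u = 0) :
        MvPowerSeries.constantCoeff (φ.subst u) = 0 :=
      PowerSeries.constantCoeff_subst_eq_zero hu _ hφ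
    have hny := hc (G.act_constantCoeff (-1)) hy
    set D := G.add (xVar (ValRing L)) ((G.act (-1)).subst (yVar (ValRing L))) with hD
    have hD0 : MvPowerSeries.constantCoeff D = 0 := G.constantCoeff_add hx hny
    have hsD := PowerSeries.HasSubst.of_constantCoeff_zero hD0
    have hDy : G.add D (yVar (ValRing L)) = xVar (ValRing L) := by
      rw [hD, G.add_assoc hx hny hy, G.neg_add hy, G.add_zero hx]
    -- `f(D)` divides `f(X) - f(Y)`, where `D` is the formal difference of `X` and `Y`
    have h1 : f.subst D ∣ f.subst (xVar (ValRing L)) - f.subst (yVar (ValRing L)) := by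
      conv_rhs => rw [← hDy]
      rw [hf.subst_add hD0 hy]
      exact G'.dvd_add_sub (hc hf.constantCoeff hD0) (hc hf.constantCoeff hy)
    have h2 : P.subst D ∣ f.subst D := by
      obtain ⟨w, hw⟩ := hdvd
      rw [hw, PowerSeries.subst_mul hsD]
      exact dvd_mul_right _ _
    have h3 : P.subst (xVar (ValRing L)) - P.subst (yVar (ValRing L)) ∣ P.subst D := by
      have hcomm : P.subst ((G.act (-1)).subst (yVar (ValRing L))) =
          (G.act (-1)).subst (P.subst (yVar (ValRing L))) := by
        have hsy := PowerSeries.HasSubst.of_constantCoeff_zero hy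
        rw [← PowerSeries.subst_comp_subst_apply
            (PowerSeries.HasSubst.of_constantCoeff_zero' (G.act_constantCoeff (-1))) hsy,
          ← PowerSeries.subst_comp_subst_apply hsP hsy, ← G.act_mul, ← G.act_mul, mul_comm]
      rw [hD, (G.act_isHom ϖ).subst_add hx hny, ← hPdef, hcomm]
      exact G.sub_dvd_add_neg (hc hP0 hx) (hc hP0 hy)
    exact h3.trans (h2.trans h1)
  obtain ⟨g, hg⟩ := hfib.exists_subst hP0 hPne fun b hb =>
    dvd_of_dvd_C_mul hP hP1' hb
  have hg0 : PowerSeries.constantCoeff g = 0 := by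
    obtain ⟨z, hz⟩ : PowerSeries.X ∣ g - PowerSeries.C (PowerSeries.constantCoeff g) :=
      PowerSeries.X_dvd_iff.2 (by simp)
    rw [sub_eq_iff_eq_add] at hz
    have h1 := hf.constantCoeff
    rw [hg, hz, PowerSeries.subst_add hsP, PowerSeries.subst_mul hsP, PowerSeries.subst_X hsP,
      PowerSeries.subst_C, _root_.map_add, map_mul, hP0, zero_mul, _root_.zero_add] at h1
    exact h1
  refine ⟨g, ⟨hg0, ?_, fun a => ?_⟩, hg⟩
  · have hpp := hasSubst_pair (constantCoeff_subst_X hP0 (0 : Fin 2)) (constantCoeff_subst_X hP0 1)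
    have hG := PowerSeries.HasSubst.of_constantCoeff_zero G.zero_constantCoeff
    have hfX (i : Fin 2) :
        g.subst (P.subst (MvPowerSeries.X i : MvPowerSeries (Fin 2) (ValRing L))) =
        f.subst (MvPowerSeries.X i : MvPowerSeries (Fin 2) (ValRing L)) := by
      rw [hg, PowerSeries.subst_comp_subst_apply hsP (PowerSeries.HasSubst.X i)]
    refine subst_pair_injective (φ := (ValRing L).subtype) Subtype.val_injective hP0 hP1' ?_
    have hgX (i : Fin 2) : MvPowerSeries.subst
        ![P.subst (MvPowerSeries.X 0 : MvPowerSeries (Fin 2) (ValRing L)),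
          P.subst (MvPowerSeries.X 1 : MvPowerSeries (Fin 2) (ValRing L))]
        (g.subst (MvPowerSeries.X i : MvPowerSeries (Fin 2) (ValRing L))) =
        f.subst (MvPowerSeries.X i : MvPowerSeries (Fin 2) (ValRing L)) := by
      rw [← hfX, mvSubst_psSubst (by simp) hpp, MvPowerSeries.subst_X hpp]
      fin_cases i <;> rfl
    have hl : MvPowerSeries.subst
        ![P.subst (MvPowerSeries.X 0 : MvPowerSeries (Fin 2) (ValRing L)),
          P.subst (MvPowerSeries.X 1 : MvPowerSeries (Fin 2) (ValRing L))]
        (g.subst G.toPowerSeries) =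
        f.subst G.toPowerSeries := by
      have h1 : MvPowerSeries.subst
          ![P.subst (MvPowerSeries.X 0 : MvPowerSeries (Fin 2) (ValRing L)),
            P.subst (MvPowerSeries.X 1 : MvPowerSeries (Fin 2) (ValRing L))] G.toPowerSeries =
          P.subst G.toPowerSeries := (G.act_hom ϖ).symm
      rw [hg, PowerSeries.subst_comp_subst_apply hsP hG, ← h1,
        mvSubst_psSubst G.zero_constantCoeff hpp]
    rw [hl, hf.map_add]
    have h2 := G'.subst_add_mv (constantCoeff_subst_X hg0 (0 : Fin 2))
      (constantCoeff_subst_X hg0 1) hpp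
    rw [hgX, hgX] at h2
    exact h2.symm
  · have hsa := PowerSeries.HasSubst.of_constantCoeff_zero' (G.act_constantCoeff a)
    have hsg := PowerSeries.HasSubst.of_constantCoeff_zero' hg0
    refine subst_left_injective hP0 hPne ?_
    rw [PowerSeries.subst_comp_subst_apply hsa hsP, PowerSeries.subst_comp_subst_apply hsg hsP,
      ← hg, ← hf.map_act a, hg, PowerSeries.subst_comp_subst_apply hsP hsa, hPdef, ← G.act_mul,
      ← G.act_mul, mul_comm]

end Quotient

/-! ### Lowest terms of homomorphisms -/

section LowestTerm

variable {R : Type*} [CommRing R]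

/-- The lowest term of `A ∘ B` when `A` starts in degree `d`. -/
lemma coeff_subst_of_X_pow_dvd {A B : PowerSeries R} {d : ℕ} (hA : PowerSeries.X ^ d ∣ A)
    (hB : PowerSeries.constantCoeff B = 0) :
    PowerSeries.coeff d (A.subst B) = PowerSeries.coeff d A * PowerSeries.coeff 1 B ^ d := by
  obtain ⟨w, rfl⟩ := hA
  obtain ⟨b, rfl⟩ := PowerSeries.X_dvd_iff.2 hB
  have hs := PowerSeries.HasSubst.of_constantCoeff_zero' hB
  have hw : PowerSeries.constantCoeff (w.subst (PowerSeries.X * b)) =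
      PowerSeries.constantCoeff w := by
    obtain ⟨z, hz⟩ : PowerSeries.X ∣ w - PowerSeries.C (PowerSeries.constantCoeff w) :=
      PowerSeries.X_dvd_iff.2 (by simp)
    rw [sub_eq_iff_eq_add] at hz
    generalize PowerSeries.constantCoeff w = c at hz
    rw [hz, PowerSeries.subst_add hs, PowerSeries.subst_mul hs, PowerSeries.subst_X hs,
      PowerSeries.subst_C, map_add, map_mul, hB, zero_mul, zero_add]
    exact MvPowerSeries.constantCoeff_C c
  rw [PowerSeries.subst_mul hs, PowerSeries.subst_pow hs, PowerSeries.subst_X hs, mul_pow,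
    mul_assoc, PowerSeries.coeff_X_pow_mul', if_pos le_rfl, PowerSeries.coeff_X_pow_mul',
    if_pos le_rfl, Nat.sub_self]
  rw [PowerSeries.coeff_zero_eq_constantCoeff_apply, PowerSeries.coeff_zero_eq_constantCoeff_apply,
    map_mul, map_pow, hw, mul_comm, PowerSeries.coeff_succ_X_mul 0 b,
    PowerSeries.coeff_zero_eq_constantCoeff_apply]

/-- The lowest term of `A ∘ B` when `B` starts in degree `d`. -/
lemma coeff_subst_of_X_pow_dvd' {A B : PowerSeries R} {d : ℕ} (hd : 1 ≤ d)
    (hA : PowerSeries.constantCoeff A = 0) (hB : PowerSeries.X ^ d ∣ B) :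
    PowerSeries.coeff d (A.subst B) = PowerSeries.coeff 1 A * PowerSeries.coeff d B := by
  have hB0 : PowerSeries.constantCoeff B = 0 :=
    PowerSeries.X_dvd_iff.1 ((dvd_pow_self _ (by omega)).trans hB)
  have hs := PowerSeries.HasSubst.of_constantCoeff_zero' hB0
  obtain ⟨a, rfl⟩ := PowerSeries.X_dvd_iff.2 hA
  obtain ⟨w, rfl⟩ := hB
  have ha : PowerSeries.constantCoeff (a.subst (PowerSeries.X ^ d * w)) =
      PowerSeries.constantCoeff a := by
    have := coeff_subst_of_X_pow_dvd (A := a) (d := 0) (by simp) hB0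
    simpa using this
  rw [PowerSeries.subst_mul hs, PowerSeries.subst_X hs, mul_assoc,
    PowerSeries.coeff_X_pow_mul', if_pos le_rfl, PowerSeries.coeff_X_pow_mul', if_pos le_rfl,
    Nat.sub_self]
  rw [PowerSeries.coeff_zero_eq_constantCoeff_apply, PowerSeries.coeff_zero_eq_constantCoeff_apply,
    map_mul, ha, mul_comm, PowerSeries.coeff_succ_X_mul 0 a,
    PowerSeries.coeff_zero_eq_constantCoeff_apply]

end LowestTerm

namespace FormalModule

variable {O : Type*} {R : Type*} [CommRing O] [CommRing R] [Algebra O R]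

/-- `G(a, b) = b + a K`, where `K` has constant term `1`. -/
lemma exists_add_eq (G : FormalModule O R) {σ : Type*} {a b : MvPowerSeries σ R}
    (ha : MvPowerSeries.constantCoeff a = 0) (hb : MvPowerSeries.constantCoeff b = 0) :
    ∃ K, MvPowerSeries.constantCoeff K = 1 ∧ G.add a b = b + a * K := by
  have hs := hasSubst_pair ha hb
  have h0 : MvPowerSeries.HasSubst ![(0 : MvPowerSeries (Fin 2) R), MvPowerSeries.X 1] :=
    hasSubst_pair (by simp) (by simp)
  obtain ⟨K, hK⟩ : MvPowerSeries.X 0 ∣ G.toPowerSeries - MvPowerSeries.X 1 := by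
    apply X_dvd_of_subst_zero
    rw [MvPowerSeries.subst_sub h0, MvPowerSeries.subst_X h0]
    have := G.zero_add (a := (MvPowerSeries.X 1 : MvPowerSeries (Fin 2) R)) (by simp)
    rw [add] at this
    rw [this]
    simp
  have hK1 : MvPowerSeries.constantCoeff K = 1 := by
    have h1 := congrArg (MvPowerSeries.coeff (Finsupp.single (0 : Fin 2) 1)) hK
    rw [map_sub, G.lin_coeff_X, MvPowerSeries.coeff_X, if_neg (by
      intro h; simpa using DFunLike.congr_fun h 0), sub_zero] at h1
    have h2 := MvPowerSeries.coeff_add_monomial_mul (Finsupp.single (0 : Fin 2) 1) 0 K (1 : R)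
    rw [_root_.add_zero, one_mul, ← MvPowerSeries.X_def, ← h1] at h2
    exact h2.symm
  refine ⟨K.subst ![a, b], ?_, ?_⟩
  · have h1 : MvPowerSeries.constantCoeff ((K - MvPowerSeries.C 1).subst ![a, b]) = 0 :=
      MvPowerSeries.constantCoeff_subst_eq_zero hs
        (by intro i; fin_cases i <;> simp [ha, hb]) (by simp [hK1])
    rw [MvPowerSeries.subst_sub hs, map_sub, sub_eq_zero] at h1
    rw [h1, ← MvPowerSeries.coe_substAlgHom hs, map_one, map_one, map_one]
  · have h1 := congrArg (MvPowerSeries.subst ![a, b]) hK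
    rw [MvPowerSeries.subst_sub hs, MvPowerSeries.subst_mul hs, MvPowerSeries.subst_X hs,
      MvPowerSeries.subst_X hs] at h1
    rw [← sub_eq_iff_eq_add']
    exact h1

lemma coeff_add_of_X_pow_dvd (G : FormalModule O R) {a b : PowerSeries R} {d : ℕ} (hd : 1 ≤ d)
    (ha : PowerSeries.X ^ d ∣ a) (hb : PowerSeries.constantCoeff b = 0) :
    PowerSeries.coeff d (G.add a b : PowerSeries R) =
      PowerSeries.coeff d a + PowerSeries.coeff d b := by
  have ha0 : PowerSeries.constantCoeff a = 0 :=
    PowerSeries.X_dvd_iff.1 ((dvd_pow_self _ (by omega)).trans ha)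
  obtain ⟨K, hK1, hK⟩ := G.exists_add_eq ha0 hb
  obtain ⟨w, rfl⟩ := ha
  replace hK1 : PowerSeries.constantCoeff (K : PowerSeries R) = 1 := hK1
  have hK' : (G.add (PowerSeries.X ^ d * w) b : PowerSeries R) =
    b + PowerSeries.X ^ d * (w * (K : PowerSeries R)) := by rw [← mul_assoc]; exact hK
  rw [hK', _root_.map_add, PowerSeries.coeff_X_pow_mul', if_pos le_rfl,
    PowerSeries.coeff_X_pow_mul', if_pos le_rfl, Nat.sub_self]
  simp [hK1, add_comm]

variable {G G' : FormalModule O R} {f : PowerSeries R} {d : ℕ}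

/-- Comparison of the terms of degree `d` in `f(G(T, c T)) = G'(f(T), f(c T))`. -/
lemma IsHom.coeff_mul_add_pow (hf : IsHom G G' f) (hd : 1 ≤ d) (hdvd : PowerSeries.X ^ d ∣ f)
    (c : R) : PowerSeries.coeff d f * (1 + c) ^ d = PowerSeries.coeff d f * (1 + c ^ d) := by
  have h0 : PowerSeries.constantCoeff (PowerSeries.C c * PowerSeries.X : PowerSeries R) = 0 := by
    simp
  have hX0 : PowerSeries.constantCoeff (PowerSeries.X : PowerSeries R) = 0 := by simp
  have h := congrArg (PowerSeries.coeff d)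
    (hf.subst_add (a := (PowerSeries.X : PowerSeries R)) hX0 h0)
  have e1 := coeff_subst_of_X_pow_dvd hdvd (B := G.add (PowerSeries.X : PowerSeries R)
    (PowerSeries.C c * PowerSeries.X)) (G.constantCoeff_add hX0 h0)
  have e2 := G.coeff_add_of_X_pow_dvd (a := PowerSeries.X) (b := PowerSeries.C c * PowerSeries.X)
    le_rfl (by rw [pow_one]) h0
  have e3 := coeff_subst_of_X_pow_dvd hdvd h0
  have e4 := G'.coeff_add_of_X_pow_dvd (b := f.subst (PowerSeries.C c * PowerSeries.X)) hd hdvd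
    (PowerSeries.constantCoeff_subst_eq_zero h0 _ hf.constantCoeff)
  have hX : f.subst (PowerSeries.X : PowerSeries R) = f := PowerSeries.X_subst _
  rw [hX] at h
  rw [e2] at e1
  rw [e3] at e4
  have h' := (e1.symm.trans h).trans e4
  simpa [mul_add] using h'

/-- Comparison of the terms of degree `d` in `f([x](T)) = [x](f(T))`. -/
lemma IsHom.coeff_mul_pow (hf : IsHom G G' f) (hd : 1 ≤ d) (hdvd : PowerSeries.X ^ d ∣ f) (x : O) :
    PowerSeries.coeff d f * algebraMap O R x ^ d = PowerSeries.coeff d f * algebraMap O R x := by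
  have h := congrArg (PowerSeries.coeff d) (hf.map_act x)
  rw [coeff_subst_of_X_pow_dvd hdvd (G.act_constantCoeff x),
    coeff_subst_of_X_pow_dvd' hd (G'.act_constantCoeff x) hdvd, G.act_coeff_one,
    G'.act_coeff_one] at h
  rw [h, mul_comm]

lemma IsHom.coeff_mul_choose (hf : IsHom G G' f) (hdvd : PowerSeries.X ^ d ∣ f) {i : ℕ}
    (hi : 0 < i) (hid : i < d) : PowerSeries.coeff d f * (d.choose i : R) = 0 := by
  -- the preceding identity over the polynomial ring, with the variable as `c`
  have hF := IsHom.map (IsScalarTower.toAlgHom O R (Polynomial R)) hf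
  have hdvd' := map_dvd (PowerSeries.map (Polynomial.C (R := R))) hdvd
  rw [map_pow, PowerSeries.map_X] at hdvd'
  have h := hF.coeff_mul_add_pow (d := d) (by omega) hdvd' Polynomial.X
  have hc : PowerSeries.coeff d (f.map ((IsScalarTower.toAlgHom O R (Polynomial R) :
      R →ₐ[O] Polynomial R) : R →+* Polynomial R)) = Polynomial.C (PowerSeries.coeff d f) := by
    rw [PowerSeries.coeff_map]; rfl
  rw [hc] at h
  have h1 := congrArg (Polynomial.coeff · i) h
  simp only [Polynomial.coeff_C_mul, Polynomial.coeff_one_add_X_pow, Polynomial.coeff_add,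
    Polynomial.coeff_one, Polynomial.coeff_X_pow, if_neg hid.ne, if_neg hi.ne', mul_zero,
    _root_.add_zero] at h1
  exact h1

end FormalModule

/-- If `d` is not a power of the prime `p`, one of the binomial coefficients `d.choose i` with
`0 < i < d` is prime to `p`. -/
lemma exists_choose_not_dvd {p d : ℕ} [hp : Fact p.Prime] (hd : 0 < d) (h : ∀ j, d ≠ p ^ j) :
    ∃ i, 0 < i ∧ i < d ∧ ¬ p ∣ d.choose i := by
  obtain ⟨s, m, hm, rfl⟩ := Nat.exists_eq_pow_mul_and_not_dvd hd.ne' p hp.out.ne_one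
  have hp0 : 0 < p ^ s := pow_pos hp.out.pos s
  have hm1 : 1 < m := by
    rcases m with _ | _ | m
    · simp at hm
    · exact absurd (mul_one _) (h s)
    · omega
  refine ⟨p ^ s, hp0, by nlinarith, fun hdvd => hm ?_⟩
  have h1 := Choose.choose_pow_mul_pow_mul_modEq_choose_nat (a := m) (b := 1) (p := p) (k := s)
  rw [mul_one, Nat.choose_one_right] at h1
  exact (Nat.ModEq.dvd_iff h1 dvd_rfl).1 hdvd

/-- If the `p ^ j`-th power is the identity on a field with `q` elements, `p ^ j` is a power
of `q`. -/
lemma exists_eq_card_pow_of_pow_eq {k : Type*} [Field k] [Finite k] {p j : ℕ} [CharP k p]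
    [hp : Fact p.Prime] (h : ∀ z : k, z ^ p ^ j = z) : ∃ i, p ^ j = Nat.card k ^ i := by
  have := Fintype.ofFinite k
  obtain ⟨f, -, hf⟩ := FiniteField.card k p
  have hf0 : 0 < (f : ℕ) := f.pos
  have hr : ∀ z : k, z ^ p ^ (j % f) = z := by
    intro z
    have h1 : z ^ p ^ j = z ^ p ^ (j % f) := by
      conv_lhs => rw [← Nat.div_add_mod j f, pow_add, pow_mul p, pow_mul z, ← hf,
        FiniteField.pow_card_pow]
    rw [← h1, h]
  have hlt : p ^ (j % f) < Fintype.card k := by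
    rw [hf]; exact Nat.pow_lt_pow_right hp.out.one_lt (Nat.mod_lt _ hf0)
  have h0 : j % f = 0 := by
    by_contra hne
    have hp1 : 1 < p ^ (j % f) := Nat.one_lt_pow hne hp.out.one_lt
    have hcard := Polynomial.card_roots' (Polynomial.X ^ p ^ (j % f) - Polynomial.X :
      Polynomial k)
    rw [FiniteField.X_pow_card_sub_X_natDegree_eq k hp1] at hcard
    have hne' := FiniteField.X_pow_card_sub_X_ne_zero k hp1
    classical
    have : (Finset.univ : Finset k).val ≤ (Polynomial.X ^ p ^ (j % f) - Polynomial.X :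
        Polynomial k).roots := by
      rw [Finset.val_le_iff_val_subset]
      intro z _
      rw [Polynomial.mem_roots hne']
      simp [hr z]
    have := Multiset.card_le_card this
    simp at this
    omega
  refine ⟨j / f, ?_⟩
  rw [Nat.card_eq_fintype_card, hf, ← pow_mul]
  congr 1
  conv_lhs => rw [← Nat.div_add_mod j f, h0, _root_.add_zero]

/-- The lowest term of a homomorphism of formal modules has degree a power of `q`. If its
coefficient `c` sits in degree `d`, additivity gives `c * d.choose i = 0` for `0 < i < d`, and linearity
gives `c * (z ^ d - z) = 0` for `z` in `O`; one of these factors of `c` is a unit unless `d` is a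
power of `q`. -/
lemma FormalModule.IsHom.coeff_eq_zero {O R : Type*} [CommRing O] [IsLocalRing O]
    [Finite (ResidueField O)] [CommRing R] [Algebra O R] {G G' : FormalModule O R}
    {f : PowerSeries R} {d : ℕ} (hf : IsHom G G' f) (hd : 1 ≤ d) (hdvd : PowerSeries.X ^ d ∣ f)
    (hq : ∀ i, d ≠ Nat.card (ResidueField O) ^ i) : PowerSeries.coeff d f = 0 := by
  have := Fintype.ofFinite (ResidueField O)
  obtain ⟨p, hchar⟩ := CharP.exists (ResidueField O)
  have hp : Fact p.Prime := ⟨(CharP.char_is_prime (ResidueField O) p)⟩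
  have key : ∀ x : O, residue O x ≠ 0 → PowerSeries.coeff d f * algebraMap O R x = 0 →
      PowerSeries.coeff d f = 0 := by
    intro x hx h
    have hu : IsUnit x := by
      rw [Ne, residue_eq_zero_iff, mem_maximalIdeal, mem_nonunits_iff, not_not] at hx
      exact hx
    exact (hu.map (algebraMap O R)).mul_left_eq_zero.1 h
  by_cases hdp : ∃ j, d = p ^ j
  · obtain ⟨j, rfl⟩ := hdp
    obtain ⟨z, hz⟩ : ∃ z : ResidueField O, z ^ p ^ j ≠ z := by
      by_contra! hz
      obtain ⟨i, hi⟩ := exists_eq_card_pow_of_pow_eq hz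
      exact hq i hi
    obtain ⟨x, rfl⟩ := residue_surjective z
    refine key (x ^ p ^ j - x) ?_ ?_
    · rw [map_sub, map_pow]; exact sub_ne_zero.2 hz
    · rw [map_sub, map_pow, mul_sub, hf.coeff_mul_pow hd hdvd, sub_self]
  · push Not at hdp
    obtain ⟨i, hi, hid, hndvd⟩ := exists_choose_not_dvd hd hdp
    refine key (d.choose i) ?_ ?_
    · rw [map_natCast, Ne, CharP.cast_eq_zero_iff (ResidueField O) p]; exact hndvd
    · rw [map_natCast]; exact hf.coeff_mul_choose hdvd hi hid

/-- The vertices of the Newton polygon of a homomorphism lie over powers of `q`: any other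
coefficient is dominated by an earlier one. -/
lemma exists_lt_norm_coeff_le {O L : Type*} [CommRing O] [IsLocalRing O]
    [Finite (ResidueField O)] [NormedField L] [IsUltrametricDist L] [Algebra O (ValRing L)]
    {G G' : FormalModule O (ValRing L)} {f : PowerSeries (ValRing L)} (hf : G.IsHom G' f) {d : ℕ}
    (hd : 1 ≤ d) (hq : ∀ i, d ≠ Nat.card (ResidueField O) ^ i) :
    ∃ j < d, ‖((PowerSeries.coeff d f : ValRing L) : L)‖ ≤
      ‖((PowerSeries.coeff j f : ValRing L) : L)‖ := by
  obtain ⟨j, hj, hmax⟩ := (Finset.range d).exists_max_image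
    (fun j => ‖((PowerSeries.coeff j f : ValRing L) : L)‖) ⟨0, Finset.mem_range.2 hd⟩
  rw [Finset.mem_range] at hj
  refine ⟨j, hj, ?_⟩
  set J := Ideal.span {PowerSeries.coeff j f}
  have hmem : ∀ a : ValRing L, ‖(a : L)‖ ≤ ‖((PowerSeries.coeff j f : ValRing L) : L)‖ → a ∈ J := by
    intro a ha
    rw [Ideal.mem_span_singleton]
    by_cases h0 : PowerSeries.coeff j f = 0
    · rw [h0] at ha ⊢
      simpa using ha
    · exact dvd_of_norm_le h0 ha
  have hF := FormalModule.IsHom.map (Ideal.Quotient.mkₐ O J) hf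
  have h0 := hF.coeff_eq_zero hd (PowerSeries.X_pow_dvd_iff.2 fun m hm => by
    rw [PowerSeries.coeff_map]
    exact Ideal.Quotient.eq_zero_iff_mem.2 (hmem _ (hmax m (Finset.mem_range.2 hm)))) hq
  rw [PowerSeries.coeff_map] at h0
  exact norm_le_of_dvd (Ideal.mem_span_singleton.1 (Ideal.Quotient.eq_zero_iff_mem.1 h0))

/-! ### Reduction and Newton polygons -/

section Reduction

variable {O : Type u} [CommRing O] [IsLocalRing O]

/-- Deformations are stable under base change along local homomorphisms. -/
lemma IsDeformation.map {G₀ : FormalModule O (ResidueField O)} {R S : Type*} [CommRing R]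
    [IsLocalRing R] [Algebra O R] [IsLocalHom (algebraMap O R)] [CommRing S] [IsLocalRing S]
    [Algebra O S] [IsLocalHom (algebraMap O S)] {G : FormalModule O R} (hG : IsDeformation G₀ G)
    (φ : R →ₐ[O] S) (hφ : IsLocalHom φ) : IsDeformation G₀ (G.map φ) := by
  have hφ' : IsLocalHom (φ : R →+* S) := ⟨hφ.map_nonunit⟩
  let ψ : ResidueField R →ₐ[O] ResidueField S :=
    { toRingHom := ResidueField.map (φ : R →+* S)
      commutes' := fun a => by
        change ResidueField.map (φ : R →+* S) (residue R (algebraMap O R a)) =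
          residue S (algebraMap O S a)
        rw [ResidueField.map_residue]
        congr 1
        exact φ.commutes a }
  have h1 : (reduction O S).comp φ = ψ.comp (reduction O R) := by
    ext a
    exact (ResidueField.map_residue (φ : R →+* S) a).symm
  have h2 : residueMap O S = ψ.comp (residueMap O R) := by
    ext a
    obtain ⟨a, rfl⟩ := residue_surjective a
    change ResidueField.map (algebraMap O S) (residue O a) =
      ResidueField.map (φ : R →+* S) (ResidueField.map (algebraMap O R) (residue O a))
    rw [ResidueField.map_residue, ResidueField.map_residue, ResidueField.map_residue]
    congr 1
    exact (φ.commutes a).symm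
  rw [IsDeformation, FormalModule.map_comp, h1, h2, ← FormalModule.map_comp,
    ← FormalModule.map_comp, hG]

lemma residueMap_injective (R : Type*) [CommRing R] [IsLocalRing R] [Algebra O R]
    [IsLocalHom (algebraMap O R)] : Function.Injective (residueMap O R) :=
  (residueMap O R : ResidueField O →+* ResidueField R).injective

lemma IsDeformation.residue_coeff_act {G₀ : FormalModule O (ResidueField O)} {R : Type*}
    [CommRing R] [IsLocalRing R] [Algebra O R] [IsLocalHom (algebraMap O R)]
    {G : FormalModule O R} (hG : IsDeformation G₀ G) (a : O) (k : ℕ) :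
    residue R (PowerSeries.coeff k (G.act a)) =
      residueMap O R (PowerSeries.coeff k (G₀.act a)) := by
  have h := congrArg (fun H : FormalModule O (ResidueField R) => PowerSeries.coeff k (H.act a)) hG
  exact h

end Reduction

section Residue

variable {F : Type u} {L : Type v} [NormedField F] [IsUltrametricDist F]
  [NormedField L] [IsUltrametricDist L] [NormedAlgebra F L]

lemma norm_lt_one_iff_residue_eq_zero {a : ValRing L} :
    ‖(a : L)‖ < 1 ↔ residue (ValRing L) a = 0 := by
  rw [residue_eq_zero_iff, mem_maximalIdeal_valRing_iff]

lemma norm_eq_one_iff_residue_ne_zero {a : ValRing L} :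
    ‖(a : L)‖ = 1 ↔ residue (ValRing L) a ≠ 0 := by
  rw [Ne, ← norm_lt_one_iff_residue_eq_zero, not_lt]
  exact ⟨fun h => h.ge, fun h => le_antisymm (norm_coe_le_one a) h⟩

variable {ϖ : ValRing F} {n : ℕ} {G₀ : FormalModule (ValRing F) (ResidueField (ValRing F))}

lemma norm_uniformizer_pos (hϖ : Irreducible ϖ) : 0 < ‖(ϖ : F)‖ :=
  norm_pos_iff.2 (by simpa using hϖ.ne_zero)

lemma norm_uniformizer_lt_one (hϖ : Irreducible ϖ) : ‖(ϖ : F)‖ < 1 :=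
  mem_maximalIdeal_valRing_iff.1 hϖ.not_isUnit

lemma HasHeight.two_le_card (hG₀ : HasHeight ϖ G₀ n) (hn : 1 ≤ n) :
    2 ≤ Nat.card (ResidueField (ValRing F)) := by
  have h0 : Nat.card (ResidueField (ValRing F)) ≠ 0 := by
    intro h0
    rw [HasHeight, h0, zero_pow (by omega)] at hG₀
    have h1 : ((0 : ℕ) : ℕ∞) < (G₀.act ϖ).order := by
      refine lt_of_lt_of_le (by simp) (PowerSeries.le_order (G₀.act ϖ) 1 fun i hi => ?_)
      have : i = 0 := by simpa using hi
      rw [this, PowerSeries.coeff_zero_eq_constantCoeff_apply, G₀.act_constantCoeff]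
    exact h1.ne' hG₀
  have h1 : Nat.card (ResidueField (ValRing F)) ≠ 1 := by
    intro h1
    have := (Nat.card_eq_one_iff_unique.1 h1).1
    exact not_subsingleton _ this
  omega

lemma HasHeight.finite (hG₀ : HasHeight ϖ G₀ n) (hn : 1 ≤ n) :
    Finite (ResidueField (ValRing F)) :=
  Nat.finite_of_card_ne_zero (by have := hG₀.two_le_card hn; omega)

lemma HasHeight.norm_coeff (hG₀ : HasHeight ϖ G₀ n) {G : FormalModule (ValRing F) (ValRing L)}
    (hG : IsDeformation G₀ G) :
    ‖((PowerSeries.coeff (Nat.card (ResidueField (ValRing F)) ^ n) (G.act ϖ) :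
      ValRing L) : L)‖ = 1 ∧
    ∀ k < Nat.card (ResidueField (ValRing F)) ^ n,
      ‖((PowerSeries.coeff k (G.act ϖ) : ValRing L) : L)‖ < 1 := by
  obtain ⟨h1, h2⟩ := PowerSeries.order_eq_nat.1 hG₀
  refine ⟨?_, fun k hk => ?_⟩
  · rw [norm_eq_one_iff_residue_ne_zero, hG.residue_coeff_act]
    exact (map_ne_zero_iff _ (residueMap_injective (ValRing L))).2 h1
  · rw [norm_lt_one_iff_residue_eq_zero, hG.residue_coeff_act, h2 k hk, map_zero]

lemma coeff_one_act_ne_zero (hϖ : Irreducible ϖ) (G : FormalModule (ValRing F) (ValRing L)) :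
    PowerSeries.coeff 1 (G.act ϖ) ≠ 0 := by
  rw [G.act_coeff_one]
  intro h
  have := congrArg (fun a : ValRing L => ‖(a : L)‖) h
  simp only [coe_algebraMap_ValRing, norm_algebraMap', ZeroMemClass.coe_zero, norm_zero] at this
  exact (norm_uniformizer_pos hϖ).ne' this

lemma norm_coeff_one_act (G : FormalModule (ValRing F) (ValRing L)) :
    ‖((PowerSeries.coeff 1 (G.act ϖ) : ValRing L) : L)‖ = ‖(ϖ : F)‖ := by
  rw [G.act_coeff_one, coe_algebraMap_ValRing, norm_algebraMap']

end Residue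

section Newton

variable {F : Type u} {L : Type v} [NormedField F] [IsUltrametricDist F] [NormedField L]
  {ϖ : ValRing F}

lemma coe_le_val (h0 : 0 < ‖(ϖ : F)‖) (h1 : ‖(ϖ : F)‖ < 1) {y : L} {m : ℝ}
    (h : ‖y‖ ≤ ‖(ϖ : F)‖ ^ m) : (m : WithTop ℝ) ≤ val ϖ y := by
  rw [val]
  split_ifs with hy
  · exact le_top
  · rw [WithTop.coe_le_coe, Real.le_logb_iff_rpow_le_of_base_lt_one h0 h1 (norm_pos_iff.2 hy)]
    exact h

lemma le_of_coe_le_val (h0 : 0 < ‖(ϖ : F)‖) (h1 : ‖(ϖ : F)‖ < 1) {y : L} {m s : ℝ}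
    (h : (m : WithTop ℝ) ≤ val ϖ y) (hs : ‖y‖ = ‖(ϖ : F)‖ ^ s) : m ≤ s := by
  have hy : y ≠ 0 := norm_pos_iff.1 (hs ▸ Real.rpow_pos_of_pos h0 s)
  rw [val, if_neg hy, WithTop.coe_le_coe, hs, Real.logb_rpow h0 h1.ne] at h
  exact h

variable [IsUltrametricDist L]

/-- The Newton polygon lies below the segments joining two of its defining points. -/
lemma newtonPolygon_le (h0 : 0 < ‖(ϖ : F)‖) (h1 : ‖(ϖ : F)‖ < 1) (P : PowerSeries (ValRing L))
    {i j : ℕ} {s t α β : ℝ} (hα : 0 ≤ α) (hβ : 0 ≤ β) (hαβ : α + β = 1)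
    (hi : ‖((PowerSeries.coeff i P : ValRing L) : L)‖ = ‖(ϖ : F)‖ ^ s)
    (hj : ‖((PowerSeries.coeff j P : ValRing L) : L)‖ = ‖(ϖ : F)‖ ^ t) {z : ℝ}
    (hz : z = α * i + β * j) : newtonPolygon ϖ P z ≤ α * s + β * t := by
  refine csSup_le ⟨0, 0, 0, fun k => ?_, by simp⟩ ?_
  · refine coe_le_val h0 h1 ?_
    simpa using norm_coe_le_one (PowerSeries.coeff k P)
  · rintro y ⟨a, b, hab, rfl⟩
    have e1 := le_of_coe_le_val h0 h1 (hab i) hi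
    have e2 := le_of_coe_le_val h0 h1 (hab j) hj
    calc a + b * z = (α + β) * a + b * z := by rw [hαβ, one_mul]
      _ = α * (a + b * i) + β * (a + b * j) := by rw [hz]; ring
      _ ≤ _ := by gcongr

/-- The Newton polygon lies above each line that lies below its defining points. -/
lemma le_newtonPolygon (h0 : 0 < ‖(ϖ : F)‖) (h1 : ‖(ϖ : F)‖ < 1) (P : PowerSeries (ValRing L))
    {a b : ℝ} (hab : ∀ k : ℕ, ‖((PowerSeries.coeff k P : ValRing L) : L)‖ ≤
      ‖(ϖ : F)‖ ^ (a + b * k)) {i : ℕ} (hi : PowerSeries.coeff i P ≠ 0) :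
    a + b * i ≤ newtonPolygon ϖ P i := by
  have hpos : 0 < ‖((PowerSeries.coeff i P : ValRing L) : L)‖ := norm_pos_iff.2 (by simpa using hi)
  refine le_csSup ⟨Real.logb ‖(ϖ : F)‖ ‖((PowerSeries.coeff i P : ValRing L) : L)‖, ?_⟩
    ⟨a, b, fun k => coe_le_val h0 h1 (hab k), rfl⟩
  rintro y ⟨a', b', hab', rfl⟩
  exact le_of_coe_le_val h0 h1 (hab' i) (Real.rpow_logb h0 h1.ne hpos).symm

variable [NormedAlgebra F L] {n : ℕ} {G₀ : FormalModule (ValRing F) (ResidueField (ValRing F))}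
  {G : FormalModule (ValRing F) (ValRing L)}

/-- A coefficient larger than all the previous ones sits in degree a power of `q`. -/
lemma exists_eq_card_pow [Finite (ResidueField (ValRing F))] {d : ℕ} (hd : 1 ≤ d)
    (hlt : ∀ j < d, ‖((PowerSeries.coeff j (G.act ϖ) : ValRing L) : L)‖ <
      ‖((PowerSeries.coeff d (G.act ϖ) : ValRing L) : L)‖) :
    ∃ i, d = Nat.card (ResidueField (ValRing F)) ^ i := by
  by_contra! h
  obtain ⟨j, hj, hle⟩ := exists_lt_norm_coeff_le (G.act_isHom ϖ) hd h
  exact (hlt j hj).not_ge hle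

/-- The smallest slope is at most the valuation of `rₙ`: a term dominant at the radius `rₙ`, of
degree less than `q ^ n`, gives a point of the Newton polygon over a power of `q`. -/
lemma newtonSlope_le (hϖ : Irreducible ϖ) (hn : 1 ≤ n) (hG₀ : HasHeight ϖ G₀ n)
    (hG : IsDeformation G₀ G) {r : ℝ}
    (hr : IsOuterRadius (toField (G.act ϖ)) (Nat.card (ResidueField (ValRing F)) ^ n) r) :
    newtonSlope ϖ G n ≤ Real.logb ‖(ϖ : F)‖ r := by
  have h0 := norm_uniformizer_pos hϖ
  have h1 := norm_uniformizer_lt_one hϖ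
  have hq := hG₀.two_le_card hn
  have := hG₀.finite hn
  obtain ⟨hu, -⟩ := hG₀.norm_coeff hG
  obtain ⟨e, heN, he⟩ := hr.exists_eq
  set q := Nat.card (ResidueField (ValRing F)) with hqdef
  set μ := Real.logb ‖(ϖ : F)‖ r with hμ
  have hμr : ‖(ϖ : F)‖ ^ μ = r := Real.rpow_logb h0 h1.ne hr.pos
  have hpw : ∀ k : ℕ, r ^ k = ‖(ϖ : F)‖ ^ (μ * k) := fun k => by
    rw [Real.rpow_mul h0.le, hμr, Real.rpow_natCast]
  have hne : ‖((PowerSeries.coeff e (G.act ϖ) : ValRing L) : L)‖ = r ^ (q ^ n - e) := by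
    have h2 : r ^ (q ^ n) = r ^ (q ^ n - e) * r ^ e := by rw [← pow_add, Nat.sub_add_cancel heN.le]
    rw [wt, coeff_toField, h2] at he
    exact mul_right_cancel₀ (pow_ne_zero _ hr.pos.ne') he
  have he1 : 1 ≤ e := by
    by_contra h
    have : e = 0 := by omega
    rw [this, PowerSeries.coeff_zero_eq_constantCoeff_apply, G.act_constantCoeff] at hne
    simp only [ZeroMemClass.coe_zero, norm_zero] at hne
    exact (pow_pos hr.pos _).ne hne
  obtain ⟨i, hi⟩ := exists_eq_card_pow (G := G) (ϖ := ϖ) he1 fun j hj => by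
    have h2 := hr.norm_coeff_le (k := j) (by omega)
    rw [coeff_toField] at h2
    rw [hne]
    refine h2.trans_lt (pow_lt_pow_right_of_lt_one₀ hr.pos hr.lt_one ?_)
    omega
  have hin : i < n := by
    rw [hi] at heN
    exact (Nat.pow_lt_pow_iff_right (by omega)).1 heN
  have heq : e ≤ q ^ (n - 1) := hi ▸ Nat.pow_le_pow_right (by omega) (by omega)
  have hqn : q ^ (n - 1) < q ^ n := Nat.pow_lt_pow_right (by omega) (by omega)
  have heN' : (0 : ℝ) < (q : ℝ) ^ n - e := sub_pos.2 (by exact_mod_cast heN)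
  have heq' : (0 : ℝ) ≤ (q : ℝ) ^ (n - 1) - e := sub_nonneg.2 (by exact_mod_cast heq)
  have hqn' : (0 : ℝ) < (q : ℝ) ^ n - (q : ℝ) ^ (n - 1) := sub_pos.2 (by exact_mod_cast hqn)
  have hA := newtonPolygon_le h0 h1 (G.act ϖ) (i := e) (j := q ^ n) (s := μ * (q ^ n - e)) (t := 0)
    (α := ((q : ℝ) ^ n - (q : ℝ) ^ (n - 1)) / ((q : ℝ) ^ n - e))
    (β := ((q : ℝ) ^ (n - 1) - e) / ((q : ℝ) ^ n - e)) (by positivity) (by positivity)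
    (by field_simp; ring) (by
      rw [hne, hpw, Nat.cast_sub heN.le, Nat.cast_pow]) (by rw [hu, Real.rpow_zero])
    (z := (q : ℝ) ^ (n - 1)) (by push_cast; field_simp; ring)
  have hB := le_newtonPolygon h0 h1 (G.act ϖ) (a := 0) (b := 0)
    (fun k => by simpa using norm_coe_le_one _) (i := q ^ n) (fun h => by
      rw [h] at hu; simp at hu)
  have hA' : newtonPolygon ϖ (G.act ϖ) ((q : ℝ) ^ (n - 1)) ≤
      μ * ((q : ℝ) ^ n - (q : ℝ) ^ (n - 1)) := by
    refine hA.trans (le_of_eq ?_)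
    field_simp
    ring
  rw [newtonSlope, ← hqdef, div_le_iff₀ hqn']
  rw [zero_mul, add_zero, Nat.cast_pow] at hB
  linarith

/-- The largest slope is at least the valuation of the radius up to which the linear term of `[ϖ]`
is dominant, because a second dominant term at this radius has degree at least `q`. -/
lemma le_newtonSlope (hϖ : Irreducible ϖ) (hn : 1 ≤ n) (hG₀ : HasHeight ϖ G₀ n) {r : ℝ}
    (hr : IsInnerRadius (toField (G.act ϖ)) r)
    (hex : ∃ k, 1 < k ∧
      wt (toField (G.act ϖ)) r k = ‖PowerSeries.coeff 1 (toField (G.act ϖ))‖ * r) :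
    Real.logb ‖(ϖ : F)‖ r ≤ newtonSlope ϖ G 1 := by
  have h0 := norm_uniformizer_pos hϖ
  have h1 := norm_uniformizer_lt_one hϖ
  have hq := hG₀.two_le_card hn
  have := hG₀.finite hn
  obtain ⟨d, hd1, hd⟩ := hex
  set q := Nat.card (ResidueField (ValRing F)) with hqdef
  set μ := Real.logb ‖(ϖ : F)‖ r with hμ
  have hμr : ‖(ϖ : F)‖ ^ μ = r := Real.rpow_logb h0 h1.ne hr.pos
  have hpw : ∀ k : ℕ, r ^ k = ‖(ϖ : F)‖ ^ (μ * k) := fun k => by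
    rw [Real.rpow_mul h0.le, hμr, Real.rpow_natCast]
  have hone : ‖PowerSeries.coeff 1 (toField (G.act ϖ))‖ = ‖(ϖ : F)‖ := by
    rw [coeff_toField, norm_coeff_one_act]
  rw [hone] at hd
  have hle := hr.le
  rw [hone] at hle
  have hpow : ∀ k : ℕ, ‖(ϖ : F)‖ * r / r ^ k = ‖(ϖ : F)‖ ^ (1 - μ * (k - 1) : ℝ) := fun k => by
    rw [hpw, mul_div_assoc, ← hμr, Real.rpow_logb h0 h1.ne hr.pos]
    conv_lhs => rw [← hμr]
    rw [← Real.rpow_sub h0]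
    conv_lhs => enter [1]; rw [← Real.rpow_one ‖(ϖ : F)‖]
    rw [← Real.rpow_add h0]
    congr 1; ring
  have hcoef : ‖((PowerSeries.coeff d (G.act ϖ) : ValRing L) : L)‖ =
      ‖(ϖ : F)‖ ^ (1 - μ * (d - 1) : ℝ) := by
    rw [← hpow, eq_div_iff (pow_ne_zero _ hr.pos.ne'), ← hd, wt, coeff_toField]
  obtain ⟨i, hi⟩ := exists_eq_card_pow (G := G) (ϖ := ϖ) hd1.le fun j hj => by
    have h2 := hle j
    rw [← hd, wt, wt, coeff_toField, coeff_toField] at h2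
    have hdpos : 0 < ‖((PowerSeries.coeff d (G.act ϖ) : ValRing L) : L)‖ := by
      rw [hcoef]; exact Real.rpow_pos_of_pos h0 _
    refine lt_of_mul_lt_mul_right (h2.trans_lt ?_) (pow_pos hr.pos j).le
    exact mul_lt_mul_of_pos_left (pow_lt_pow_right_of_lt_one₀ hr.pos hr.lt_one hj) hdpos
  have hi0 : i ≠ 0 := by
    rintro rfl
    rw [pow_zero] at hi
    omega
  have hqd : q ≤ d := by rw [hi]; exact Nat.le_self_pow hi0 q
  have hd1' : (0 : ℝ) < (d : ℝ) - 1 := sub_pos.2 (by exact_mod_cast hd1)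
  have hqd' : (0 : ℝ) ≤ (d : ℝ) - q := sub_nonneg.2 (by exact_mod_cast hqd)
  have hq1 : (0 : ℝ) < (q : ℝ) - 1 := sub_pos.2 (by exact_mod_cast hq)
  have hA := newtonPolygon_le h0 h1 (G.act ϖ) (i := 1) (j := d) (s := 1) (t := 1 - μ * (d - 1))
    (α := ((d : ℝ) - q) / ((d : ℝ) - 1)) (β := ((q : ℝ) - 1) / ((d : ℝ) - 1))
    (by positivity) (by positivity) (by field_simp; ring)
    (by rw [norm_coeff_one_act, Real.rpow_one]) hcoef (z := (q : ℝ))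
    (by push_cast; field_simp; ring)
  have hB := le_newtonPolygon h0 h1 (G.act ϖ) (a := 1 + μ) (b := -μ) (fun k => by
    have h2 := hle k
    rw [wt, coeff_toField, ← le_div_iff₀ (pow_pos hr.pos k), hpow] at h2
    refine h2.trans (le_of_eq ?_)
    congr 1; ring) (coeff_one_act_ne_zero hϖ G)
  have hA' : newtonPolygon ϖ (G.act ϖ) q ≤ 1 - μ * (q - 1) := by
    refine hA.trans (le_of_eq ?_)
    field_simp
    ring
  rw [newtonSlope, ← hqdef, Nat.sub_self, pow_zero, pow_one, le_div_iff₀ hq1]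
  rw [Nat.cast_one] at hB
  linarith

/-- In the domain `𝓗`, the nonzero zeros of `[ϖ]` lie in an annulus `r₁ ≤ |z| ≤ rₙ` with
`rₙ ^ (q ^ n) < r₁`. -/
lemma exists_radii (hϖ : Irreducible ϖ) (hn : 1 ≤ n) (hG₀ : HasHeight ϖ G₀ n)
    (hG : IsDeformation G₀ G)
    (hH : newtonSlope ϖ G 1 / (Nat.card (ResidueField (ValRing F)) : ℝ) ^ n < newtonSlope ϖ G n) :
    ∃ rₙ r₁, IsOuterRadius (toField (G.act ϖ)) (Nat.card (ResidueField (ValRing F)) ^ n) rₙ ∧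
      IsInnerRadius (toField (G.act ϖ)) r₁ ∧ rₙ ^ Nat.card (ResidueField (ValRing F)) ^ n < r₁ := by
  have h0 := norm_uniformizer_pos hϖ
  have h1 := norm_uniformizer_lt_one hϖ
  have hq := hG₀.two_le_card hn
  obtain ⟨hu, hlt⟩ := hG₀.norm_coeff hG
  set q := Nat.card (ResidueField (ValRing F)) with hqdef
  have hN : 1 < q ^ n := Nat.one_lt_pow (by omega) (by omega)
  have hone : PowerSeries.coeff 1 (toField (G.act ϖ)) ≠ 0 := by
    rw [coeff_toField]
    simpa using coeff_one_act_ne_zero hϖ G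
  have hb := norm_coeff_toField_le (G.act ϖ)
  obtain ⟨rₙ, hrₙ⟩ := exists_isOuterRadius (A := toField (G.act ϖ)) (M := q ^ n) hb
    (by rw [coeff_toField, hu]) (fun k hk => by rw [coeff_toField]; exact hlt k hk) ⟨1, hN, hone⟩
  obtain ⟨r₁, hr₁, k, hk1, -, hk⟩ := exists_isInnerRadius (A := toField (G.act ϖ)) hb hN
    (by rw [coeff_toField, hu])
    (by
      rw [← PowerSeries.coeff_zero_eq_constantCoeff_apply, coeff_toField,
        PowerSeries.coeff_zero_eq_constantCoeff_apply, G.act_constantCoeff]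
      rfl) hone
    (by rw [coeff_toField, norm_coeff_one_act]; exact h1)
  refine ⟨rₙ, r₁, hrₙ, hr₁, ?_⟩
  have hq0 : (0 : ℝ) < (q : ℝ) ^ n := by positivity
  have e1 := newtonSlope_le hϖ hn hG₀ hG hrₙ
  have e2 := le_newtonSlope hϖ hn hG₀ hr₁ ⟨k, hk1, hk⟩
  rw [div_lt_iff₀ hq0] at hH
  have e3 : Real.logb ‖(ϖ : F)‖ r₁ < Real.logb ‖(ϖ : F)‖ (rₙ ^ q ^ n) := by
    rw [Real.logb_pow, Nat.cast_pow]
    nlinarith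
  exact (Real.logb_lt_logb_iff_of_base_lt_one h0 h1 hr₁.pos (pow_pos hrₙ.pos _)).1 e3

end Newton

/-! ### Division by powers of the uniformizer -/

section Descent

lemma toField_subst {L : Type*} [NormedField L] [IsUltrametricDist L]
    {A B : PowerSeries (ValRing L)} (hB : PowerSeries.constantCoeff B = 0) :
    toField (A.subst B) = (toField A).subst (toField B) :=
  PowerSeries.map_subst (PowerSeries.HasSubst.of_constantCoeff_zero' hB) A

/-- Over a domain, orders multiply under composition. -/
lemma X_pow_dvd_subst {R : Type*} [CommRing R] [IsDomain R] {A B : PowerSeries R} {a b : ℕ}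
    (hb : 1 ≤ b) (hA : PowerSeries.X ^ a ∣ A) (hA' : PowerSeries.coeff a A ≠ 0)
    (hB : PowerSeries.X ^ b ∣ B) (hB' : PowerSeries.coeff b B ≠ 0) :
    PowerSeries.X ^ (a * b) ∣ A.subst B ∧ PowerSeries.coeff (a * b) (A.subst B) ≠ 0 := by
  have hB0 : PowerSeries.constantCoeff B = 0 :=
    PowerSeries.X_dvd_iff.1 ((dvd_pow_self _ (by omega)).trans hB)
  have hs := PowerSeries.HasSubst.of_constantCoeff_zero' hB0
  obtain ⟨w, rfl⟩ := hB
  obtain ⟨z, rfl⟩ := hA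
  have hz := coeff_subst_of_X_pow_dvd (A := z) (d := 0) (by simp) hB0
  rw [pow_zero, mul_one] at hz
  have h : (PowerSeries.X ^ a * z).subst (PowerSeries.X ^ b * w) =
      PowerSeries.X ^ (a * b) * (w ^ a * z.subst (PowerSeries.X ^ b * w)) := by
    rw [PowerSeries.subst_mul hs, PowerSeries.subst_pow hs, PowerSeries.subst_X hs, mul_pow,
      ← pow_mul, mul_comm b a, mul_assoc]
  rw [PowerSeries.coeff_X_pow_mul', if_pos le_rfl, Nat.sub_self] at hA' hB'
  rw [h]
  refine ⟨dvd_mul_right _ _, ?_⟩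
  rw [PowerSeries.coeff_X_pow_mul', if_pos le_rfl, Nat.sub_self,
    PowerSeries.coeff_zero_eq_constantCoeff_apply, map_mul, map_pow]
  rw [PowerSeries.coeff_zero_eq_constantCoeff_apply] at hA' hB' hz
  rw [hz, PowerSeries.coeff_zero_eq_constantCoeff_apply]
  exact mul_ne_zero (pow_ne_zero _ hB') hA'

lemma FormalModule.X_pow_dvd_act_pow {O R : Type*} [CommRing O] [CommRing R] [IsDomain R]
    [Algebra O R] (G : FormalModule O R) {ϖ : O} {N : ℕ} (hN : 1 ≤ N)
    (h : PowerSeries.X ^ N ∣ G.act ϖ) (h' : PowerSeries.coeff N (G.act ϖ) ≠ 0) (m : ℕ) :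
    PowerSeries.X ^ (N ^ m) ∣ G.act (ϖ ^ m) ∧ PowerSeries.coeff (N ^ m) (G.act (ϖ ^ m)) ≠ 0 := by
  induction m with
  | zero => simp [G.act_one]
  | succ m ih =>
    rw [pow_succ, pow_succ, G.act_mul]
    exact X_pow_dvd_subst hN ih.1 ih.2 h h'

variable {F : Type u} {L : Type v} [NormedField F] [IsUltrametricDist F]
  [NormedField L] [IsUltrametricDist L] [NormedAlgebra F L] {ϖ : ValRing F} {n : ℕ}
  {G₀ : FormalModule (ValRing F) (ResidueField (ValRing F))}
  {G G' : FormalModule (ValRing F) (ValRing L)}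

/-- A nonzero homomorphism in characteristic zero has a nonzero derivative: its lowest
coefficient `c` in degree `d` satisfies `c ϖ ^ d = ϖ c`. -/
lemma FormalModule.IsHom.coeff_one_ne_zero (hϖ : Irreducible ϖ) {f : PowerSeries (ValRing L)}
    (hf : G.IsHom G' f) (hne : f ≠ 0) : PowerSeries.coeff 1 f ≠ 0 := by
  have hd := PowerSeries.coeff_order hne
  have hdvd : PowerSeries.X ^ f.order.toNat ∣ f := PowerSeries.X_pow_dvd_iff.2 fun m hm =>
    PowerSeries.coeff_of_lt_order_toNat m hm
  have hd1 : 1 ≤ f.order.toNat := by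
    by_contra h0
    have h0 : f.order.toNat = 0 := by omega
    rw [h0, PowerSeries.coeff_zero_eq_constantCoeff_apply] at hd
    exact hd hf.constantCoeff
  have h := mul_left_cancel₀ hd (hf.coeff_mul_pow hd1 hdvd ϖ)
  have h1 : ‖(ϖ : F)‖ ^ f.order.toNat = ‖(ϖ : F)‖ := by
    simpa using congrArg (fun a : ValRing L => ‖(a : L)‖) h
  have h2 : f.order.toNat = 1 := by
    by_contra hne1
    have := pow_lt_self_of_lt_one₀ (norm_uniformizer_pos hϖ) (norm_uniformizer_lt_one hϖ)
      (n := f.order.toNat) (by omega)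
    exact this.ne h1
  rwa [h2] at hd

/-- A homomorphism lifting `[ϖ ^ m]` is divisible by `[ϖ ^ m]`: the quotient lifts the identity. -/
lemma exists_isHom_lift_id [CompleteSpace L] (hϖ : Irreducible ϖ) (hn : 1 ≤ n)
    (hG₀ : HasHeight ϖ G₀ n) (hG : IsDeformation G₀ G) (hG' : IsDeformation G₀ G')
    (hH : newtonSlope ϖ G 1 / (Nat.card (ResidueField (ValRing F)) : ℝ) ^ n < newtonSlope ϖ G n)
    (hH' : newtonSlope ϖ G' 1 / (Nat.card (ResidueField (ValRing F)) : ℝ) ^ n <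
      newtonSlope ϖ G' n) (m : ℕ) (f : PowerSeries (ValRing L)) (hf : G.IsHom G' f)
    (hfm : f.map (residue (ValRing L)) =
      (G₀.map (residueMap (ValRing F) (ValRing L))).act (ϖ ^ m)) :
    ∃ g, G.IsHom G' g ∧ g.map (residue (ValRing L)) = PowerSeries.X := by
  induction m generalizing f with
  | zero => exact ⟨f, hf, by rw [hfm, pow_zero, FormalModule.act_one]⟩
  | succ m ih =>
    have h1 := norm_uniformizer_lt_one hϖ
    have hq := hG₀.two_le_card hn
    obtain ⟨rₙ, r₁, hrₙ, hr₁, hr⟩ := exists_radii hϖ hn hG₀ hG hH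
    obtain ⟨rₙ', r₁', hrₙ', hr₁', hr'⟩ := exists_radii hϖ hn hG₀ hG' hH'
    obtain ⟨hu, hlt⟩ := hG₀.norm_coeff hG
    set N := Nat.card (ResidueField (ValRing F)) ^ n with hNdef
    have hN : 1 < N := Nat.one_lt_pow (by omega) (by omega)
    have hGact : (G.act ϖ).map (residue (ValRing L)) =
        (G₀.map (residueMap (ValRing F) (ValRing L))).act ϖ :=
      congrArg (fun H : FormalModule _ _ => H.act ϖ) hG
    have hred1 : PowerSeries.X ^ N ∣ (G₀.map (residueMap (ValRing F) (ValRing L))).act ϖ := by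
      rw [← hGact, PowerSeries.X_pow_dvd_iff]
      intro k hk
      rw [PowerSeries.coeff_map, ← norm_lt_one_iff_residue_eq_zero]
      exact hlt k hk
    have hred2 : PowerSeries.coeff N ((G₀.map (residueMap (ValRing F) (ValRing L))).act ϖ) ≠ 0 := by
      rw [← hGact, PowerSeries.coeff_map, ← norm_eq_one_iff_residue_ne_zero, hu]
    obtain ⟨hM1, hM2⟩ := FormalModule.X_pow_dvd_act_pow _ hN.le hred1 hred2 (m + 1)
    rw [← hfm] at hM1 hM2
    rw [PowerSeries.coeff_map, ← norm_eq_one_iff_residue_ne_zero] at hM2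
    have hMlt : ∀ k < N ^ (m + 1), ‖((PowerSeries.coeff k f : ValRing L) : L)‖ < 1 := fun k hk => by
      rw [norm_lt_one_iff_residue_eq_zero, ← PowerSeries.coeff_map]
      exact PowerSeries.X_pow_dvd_iff.1 hM1 k hk
    have hfne : f ≠ 0 := by
      rintro rfl
      simp at hM2
    have hf1 : PowerSeries.coeff 1 (toField f) ≠ 0 := by
      rw [coeff_toField]
      simpa using hf.coeff_one_ne_zero hϖ hfne
    have hNM : N ≤ N ^ (m + 1) := Nat.le_self_pow (by omega) N
    have hf0 := hf.constantCoeff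
    have hP0 := G.act_constantCoeff ϖ
    obtain ⟨r₀, hr₀⟩ := exists_isOuterRadius (A := toField f) (M := N ^ (m + 1))
      (norm_coeff_toField_le f) (by rw [coeff_toField, hM2])
      (fun k hk => by rw [coeff_toField]; exact hMlt k hk) ⟨1, by omega, hf1⟩
    have hcomm : (toField f).subst (toField (G.act ϖ)) =
        (toField (G'.act ϖ)).subst (toField f) := by
      rw [← toField_subst hP0, ← toField_subst hf0, hf.map_act]
    obtain ⟨hge, hlt'⟩ := radius_estimates hrₙ hr₁ hr hrₙ' hr₁' hr'
      (by rw [coeff_toField, norm_coeff_one_act]; exact h1) hN hNM hr₀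
      (by
        rw [← PowerSeries.coeff_zero_eq_constantCoeff_apply, coeff_toField,
          PowerSeries.coeff_zero_eq_constantCoeff_apply, hf0]
        rfl) hf1 hcomm
    have hdvd := dvd_of_radius_estimates hrₙ hP0 hr₁' hlt hr₀.le hge hr₀.lt_one hlt' hf0
      (hf.map_act ϖ)
    obtain ⟨g, hg, hfg⟩ := hf.exists_factor hrₙ
      (by rw [← G.act_coeff_one]; exact coeff_one_act_ne_zero hϖ G) hdvd
    refine ih g hg ?_
    set Gk := G₀.map (residueMap (ValRing F) (ValRing L))
    refine subst_left_injective (Gk.act_constantCoeff ϖ) (fun h => hred2 (by rw [h, map_zero])) ?_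
    rw [← Gk.act_mul, ← pow_succ, ← hfm, hfg, ← hGact]
    exact (PowerSeries.map_subst (PowerSeries.HasSubst.of_constantCoeff_zero' hP0) g).symm

end Descent

/-! ### Approximate commutation with a series -/

section Contraction

/-- As long as `K j ≤ ρ`, the recursive bound makes `K` grow at least by the factor `1 / ρ`. -/
lemma exists_lt_of_forall_le_max {K : ℕ → ℝ} {ρ R : ℝ} {N : ℕ} (hN : 2 ≤ N) (hK0 : ∀ j, 0 < K j)
    (hK1 : ∀ j, K j < 1) (hmono : Monotone K) (hR : R < K 0) (hρ0 : 0 < ρ) (hρ1 : ρ < 1)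
    (hstep : ∀ j, K j ≤ max (ρ * K (j + 1)) (max (K (j + 1) ^ N) R)) : ∃ j, ρ < K j := by
  by_contra! h
  have hle : ∀ j, K j ≤ ρ * K (j + 1) := by
    intro j
    rcases le_max_iff.1 (hstep j) with h1 | h1
    · exact h1
    rcases le_max_iff.1 h1 with h1 | h1
    · refine h1.trans ?_
      have h2 : K (j + 1) ^ N ≤ K (j + 1) ^ 2 :=
        pow_le_pow_of_le_one (hK0 _).le (hK1 _).le hN
      nlinarith [h (j + 1), hK0 (j + 1)]
    · exact absurd (h1.trans_lt hR) (not_lt.2 (hmono (Nat.zero_le j)))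
  have hpow : ∀ j, K 0 ≤ ρ ^ j * K j := by
    intro j
    induction j with
    | zero => simp
    | succ j ih =>
      rw [pow_succ, mul_assoc]
      exact ih.trans (mul_le_mul_of_nonneg_left (hle j) (pow_nonneg hρ0.le j))
  obtain ⟨j, hj⟩ := exists_pow_lt_of_lt_one (hK0 0) hρ1
  have := hpow j
  have h1 : ρ ^ j * K j ≤ ρ ^ j * 1 := by gcongr; exact (hK1 j).le
  linarith

/-- Once `K 0 > ρ`, only the term `K (j + 1) ^ N` of the recursive bound can be effective. -/
lemma le_pow_of_forall_le_max {K : ℕ → ℝ} {ρ R : ℝ} {N : ℕ} (hK0 : ∀ j, 0 < K j)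
    (hK1 : ∀ j, K j < 1) (hmono : Monotone K) (hR : R < K 0) (hρ0 : 0 < ρ) (hρ : ρ < K 0)
    (hstep : ∀ j, K j ≤ max (ρ * K (j + 1)) (max (K (j + 1) ^ N) R)) (j : ℕ) :
    K 0 ≤ K j ^ N ^ j := by
  have hle : ∀ j, K j ≤ K (j + 1) ^ N := by
    intro j
    have hj := hmono (Nat.zero_le j)
    rcases le_max_iff.1 (hstep j) with h1 | h1
    · nlinarith [hK1 (j + 1), hK0 (j + 1)]
    rcases le_max_iff.1 h1 with h1 | h1
    · exact h1
    · linarith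
  induction j with
  | zero => simp
  | succ j ih =>
    rw [pow_succ', pow_mul]
    exact ih.trans (pow_le_pow_left₀ (hK0 j).le (hle j) _)

variable {L : Type*} [NormedField L] [IsUltrametricDist L]

/-- A series `h` with coefficients of absolute value less than `1` which commutes with `P` up to
an error bounded by `R` is itself bounded by `R`. Composition with `P` on the right turns the
radius `r` into `r ^ N`, composition on the left shrinks values. If `h` were larger than `R`, its
maximum `K(r)` on the circle of radius `r` would satisfy `K(r ^ N) ≤ K(r) ^ N` for `r` close
to `1`; then its dominant index stays bounded as `r` tends to `1`, whereas `K(r)` tends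
to `1`. -/
lemma norm_coeff_le_of_comm {P h : PowerSeries L} {N : ℕ} {rₙ R : ℝ} (hN : 2 ≤ N)
    (hP : IsOuterRadius P N rₙ) (hP0 : PowerSeries.constantCoeff P = 0)
    (hh0 : PowerSeries.constantCoeff h = 0) (hh : ∀ k, ‖PowerSeries.coeff k h‖ < 1) (hR : 0 ≤ R)
    (hcomm : ∀ k, ‖PowerSeries.coeff k (h.subst P - P.subst h)‖ ≤ R) (k : ℕ) :
    ‖PowerSeries.coeff k h‖ ≤ R := by
  by_contra! hk
  have hne : h ≠ 0 := by
    rintro rfl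
    simp at hk
    linarith
  have hwt1 : ∀ {r : ℝ} (_ : 0 < r) (_ : r < 1) (i : ℕ), wt h r i < 1 := fun {r} hr0 hr1 i =>
    calc wt h r i ≤ ‖PowerSeries.coeff i h‖ * 1 := by
          unfold wt; gcongr; exact pow_le_one₀ hr0.le hr1.le
      _ < 1 := by rw [mul_one]; exact hh i
  have hstep : ∀ {r : ℝ} (_ : rₙ < r) (_ : r < 1) {i j : ℕ} (_ : IsFirst h (r ^ N) i)
      (_ : IsFirst h r j), wt h (r ^ N) i ≤ max (rₙ * wt h r j) (max (wt h r j ^ N) R) := by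
    intro r hr hr1 i j hi hj
    have hr0 : 0 < r := hP.pos.trans hr
    have h1 := (IsFirst.subst hP0 hr0 (hP.isFirst hr hr1) (by rwa [hP.wt_eq])).2
    rw [hP.wt_eq] at h1
    set s := wt h r j with hs
    have hs0 : 0 < s := hj.pos hr0
    have hs1 : s < 1 := hwt1 hr0 hr1 j
    have hPs : ∀ l, wt P s l ≤ max (rₙ * s) (s ^ N) := by
      intro l
      rcases Nat.eq_zero_or_pos l with rfl | hl
      · rw [wt, PowerSeries.coeff_zero_eq_constantCoeff_apply, hP0, norm_zero, zero_mul]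
        exact le_max_of_le_right (pow_nonneg hs0.le _)
      rcases lt_or_ge l N with hlN | hlN
      · refine le_max_of_le_left ?_
        unfold wt
        have h2 : ‖PowerSeries.coeff l P‖ ≤ rₙ := (hP.norm_coeff_le hlN.le).trans
          (pow_le_of_le_one hP.pos.le hP.lt_one.le (by omega))
        have h3 : s ^ l ≤ s := pow_le_of_le_one hs0.le hs1.le (by omega)
        have := hP.pos.le
        gcongr
      · refine le_max_of_le_right ?_
        calc wt P s l ≤ 1 * s ^ l := by unfold wt; gcongr; exact hP.bdd l
          _ ≤ s ^ N := by rw [one_mul]; exact pow_le_pow_of_le_one hs0.le hs1.le hlN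
    have h2 : wt (P.subst h) r (i * N) ≤ max (rₙ * s) (s ^ N) :=
      wt_subst_le hh0 hr0.le (le_max_of_le_right (pow_nonneg hs0.le _)) hj.le hPs _
    have h3 : wt (h.subst P - P.subst h) r (i * N) ≤ R :=
      calc wt (h.subst P - P.subst h) r (i * N) ≤ R * 1 := by
            unfold wt; gcongr; exacts [hcomm _, pow_le_one₀ hr0.le hr1.le]
        _ = R := mul_one R
    have h4 : wt (h.subst P) r (i * N) ≤
        max (wt (h.subst P - P.subst h) r (i * N)) (wt (P.subst h) r (i * N)) := by
      rw [wt, wt, wt, ← max_mul_of_nonneg _ _ (pow_nonneg hr0.le _)]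
      gcongr
      have := IsUltrametricDist.norm_add_le_max
        (PowerSeries.coeff (i * N) (h.subst P - P.subst h)) (PowerSeries.coeff (i * N) (P.subst h))
      rwa [← map_add, sub_add_cancel] at this
    rw [h1] at h4
    refine h4.trans (max_le (h3.trans ?_) (h2.trans ?_))
    · exact (le_max_right _ _).trans (le_max_right _ _)
    · exact max_le_max le_rfl (le_max_left _ _)
  -- a radius where the maximum of `h` exceeds `R`, and its iterated `N`-th roots
  obtain ⟨r₀, hr₀, hr₀1, hKr₀⟩ : ∃ r₀, rₙ < r₀ ∧ r₀ < 1 ∧ R < wt h r₀ k := by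
    by_contra! hcon
    exact hk.not_ge (le_of_forall_mul_pow_le hP.lt_one k hcon)
  have hr₀0 : 0 < r₀ := hP.pos.trans hr₀
  have hN0 : (0 : ℝ) < N := by exact_mod_cast (by omega : 0 < N)
  obtain ⟨r, hr0, hrpow⟩ : ∃ r : ℕ → ℝ, (∀ j, r₀ ≤ r j ∧ r j < 1) ∧
      ∀ i j, r (i + j) ^ N ^ j = r i := by
    refine ⟨fun j => r₀ ^ (((N : ℝ) ^ j)⁻¹), fun j => ⟨?_, ?_⟩, fun i j => ?_⟩
    · refine Real.self_le_rpow_of_le_one hr₀0.le hr₀1.le (inv_le_one_of_one_le₀ ?_)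
      exact one_le_pow₀ (by exact_mod_cast (by omega : 1 ≤ N))
    · exact Real.rpow_lt_one hr₀0.le hr₀1 (by positivity)
    · rw [← Real.rpow_natCast, ← Real.rpow_mul hr₀0.le]
      congr 1
      push_cast
      rw [pow_add]
      field_simp
  have hrpos : ∀ j, 0 < r j := fun j => hr₀0.trans_le (hr0 j).1
  have hrmono : ∀ j, r j ≤ r (j + 1) := fun j => by
    rw [← hrpow j 1, pow_one]
    exact pow_le_of_le_one (hrpos _).le (hr0 _).2.le (by omega)
  choose i hi using fun j => exists_isFirst (fun k => (hh k).le) hne (hrpos j) (hr0 j).2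
  set K : ℕ → ℝ := fun j => wt h (r j) (i j) with hK
  have hK0 : ∀ j, 0 < K j := fun j => (hi j).pos (hrpos j)
  have hK1 : ∀ j, K j < 1 := fun j => hwt1 (hrpos j) (hr0 j).2 _
  have hKmono : Monotone K := monotone_nat_of_le_succ fun j => by
    refine le_trans ?_ ((hi (j + 1)).le (i j))
    have := hrmono j
    have := (hrpos j).le
    simp only [hK]
    unfold wt
    gcongr
  have hKR : R < K 0 := by
    refine hKr₀.trans_le (le_trans ?_ ((hi 0).le k))
    have := (hr0 0).1
    unfold wt
    gcongr
  have hKstep : ∀ j, K j ≤ max (rₙ * K (j + 1)) (max (K (j + 1) ^ N) R) := fun j => by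
    have h1 := hrpow j 1
    rw [pow_one] at h1
    have := hstep (hr₀.trans_le (hr0 (j + 1)).1) (hr0 (j + 1)).2 (i := i j) (j := i (j + 1))
      (by rw [h1]; exact hi j) (hi (j + 1))
    rwa [h1] at this
  obtain ⟨j₀, hj₀⟩ := exists_lt_of_forall_le_max hN hK0 hK1 hKmono hKR hP.pos hP.lt_one hKstep
  have hpow : ∀ j, K j₀ ≤ K (j₀ + j) ^ N ^ j :=
    le_pow_of_forall_le_max (K := fun j => K (j₀ + j)) (fun j => hK0 _) (fun j => hK1 _)
      (fun a b hab => hKmono (by omega)) (hKR.trans_le (hKmono (Nat.zero_le _))) hP.pos hj₀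
      (fun j => hKstep _)
  -- the dominant indices at the radii `r (j₀ + j)` remain below `α`
  obtain ⟨α, hα⟩ := exists_pow_lt_of_lt_one (hK0 j₀) (hr0 j₀).2
  have hbound : ∀ j, i (j₀ + j) < α ∧ K j₀ ≤ ‖PowerSeries.coeff (i (j₀ + j)) h‖ ^ N ^ j := by
    intro j
    have h1 : K j₀ ≤ ‖PowerSeries.coeff (i (j₀ + j)) h‖ ^ N ^ j * r j₀ ^ i (j₀ + j) := by
      refine (hpow j).trans (le_of_eq ?_)
      simp only [hK]
      rw [wt, mul_pow, ← pow_mul, mul_comm (i (j₀ + j)), pow_mul, hrpow]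
    constructor
    · by_contra! hle
      have h2 : r j₀ ^ i (j₀ + j) ≤ r j₀ ^ α :=
        pow_le_pow_of_le_one (hrpos _).le (hr0 _).2.le hle
      have h3 : ‖PowerSeries.coeff (i (j₀ + j)) h‖ ^ N ^ j * r j₀ ^ i (j₀ + j) ≤
          1 * r j₀ ^ α := by
        have := (hrpos j₀).le
        gcongr
        exact pow_le_one₀ (norm_nonneg _) (hh _).le
      linarith
    · exact h1.trans (mul_le_of_le_one_right (by positivity)
        (pow_le_one₀ (hrpos _).le (hr0 _).2.le))
  -- only finitely many coefficients are involved, hence they are bounded away from `1`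
  obtain ⟨l, -, hl⟩ := (Finset.range (α + 1)).exists_max_image (fun k => ‖PowerSeries.coeff k h‖)
    ⟨0, by simp⟩
  obtain ⟨j, hj⟩ := exists_pow_lt_of_lt_one (hK0 j₀) (hh l)
  have h1 : ‖PowerSeries.coeff (i (j₀ + j)) h‖ ^ N ^ j ≤ ‖PowerSeries.coeff l h‖ ^ N ^ j := by
    gcongr
    exact hl _ (by have := (hbound j).1; simp; omega)
  have h2 : ‖PowerSeries.coeff l h‖ ^ N ^ j ≤ ‖PowerSeries.coeff l h‖ ^ j :=
    pow_le_pow_of_le_one (norm_nonneg _) (hh l).le (Nat.lt_pow_self (by omega)).le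
  have := (hbound j).2
  linarith

end Contraction

/-! ### Points of the polydisc and congruences between fibres -/

section Coordinates

/-- A power series without constant term is a combination of the variables. -/
lemma exists_eq_sum_X_mul {σ R : Type*} [Fintype σ] [CommRing R] {f : MvPowerSeries σ R}
    (hf : MvPowerSeries.constantCoeff f = 0) :
    ∃ g : σ → MvPowerSeries σ R, f = ∑ i, MvPowerSeries.X i * g i := by
  classical
  rcases isEmpty_or_nonempty σ with hσ | hσ
  · refine ⟨0, ?_⟩
    ext m
    rw [Subsingleton.elim m 0, MvPowerSeries.coeff_zero_eq_constantCoeff_apply, hf]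
    simp
  have hex : ∀ m : σ →₀ ℕ, m ≠ 0 → ∃ i, m i ≠ 0 := fun m hm => Finsupp.ne_iff.1 hm
  -- each nonconstant monomial is assigned to one of the variables occurring in it
  choose! c hc using hex
  let g : σ → MvPowerSeries σ R := fun i m =>
    if c (m + Finsupp.single i 1) = i then MvPowerSeries.coeff (m + Finsupp.single i 1) f else 0
  have hg : ∀ i m, MvPowerSeries.coeff m (g i) =
    if c (m + Finsupp.single i 1) = i then MvPowerSeries.coeff (m + Finsupp.single i 1) f else 0 :=
    fun i m => rfl
  refine ⟨g, ?_⟩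
  ext m
  have hterm : ∀ i, MvPowerSeries.coeff m (MvPowerSeries.X i * g i) =
      if m i ≠ 0 ∧ c m = i then MvPowerSeries.coeff m f else 0 := by
    intro i
    rw [MvPowerSeries.X_def, MvPowerSeries.coeff_monomial_mul, one_mul, hg]
    by_cases hmi : m i = 0
    · rw [if_neg, if_neg]
      · exact fun h => h.1 hmi
      · rw [Finsupp.single_le_iff]; omega
    · have hle : Finsupp.single i 1 ≤ m := by rw [Finsupp.single_le_iff]; omega
      rw [if_pos hle, tsub_add_cancel_of_le hle]
      simp [hmi]
  rw [map_sum, Finset.sum_congr rfl fun i _ => hterm i]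
  by_cases hm : m = 0
  · subst hm
    rw [MvPowerSeries.coeff_zero_eq_constantCoeff_apply, hf]
    simp
  · rw [Finset.sum_eq_single (c m)]
    · rw [if_pos ⟨hc m hm, rfl⟩]
    · intro i _ hi
      exact if_neg fun h => hi h.2.symm
    · simp

variable {F : Type u} {L : Type v} [NormedField F] [IsUltrametricDist F]
  [NormedField L] [IsUltrametricDist L] [NormedAlgebra F L] {σ : Type*}

lemma Point.norm_lt_one (x : Point F L σ) {a : MvPowerSeries σ (ValRing F)} (ha : ¬ IsUnit a) :
    ‖(x.1 a : L)‖ < 1 := by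
  rw [← mem_maximalIdeal_valRing_iff, mem_maximalIdeal, mem_nonunits_iff]
  exact fun h => ha (x.2.map_nonunit a h)

lemma not_isUnit_X {R : Type*} [CommRing R] [Nontrivial R] (i : σ) :
    ¬ IsUnit (MvPowerSeries.X i : MvPowerSeries σ R) := by
  simp [MvPowerSeries.isUnit_iff_constantCoeff]

/-- The distance of two points of the polydisc is attained on the coordinates. -/
lemma Point.norm_sub_le [Finite σ] (x x' : Point F L σ) {R : ℝ} (hR : 0 ≤ R)
    (h : ∀ i, ‖((x'.1 (MvPowerSeries.X i) : ValRing L) : L) -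
      (x.1 (MvPowerSeries.X i) : ValRing L)‖ ≤ R)
    (a : MvPowerSeries σ (ValRing F)) : ‖((x'.1 a : ValRing L) : L) - (x.1 a : ValRing L)‖ ≤ R := by
  classical
  have := Fintype.ofFinite σ
  obtain ⟨ρ, hρ0, hρ1, hρ⟩ : ∃ ρ : ℝ, 0 ≤ ρ ∧ ρ < 1 ∧
      ∀ i, ‖((x.1 (MvPowerSeries.X i) : ValRing L) : L)‖ ≤ ρ := by
    rcases isEmpty_or_nonempty σ with hσ | hσ
    · exact ⟨0, le_rfl, one_pos, fun i => isEmptyElim i⟩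
    · obtain ⟨i, -, hi⟩ := Finset.univ.exists_max_image
        (fun i => ‖((x.1 (MvPowerSeries.X i) : ValRing L) : L)‖) Finset.univ_nonempty
      exact ⟨_, norm_nonneg _, x.norm_lt_one (not_isUnit_X i), fun j => hi j (Finset.mem_univ _)⟩
  -- writing `a` in terms of the variables improves an error bound `B` to `max R (ρ B)`
  have key : ∀ k : ℕ, ∀ a : MvPowerSeries σ (ValRing F),
      ‖((x'.1 a : ValRing L) : L) - (x.1 a : ValRing L)‖ ≤ max R (ρ ^ k) := by
    intro k
    induction k with
    | zero =>
      intro a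
      refine le_max_of_le_right ?_
      rw [pow_zero]
      exact norm_coe_le_one (x'.1 a - x.1 a)
    | succ k ih =>
      intro a
      obtain ⟨g, hg⟩ := exists_eq_sum_X_mul
        (f := a - algebraMap (ValRing F) _ (MvPowerSeries.constantCoeff a))
        (by simp [MvPowerSeries.algebraMap_apply])
      rw [sub_eq_iff_eq_add] at hg
      have h1 : ((x'.1 a : ValRing L) : L) - (x.1 a : ValRing L) =
          ∑ i, (((x'.1 (MvPowerSeries.X i) : ValRing L) : L) * (x'.1 (g i) : ValRing L) -
            (x.1 (MvPowerSeries.X i) : ValRing L) * (x.1 (g i) : ValRing L)) := by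
        rw [hg, map_add, map_add, AlgHom.commutes, AlgHom.commutes, map_sum, map_sum]
        push_cast
        rw [add_sub_add_right_eq_sub, ← Finset.sum_sub_distrib]
        simp
      rw [h1]
      refine IsUltrametricDist.norm_sum_le_of_forall_le_of_nonneg (le_max_of_le_left hR)
        fun i _ => ?_
      have h2 : ((x'.1 (MvPowerSeries.X i) : ValRing L) : L) * (x'.1 (g i) : ValRing L) -
            (x.1 (MvPowerSeries.X i) : ValRing L) * (x.1 (g i) : ValRing L) =
          (((x'.1 (MvPowerSeries.X i) : ValRing L) : L) - (x.1 (MvPowerSeries.X i) : ValRing L)) *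
            (x'.1 (g i) : ValRing L) + (x.1 (MvPowerSeries.X i) : ValRing L) *
            (((x'.1 (g i) : ValRing L) : L) - (x.1 (g i) : ValRing L)) := by ring
      rw [h2]
      refine (IsUltrametricDist.norm_add_le_max _ _).trans (max_le ?_ ?_)
      · rw [norm_mul]
        exact le_max_of_le_left ((mul_le_of_le_one_right (norm_nonneg _)
          (norm_coe_le_one _)).trans (h i))
      · rw [norm_mul]
        calc _ ≤ ρ * max R (ρ ^ k) := by gcongr; exacts [hρ i, ih (g i)]
          _ ≤ max R (ρ ^ (k + 1)) := by
            rw [mul_max_of_nonneg _ _ hρ0, pow_succ']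
            exact max_le_max (mul_le_of_le_one_left hR hρ1.le) le_rfl
  have ht : Filter.Tendsto (fun k : ℕ => max R (ρ ^ k)) Filter.atTop (nhds (max R 0)) :=
    tendsto_const_nhds.max (tendsto_pow_atTop_nhds_zero_of_lt_one hρ0 hρ1)
  rw [max_eq_left hR] at ht
  exact ge_of_tendsto' ht fun k => key k a

end Coordinates

section Congruence

variable {O : Type*} [CommRing O] {L : Type*} [NormedField L] [IsUltrametricDist L]
  [Algebra O (ValRing L)]

/-- If two formal modules are congruent modulo `a`, any homomorphism between them which
is congruent to the identity modulo the maximal ideal is so modulo `a`. -/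
lemma FormalModule.IsHom.dvd_coeff_sub_X {G G' : FormalModule O (ValRing L)}
    {g : PowerSeries (ValRing L)} (hg : G.IsHom G' g)
    (hgX : g.map (residue (ValRing L)) = PowerSeries.X) {ϖ : O} {N : ℕ} {rₙ : ℝ} (hN : 2 ≤ N)
    (hP : IsOuterRadius (toField (G'.act ϖ)) N rₙ) {a : ValRing L} (ha : a ≠ 0)
    (hGG' : G.map (Ideal.Quotient.mkₐ O (Ideal.span {a})) =
      G'.map (Ideal.Quotient.mkₐ O (Ideal.span {a}))) (k : ℕ) :
    a ∣ PowerSeries.coeff k g - PowerSeries.coeff k PowerSeries.X := by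
  set mk := Ideal.Quotient.mkₐ O (Ideal.span {a}) with hmk
  set Q := G'.map mk with hQ
  have hg0 := hg.constantCoeff
  have hn0 := G'.act_constantCoeff (-1)
  have hP0 := G'.act_constantCoeff ϖ
  have hdvd : ∀ b : ValRing L, mk b = 0 ↔ a ∣ b := fun b => by
    rw [← Ideal.mem_span_singleton]; exact Ideal.Quotient.eq_zero_iff_mem
  set h : PowerSeries (ValRing L) := G'.add g (G'.act (-1)) with hh
  have hh0 : PowerSeries.constantCoeff h = 0 := G'.constantCoeff_add hg0 hn0
  have hmap : h.map (mk : ValRing L →+* ValRing L ⧸ Ideal.span {a}) =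
      Q.add (g.map (mk : ValRing L →+* ValRing L ⧸ Ideal.span {a}))
        (Q.act (-1)) :=
    FormalModule.map_add mk G' hg0 hn0
  -- modulo the maximal ideal, the formal difference of `g` and the identity vanishes
  have hres : ∀ k, ‖PowerSeries.coeff k (toField h)‖ < 1 := by
    intro k
    rw [coeff_toField, norm_lt_one_iff_residue_eq_zero]
    have h1 : h.map (residue (ValRing L)) = (G'.map (reduction O (ValRing L))).add
        (g.map (residue (ValRing L))) ((G'.map (reduction O (ValRing L))).act (-1)) :=
      FormalModule.map_add (reduction O (ValRing L)) G' hg0 hn0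
    have h2 := (G'.map (reduction O (ValRing L))).add_neg
      (a := (PowerSeries.X : PowerSeries (ResidueField (ValRing L)))) PowerSeries.constantCoeff_X
    have h3 : PowerSeries.subst (PowerSeries.X : PowerSeries (ResidueField (ValRing L)))
      ((G'.map (reduction O (ValRing L))).act (-1)) =
      (G'.map (reduction O (ValRing L))).act (-1) := PowerSeries.X_subst _
    rw [h3] at h2
    rw [hgX] at h1
    have h4 := congrArg (PowerSeries.coeff k) (h1.trans h2)
    rw [PowerSeries.coeff_map] at h4
    rw [h4]
    exact map_zero _
  -- modulo `a`, the series `g` is an endomorphism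
  have hgQ : IsHom Q Q (g.map (mk : ValRing L →+* ValRing L ⧸ Ideal.span {a})) := by
    have := hg.map mk
    rwa [hGG'] at this
  have hcomm : ∀ k, ‖PowerSeries.coeff k ((toField h).subst (toField (G'.act ϖ)) -
      (toField (G'.act ϖ)).subst (toField h))‖ ≤ ‖(a : L)‖ := by
    intro k
    rw [← toField_subst hP0, ← toField_subst hh0, ← map_sub, coeff_toField]
    refine norm_le_of_dvd ((hdvd _).1 ?_)
    have h1 := hgQ.sub_id_comm ϖ
    rw [← hmap] at h1
    have h2 := PowerSeries.map_subst (h := (mk : ValRing L →+* ValRing L ⧸ Ideal.span {a}))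
      (PowerSeries.HasSubst.of_constantCoeff_zero hP0) h
    have h3 := PowerSeries.map_subst (h := (mk : ValRing L →+* ValRing L ⧸ Ideal.span {a}))
      (PowerSeries.HasSubst.of_constantCoeff_zero hh0) (G'.act ϖ)
    have h4 := congrArg (PowerSeries.coeff k) ((h2.trans h1).trans h3.symm)
    rw [map_sub, map_sub, sub_eq_zero]
    exact h4
  have hle := norm_coeff_le_of_comm hN hP (by
      rw [← PowerSeries.coeff_zero_eq_constantCoeff_apply, coeff_toField,
        PowerSeries.coeff_zero_eq_constantCoeff_apply, hP0]
      rfl) (by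
      rw [← PowerSeries.coeff_zero_eq_constantCoeff_apply, coeff_toField,
        PowerSeries.coeff_zero_eq_constantCoeff_apply, hh0]
      rfl) hres (norm_nonneg _) hcomm
  have hzero : h.map (mk : ValRing L →+* ValRing L ⧸ Ideal.span {a}) = 0 := by
    ext k
    rw [PowerSeries.coeff_map, map_zero]
    have := hle k
    rw [coeff_toField] at this
    exact (hdvd _).2 (dvd_of_norm_le ha this)
  have hgQX : g.map (mk : ValRing L →+* ValRing L ⧸ Ideal.span {a}) = PowerSeries.X := by
    have h1 := Q.add_sub_id hgQ.constantCoeff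
    rw [← hmap, hzero] at h1
    rw [← h1]
    exact Q.zero_add PowerSeries.constantCoeff_X
  rw [← hdvd, map_sub, sub_eq_zero]
  have h1 := congrArg (PowerSeries.coeff k) hgQX
  rw [PowerSeries.coeff_map] at h1
  refine h1.trans ?_
  rw [PowerSeries.coeff_X, PowerSeries.coeff_X]
  split_ifs <;> simp

end Congruence

/-! ### First-order deformations and rigidity -/

section DualNumbers

variable {O : Type u} [CommRing O] [IsLocalRing O]

open TrivSqZeroExt in
instance : IsLocalHom (algebraMap O (DualNumber (ResidueField O))) where
  map_nonunit c hc := by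
    rw [isUnit_iff_isUnit_fst] at hc
    have h : fst (algebraMap O (DualNumber (ResidueField O)) c) = residue O c := rfl
    rw [h] at hc
    exact isUnit_of_map_unit (residue O) c hc

lemma mem_maximalIdeal_dualNumber {k : Type*} [Field k] {z : DualNumber k} :
    z ∈ maximalIdeal (DualNumber k) ↔ z.fst = 0 := by
  rw [mem_maximalIdeal, mem_nonunits_iff, TrivSqZeroExt.isUnit_iff_isUnit_fst, isUnit_iff_ne_zero,
    not_not]

/-- A ring is complete for an ideal of square zero. -/
lemma isAdicComplete_of_sq_eq_bot {R : Type*} [CommRing R] {I : Ideal R} (hI : I ^ 2 = ⊥) :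
    IsAdicComplete I R where
  haus' x hx := by
    have h := hx 2
    rw [hI] at h
    simpa [SModEq.zero] using h
  prec' f hf := by
    refine ⟨f 2, fun n => ?_⟩
    rcases le_total n 2 with hn | hn
    · exact hf hn
    · have h : f 2 = f n := by
        have h := hf hn
        rw [hI] at h
        simpa [SModEq.sub_mem, sub_eq_zero] using h
      rw [h]

instance {k : Type*} [Field k] : IsAdicComplete (maximalIdeal (DualNumber k)) (DualNumber k) := by
  refine isAdicComplete_of_sq_eq_bot (le_bot_iff.1 ?_)
  rw [pow_two, Ideal.mul_le]
  intro a ha b hb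
  rw [mem_maximalIdeal_dualNumber] at ha hb
  rw [Ideal.mem_bot]
  ext <;> simp [ha, hb]

lemma residueMap_dualNumber_bijective :
    Function.Bijective (residueMap O (DualNumber (ResidueField O))) := by
  refine ⟨residueMap_injective _, fun z => ?_⟩
  obtain ⟨z, rfl⟩ := residue_surjective z
  obtain ⟨c, hc⟩ := residue_surjective (R := O) z.fst
  refine ⟨residue O c, ?_⟩
  change residue _ (algebraMap O (DualNumber (ResidueField O)) c) = _
  rw [← sub_eq_zero, ← map_sub, residue_eq_zero_iff, mem_maximalIdeal_dualNumber,
    TrivSqZeroExt.fst_sub, ← hc]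
  exact sub_self _

end DualNumbers

section Thickening

/-- A field is a direct summand of each of its extensions. -/
lemma exists_retraction {k K : Type*} [Field k] [Field K] (φ : k →+* K) :
    ∃ l : K →+ k, l 1 = 1 ∧ ∀ c z, l (φ c * z) = c * l z := by
  let _ : Algebra k K := φ.toAlgebra
  obtain ⟨l, hl⟩ := LinearMap.exists_leftInverse_of_injective (Algebra.linearMap k K)
    (LinearMap.ker_eq_bot.2 φ.injective)
  refine ⟨l.toAddMonoidHom, ?_, fun c z => ?_⟩
  · have := LinearMap.congr_fun hl 1
    simpa using this
  · have := l.map_smul c z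
    rw [Algebra.smul_def] at this
    exact this

variable (O : Type u) [CommRing O] [IsLocalRing O] {R : Type*} [CommRing R] [IsLocalRing R]
  [Algebra O R] [IsLocalHom (algebraMap O R)]

/-- The pairs `(z, z')` of elements of `R` which are congruent modulo `a` and reduce to the image
of the residue field of `O`. -/
def thickening (a : R) : Subalgebra O (R × R) where
  carrier := {z | (∃ c : O, residue R z.1 = residue R (algebraMap O R c)) ∧ a ∣ z.2 - z.1}
  mul_mem' := by
    rintro ⟨x, x'⟩ ⟨y, y'⟩ ⟨⟨c, hc⟩, hx⟩ ⟨⟨d, hd⟩, hy⟩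
    refine ⟨⟨c * d, by simp only [Prod.mk_mul_mk, map_mul] at *; rw [hc, hd]⟩, ?_⟩
    have h : x' * y' - x * y = (x' - x) * y' + (y' - y) * x := by ring
    change a ∣ x' * y' - x * y
    rw [h]
    exact dvd_add (hx.mul_right _) (hy.mul_right _)
  add_mem' := by
    rintro ⟨x, x'⟩ ⟨y, y'⟩ ⟨⟨c, hc⟩, hx⟩ ⟨⟨d, hd⟩, hy⟩
    refine ⟨⟨c + d, by simp only [Prod.mk_add_mk, map_add] at *; rw [hc, hd]⟩, ?_⟩
    have h : (x' + y') - (x + y) = (x' - x) + (y' - y) := by ring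
    change a ∣ (x' + y') - (x + y)
    rw [h]
    exact dvd_add hx hy
  algebraMap_mem' c := ⟨⟨c, rfl⟩, by simp⟩

variable {O}

/-- The tangent map `(z, z') ↦ z + ((z' - z) / a) ε`, followed by a retraction of residue
fields. -/
lemma exists_tangent_map [IsDomain R] {a : R} (ha : a ≠ 0) (ha' : a ∈ maximalIdeal R) :
    ∃ θ : thickening O a →ₐ[O] DualNumber (ResidueField O),
      (∀ (z : thickening O a) (c : O), residue R z.1.1 = residue R (algebraMap O R c) →
        (θ z).fst = residue O c) ∧
      (∀ z : thickening O a, z.1.2 = z.1.1 → (θ z).snd = 0) ∧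
      ∀ z : thickening O a, z.1.2 = z.1.1 + a → (θ z).snd = 1 := by
  obtain ⟨l, hl1, hl⟩ := exists_retraction (residueMap O R : ResidueField O →+* ResidueField R)
  have hlc : ∀ c : O, l (residue R (algebraMap O R c)) = residue O c := fun c => by
    have := hl (residue O c) 1
    rw [mul_one, hl1, mul_one] at this
    exact this
  choose e he using fun z : thickening O a => z.2.2
  have huniq : ∀ (z : thickening O a) (w : R), z.1.2 - z.1.1 = a * w → e z = w := fun z w hw =>
    mul_left_cancel₀ ha ((he z).symm.trans hw)
  have hmul : ∀ (z : thickening O a) (w : ResidueField R),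
      l (residue R z.1.1 * w) = l (residue R z.1.1) * l w := by
    intro z w
    obtain ⟨c, hc⟩ := z.2.1
    rw [hc, hlc]
    exact hl (residue O c) w
  have hres : ∀ z : thickening O a, residue R z.1.2 = residue R z.1.1 := by
    intro z
    rw [← sub_eq_zero, ← map_sub, he z, map_mul, (residue_eq_zero_iff a).2 ha', zero_mul]
  let θ : thickening O a →ₐ[O] DualNumber (ResidueField O) :=
    { toFun := fun z => TrivSqZeroExt.inl (l (residue R z.1.1)) +
        TrivSqZeroExt.inr (l (residue R (e z)))
      map_one' := by
        rw [huniq 1 0 (by simp)]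
        ext <;> simp [hl1]
      map_zero' := by
        rw [huniq 0 0 (by simp)]
        ext <;> simp
      map_add' := fun z w => by
        rw [huniq (z + w) (e z + e w) (by
          rw [mul_add, ← he, ← he]
          simp only [Subalgebra.coe_add, Prod.fst_add, Prod.snd_add]
          ring)]
        ext <;> simp
      map_mul' := fun z w => by
        rw [huniq (z * w) (z.1.2 * e w + w.1.1 * e z) (by
          rw [mul_add, mul_left_comm, ← he, mul_left_comm, ← he]
          simp only [Subalgebra.coe_mul, Prod.fst_mul, Prod.snd_mul]
          ring)]
        ext
        · simp [hmul]
        · simp [hmul, hres, mul_comm]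
      commutes' := fun c => by
        rw [huniq (algebraMap O _ c) 0 (by simp)]
        ext
        · simp only [TrivSqZeroExt.fst_add, TrivSqZeroExt.fst_inl, TrivSqZeroExt.fst_inr, add_zero]
          exact hlc c
        · simp only [map_zero, TrivSqZeroExt.snd_add, TrivSqZeroExt.snd_inl,
            TrivSqZeroExt.snd_inr, add_zero]
          rfl }
  refine ⟨θ, fun z c hc => ?_, fun z hz => ?_, fun z hz => ?_⟩
  · change (TrivSqZeroExt.inl (l (residue R z.1.1)) +
        TrivSqZeroExt.inr (l (residue R (e z))) : DualNumber (ResidueField O)).fst = _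
    rw [hc, hlc]
    simp
  · change (TrivSqZeroExt.inl (l (residue R z.1.1)) +
        TrivSqZeroExt.inr (l (residue R (e z))) : DualNumber (ResidueField O)).snd = _
    rw [huniq z 0 (by rw [hz, sub_self, mul_zero])]
    simp
  · change (TrivSqZeroExt.inl (l (residue R z.1.1)) +
        TrivSqZeroExt.inr (l (residue R (e z))) : DualNumber (ResidueField O)).snd = _
    rw [huniq z 1 (by rw [hz, add_sub_cancel_left, mul_one])]
    simp [hl1]

end Thickening

/-- Homomorphisms of formal modules over a subring of a product can be tested on the factors. -/
lemma FormalModule.IsHom.of_map_pair {O D R S : Type*} [CommRing O] [CommRing D] [CommRing R]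
    [CommRing S] [Algebra O D] [Algebra O R] [Algebra O S] (p : D →ₐ[O] R) (p' : D →ₐ[O] S)
    (hinj : ∀ a b, p a = p b → p' a = p' b → a = b) {G G' : FormalModule O D} {f : PowerSeries D}
    (h : (G.map p).IsHom (G'.map p) (f.map (p : D →+* R)))
    (h' : (G.map p').IsHom (G'.map p') (f.map (p' : D →+* S))) : G.IsHom G' f := by
  have hext : ∀ {ι : Type} {A B : MvPowerSeries ι D},
      A.map (p : D →+* R) = B.map (p : D →+* R) → A.map (p' : D →+* S) = B.map (p' : D →+* S) →
      A = B := by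
    intro ι A B hA hB
    ext m
    refine hinj _ _ ?_ ?_
    · have := congrArg (MvPowerSeries.coeff m) hA
      rwa [MvPowerSeries.coeff_map, MvPowerSeries.coeff_map] at this
    · have := congrArg (MvPowerSeries.coeff m) hB
      rwa [MvPowerSeries.coeff_map, MvPowerSeries.coeff_map] at this
  have hf0 : PowerSeries.constantCoeff f = 0 := by
    have h1 := h.constantCoeff
    have h2 := h'.constantCoeff
    rw [← PowerSeries.coeff_zero_eq_constantCoeff_apply, PowerSeries.coeff_map,
      PowerSeries.coeff_zero_eq_constantCoeff_apply] at h1 h2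
    exact hinj _ _ (h1.trans (map_zero p).symm) (h2.trans (map_zero p').symm)
  refine ⟨hf0, hext ?_ ?_, fun x => hext ?_ ?_⟩
  · rw [G.map_subst_law p, G'.map_law_subst p hf0]; exact h.map_add
  · rw [G.map_subst_law p', G'.map_law_subst p' hf0]; exact h'.map_add
  · exact (PowerSeries.map_subst (PowerSeries.HasSubst.of_constantCoeff_zero
      (G.act_constantCoeff x)) f).trans ((h.map_act x).trans (PowerSeries.map_subst
        (PowerSeries.HasSubst.of_constantCoeff_zero hf0) (G'.act x)).symm)
  · exact (PowerSeries.map_subst (PowerSeries.HasSubst.of_constantCoeff_zero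
      (G.act_constantCoeff x)) f).trans ((h'.map_act x).trans (PowerSeries.map_subst
        (PowerSeries.HasSubst.of_constantCoeff_zero hf0) (G'.act x)).symm)

section Main

variable {F : Type u} {L : Type v} [NormedField F] [IsUltrametricDist F]
  [NormedField L] [IsUltrametricDist L] [NormedAlgebra F L] {σ : Type*}

lemma Point.residue_apply (x : Point F L σ) (b : MvPowerSeries σ (ValRing F)) :
    residue (ValRing L) (x.1 b) =
      residue (ValRing L) (algebraMap (ValRing F) (ValRing L) (MvPowerSeries.constantCoeff b)) := by
  rw [← x.1.commutes, ← sub_eq_zero, ← map_sub, ← map_sub, ← norm_lt_one_iff_residue_eq_zero]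
  refine x.norm_lt_one ?_
  simp [MvPowerSeries.isUnit_iff_constantCoeff, MvPowerSeries.algebraMap_apply]

/-- Two fibres of the universal deformation which are isomorphic by an isomorphism lifting the
identity lie over the same point. Otherwise, let `a` be the largest difference of the coordinates:
the isomorphism is the identity modulo `a`, and dividing by `a` gives a `⋆`-isomorphism between two
different first-order deformations, over the dual numbers. -/
lemma point_eq_of_isHom_lift_id [Finite σ]
    {G₀ : FormalModule (ValRing F) (ResidueField (ValRing F))}
    {U : FormalModule (ValRing F) (MvPowerSeries σ (ValRing F))}
    (hU : IsUniversalDeformation G₀ U) (x x' : Point F L σ) {g : PowerSeries (ValRing L)}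
    (hg : (fibre U x).IsHom (fibre U x') g)
    (hgX : g.map (residue (ValRing L)) = PowerSeries.X) {ϖ : ValRing F} {N : ℕ} {rₙ : ℝ}
    (hN : 2 ≤ N) (hP : IsOuterRadius (toField ((fibre U x').act ϖ)) N rₙ) : x = x' := by
  have heq_of : (∀ i, x.1 (MvPowerSeries.X i) = x'.1 (MvPowerSeries.X i)) → x = x' := by
    intro h
    ext b
    have := Point.norm_sub_le x x' le_rfl (fun i => by rw [h i, sub_self, norm_zero]) b
    exact (sub_eq_zero.1 (norm_le_zero_iff.1 this)).symm
  by_contra hne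
  obtain ⟨i₁, hi₁⟩ : ∃ i, x.1 (MvPowerSeries.X i) ≠ x'.1 (MvPowerSeries.X i) := by
    by_contra! h
    exact hne (heq_of h)
  have : Nonempty σ := ⟨i₁⟩
  obtain ⟨i, hi⟩ := Finite.exists_max fun i =>
    ‖((x'.1 (MvPowerSeries.X i) : ValRing L) : L) - (x.1 (MvPowerSeries.X i) : ValRing L)‖
  set a : ValRing L := x'.1 (MvPowerSeries.X i) - x.1 (MvPowerSeries.X i) with ha
  have ha0 : a ≠ 0 := by
    intro h0
    have h1 := hi i₁
    have h2 : ((x'.1 (MvPowerSeries.X i) : ValRing L) : L) -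
        (x.1 (MvPowerSeries.X i) : ValRing L) = 0 :=
      congrArg Subtype.val h0
    rw [h2, norm_zero, norm_le_zero_iff, sub_eq_zero] at h1
    exact hi₁ (Subtype.ext h1).symm
  have hdvd : ∀ b, a ∣ x'.1 b - x.1 b := fun b =>
    dvd_of_norm_le ha0 (Point.norm_sub_le x x' (norm_nonneg _) hi b)
  have ham : a ∈ maximalIdeal (ValRing L) := by
    rw [← residue_eq_zero_iff, ha, map_sub, x.residue_apply, x'.residue_apply, sub_self]
  have hcongr : (Ideal.Quotient.mkₐ (ValRing F) (Ideal.span {a})).comp x.1 =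
      (Ideal.Quotient.mkₐ (ValRing F) (Ideal.span {a})).comp x'.1 := by
    ext b
    refine (Ideal.Quotient.eq.2 ?_).symm
    exact Ideal.mem_span_singleton.2 (hdvd b)
  have hgdvd := hg.dvd_coeff_sub_X hgX hN hP ha0
    (by rw [FormalModule.map_comp, FormalModule.map_comp, hcongr])
  -- the points `(x, x)` and `(x, x')` of the thickening, and the homomorphism `(T, g)`
  let D := thickening (ValRing F) a
  let φ : MvPowerSeries σ (ValRing F) →ₐ[ValRing F] D := (x.1.prod x.1).codRestrict D
    fun b => ⟨⟨_, x.residue_apply b⟩, by simp⟩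
  let φ' : MvPowerSeries σ (ValRing F) →ₐ[ValRing F] D := (x.1.prod x'.1).codRestrict D
    fun b => ⟨⟨_, x.residue_apply b⟩, hdvd b⟩
  let γ : PowerSeries D := PowerSeries.mk fun k =>
    ⟨(PowerSeries.coeff k PowerSeries.X, PowerSeries.coeff k g),
      ⟨if k = 1 then 1 else 0, by
        rw [PowerSeries.coeff_X]
        split_ifs <;> simp⟩, hgdvd k⟩
  let p : D →ₐ[ValRing F] ValRing L := (AlgHom.fst (ValRing F) (ValRing L) (ValRing L)).comp D.val
  let p' : D →ₐ[ValRing F] ValRing L := (AlgHom.snd (ValRing F) (ValRing L) (ValRing L)).comp D.val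
  have hγ : (U.map φ).IsHom (U.map φ') γ := by
    have hγp : γ.map (p : D →+* ValRing L) = PowerSeries.X := by
      ext k
      rw [PowerSeries.coeff_map, PowerSeries.coeff_mk]
      rfl
    have hγp' : γ.map (p' : D →+* ValRing L) = g := by
      ext k
      rw [PowerSeries.coeff_map, PowerSeries.coeff_mk]
      rfl
    refine FormalModule.IsHom.of_map_pair p p'
      (fun z w h h' => Subtype.ext (Prod.ext h h')) ?_ ?_
    · rw [hγp, FormalModule.map_comp, FormalModule.map_comp]
      exact (fibre U x).isHom_X
    · rw [hγp', FormalModule.map_comp, FormalModule.map_comp]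
      exact hg
  obtain ⟨θ, hθ, hθ0, hθ1⟩ := exists_tangent_map (O := ValRing F) ha0 ham
  have hfst : ∀ (b : MvPowerSeries σ (ValRing F)) (z : D), z.1.1 = x.1 b →
      (θ z).fst = residue (ValRing F) (MvPowerSeries.constantCoeff b) := fun b z hz =>
    hθ z _ (by rw [hz, x.residue_apply])
  have hlocal : ∀ χ : MvPowerSeries σ (ValRing F) →ₐ[ValRing F] D, (∀ b, (χ b).1.1 = x.1 b) →
      IsLocalHom (θ.comp χ) := by
    refine fun χ hχ => ⟨fun b hb => ?_⟩
    rw [TrivSqZeroExt.isUnit_iff_isUnit_fst, AlgHom.comp_apply, hfst b _ (hχ b)] at hb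
    rw [MvPowerSeries.isUnit_iff_constantCoeff]
    exact isUnit_of_map_unit (residue (ValRing F)) _ hb
  have hφl := hlocal φ fun b => rfl
  have hφl' := hlocal φ' fun b => rfl
  have hstar : StarIsomorphic (U.map (θ.comp φ)) (U.map (θ.comp φ')) := by
    refine ⟨γ.map (θ : D →+* DualNumber (ResidueField (ValRing F))), ?_, ?_⟩
    · rw [← FormalModule.map_comp, ← FormalModule.map_comp]
      exact hγ.map θ
    · ext k
      rw [PowerSeries.coeff_map, PowerSeries.coeff_map, ← sub_eq_zero]
      have h1 : PowerSeries.coeff k (PowerSeries.X :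
          PowerSeries (ResidueField (DualNumber (ResidueField (ValRing F))))) =
          residue _ (PowerSeries.coeff k PowerSeries.X) := by
        rw [PowerSeries.coeff_X, PowerSeries.coeff_X]
        split_ifs <;> simp
      rw [h1, ← map_sub, residue_eq_zero_iff, mem_maximalIdeal_dualNumber, TrivSqZeroExt.fst_sub,
        sub_eq_zero]
      have h2 := hθ (PowerSeries.coeff k γ) (if k = 1 then 1 else 0) (by
        rw [PowerSeries.coeff_mk]
        change residue _ (PowerSeries.coeff k PowerSeries.X) = _
        rw [PowerSeries.coeff_X]
        split_ifs <;> simp)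
      refine h2.trans ?_
      rw [PowerSeries.coeff_X]
      split_ifs <;> simp
  have hrefl : StarIsomorphic (U.map (θ.comp φ')) (U.map (θ.comp φ')) :=
    ⟨PowerSeries.X, FormalModule.isHom_X _, by simp⟩
  have hsame : θ.comp φ = θ.comp φ' :=
    (hU.2 (DualNumber (ResidueField (ValRing F))) residueMap_dualNumber_bijective
      (U.map (θ.comp φ')) (hU.1.map _ hφl')).unique ⟨hφl, hstar⟩ ⟨hφl', hrefl⟩
  have h1 := congrArg TrivSqZeroExt.snd (DFunLike.congr_fun hsame (MvPowerSeries.X i))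
  rw [AlgHom.comp_apply, AlgHom.comp_apply, hθ0 _ rfl, hθ1 _ (by
    change x'.1 (MvPowerSeries.X i) = x.1 (MvPowerSeries.X i) + a
    rw [ha]; ring)] at h1
  exact zero_ne_one h1

end Main

end LubinTate

end

theorem proposition4p2 (p : ℕ) [Fact p.Prime]
    (F : Type u) [NormedField F] [IsUltrametricDist F] [NormedAlgebra ℚ_[p] F]
    [FiniteDimensional ℚ_[p] F]
    (ϖ : LubinTate.ValRing F) (hϖ : Irreducible ϖ)
    (n : ℕ) (hn : 1 ≤ n)
    (G₀ : LubinTate.FormalModule (LubinTate.ValRing F) (IsLocalRing.ResidueField (LubinTate.ValRing F)))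
    (hG₀ : LubinTate.HasHeight ϖ G₀ n)
    (U : LubinTate.FormalModule (LubinTate.ValRing F)
      (MvPowerSeries (Fin (n - 1)) (LubinTate.ValRing F)))
    (hU : LubinTate.IsUniversalDeformation G₀ U)
    (L : Type v) [NormedField L] [IsUltrametricDist L] [NormedAlgebra F L] [CompleteSpace L]
    (x x' : LubinTate.Point F L (Fin (n - 1)))
    (hx : x ∈ LubinTate.domainH L ϖ n U) (hx' : x' ∈ LubinTate.domainH L ϖ n U)
    (f : PowerSeries (LubinTate.ValRing L))
    (hf : (LubinTate.fibre U x).IsIsogeny (LubinTate.fibre U x') f)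
    (hf_pow : LubinTate.DeformsPower ϖ G₀ f) :
    x = x' := by
  obtain ⟨m, hm⟩ := hf_pow
  have hG := hU.1.map x.1 x.2
  have hG' := hU.1.map x'.1 x'.2
  obtain ⟨g, hg, hgX⟩ :=
    LubinTate.exists_isHom_lift_id hϖ hn hG₀ hG hG' hx hx' m f hf.toIsHom hm
  obtain ⟨rₙ, -, hrₙ, -, -⟩ := LubinTate.exists_radii hϖ hn hG₀ hG' hx'
  have hq := hG₀.two_le_card hn
  exact LubinTate.point_eq_of_isHom_lift_id hU x x' hg hgX
    (Nat.one_lt_pow (by omega) (by omega)) hrₙ
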